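/- Let $m,r\ge 0$, let $\alpha^1,\dots,\alpha^m\in\mathbb C$ be nonzero and pairwise distinct, $\delta\in\mathbb C$, $t=(t_1,\dots,t_r)\in\mathbb C^r$. Let $h^{(i)}_n$ be the polynomials in $(u_s)_{s\in\mathbb Z}$ with $h^{(0)}_n=\frac12$ and $$h^{(i+1)}_n=u_n\sum_{s=0}^i\bigl(h^{(s)}_{n+1}+h^{(s)}_n\bigr)\bigl(h^{(i-s)}_n+h^{(i-s)}_{n-1}\bigr)-\sum_{s=1}^i h^{(s)}_nh^{(i+1-s)}_n .$$ Consider, for complex sequences $u_n,y^1_n,\dots,y^m_n$ ($n\in\mathbb Z$) and parameters $\omega^1,\dots,\omega^m,\varepsilon\in\mathbb C$, the system $$(\ast)\qquad u_n(y^j_{n+1}+y^j_n)(y^j_n+y^j_{n-1})=\alpha^j\bigl((y^j_n)^2-(\omega^j)^2\bigr)\ (1\le j\le m),\qquad 2\sum_{i=1}^r i\,t_ih^{(i)}_n+n-\delta+(-1)^n\varepsilon=\sum_{j=1}^m y^j_n ,$$ and the evolution equations $$(\ast\ast)\qquad u_{n,t_i}=u_n\bigl(h^{(i)}_{n+1}-h^{(i)}_{n-1}\bigr),\qquad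 y^j_{n,t_i}=h^{(i)}_{n,\xi^j}\quad(1\le i\le r),$$ where $\xi^j$ denotes differentiation of polynomials in $u$ along $u_{n,\xi^j}=u_n(y^j_{n+1}-y^j_{n-1})$, and where $\alpha^j,\delta,\omega^j,\varepsilon$ are constants. A tuple $(\omega,\varepsilon,u,y)$ is called nondegenerate if $y^j_n+y^j_{n-1}\ne0$ and $(y^j_n)^2\ne(\omega^j)^2$ for all $j,n$. For $1\le k\le m$, let $A_k$ be the map that changes $\omega^k$ to $-\omega^k$ and nothing else, and let $B_k$ be the rational map $$\tilde\omega^k=1-\omega^k,\quad \tilde\omega^j=\omega^j\ (j\ne k),\quad \tilde\varepsilon=-\varepsilon,\quad \tilde u_n=u_n\frac{(y^k_{n+1}-\omega^k)(y^k_{n-1}+\omega^k)}{(y^k_n)^2-(\omega^k)^2},$$ $$\tilde y^j_n=\frac1{\alpha^j-\alpha^k}\Bigl((\alpha^j+\alpha^k)y^j_n-\alpha^k(y^k_n+\omega^k)\frac{y^j_{n+1}+y^j_n}{y^k_{n+1}+y^k_n}-\alpha^k(y^k_n-\omega^k)\frac{y^j_n+y^j_{n-1}}{y^k_n+y^k_{n-1}}\Bigr)\quad(j\ne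 k),$$ $$\tilde y^k_n=-\sum_{j\ne k}\tilde y^j_n+2\sum_{i=1}^r i\,t_i\,h^{(i)}_n(\tilde u)+n-\delta-(-1)^n\varepsilon .$$ 1. $A_k$ maps solutions of $(\ast)$ to solutions of $(\ast)$ with the changed parameters, and so does $B_k$ on nondegenerate solutions. 2. The maps are consistent with $(\ast\ast)$: if a family of tuples depending on $t$ (with $\omega,\varepsilon$ constant) satisfies $(\ast\ast)$ at a point $t$ and is a solution of $(\ast)$ at that point, then its image under $A_k$ satisfies $(\ast\ast)$ at $t$, and so does its image under $B_k$ if the tuple at $t$ is nondegenerate. 3. $A_k^2=\mathrm{id}$, $A_jA_k=A_kA_j$, $B_k^2=\mathrm{id}$, and $B_jB_k=B_kB_j$, $A_jB_k=B_kA_j$ for $j\ne k$; the relations between the rational maps $B$ hold at every nondegenerate solution $S$ for which the intermediate tuples ($B_kS$, and $B_jS$) are nondegenerate as well. 4. Let $t\neq0$ and let $X$ be the set of the solutions of $(\ast)$ whose images under all compositions of the maps $A_1,B_1,\dots,A_m,B_m$ are nondegenerate. Then the $A_k,B_k$ act on $X$ by permutations, and the group that they generate is isomorphic to the semidirect product $\mathbb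 Z^m\rtimes\mathbb Z_2^m$, where $\mathbb Z_2^m=\{1,-1\}^m$ acts on $\mathbb Z^m$ by changing the signs of the coordinates. The isomorphism can be chosen so that an element corresponding to $(\nu,\sigma)\in\mathbb Z^m\rtimes\{1,-1\}^m$ transforms the parameters by $\omega^k\mapsto\sigma_k\omega^k+\nu_k$; in particular, the elements of $\mathbb Z^m$ shift the $\omega^k$ by integers. -/

import Mathlib

noncomputable section

namespace Volterra

open MvPolynomial

/-- The homogeneous polynomials `h^{(i)}_n` in the variables `u_s`, `s ∈ ℤ`, of the Volterra
hierarchy, given by `h^{(0)}_n = 1/2` and the recurrence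
`h^{(i+1)}_n = u_n ∑_{s=0}^{i} (h^{(s)}_{n+1} + h^{(s)}_n) (h^{(i-s)}_n + h^{(i-s)}_{n-1})
  - ∑_{s=1}^{i} h^{(s)}_n h^{(i+1-s)}_n`. -/
def h : ℕ → ℤ → MvPolynomial ℤ ℂ
  | 0, _ => C (1 / 2)
  | i + 1, n =>
      X n * ∑ s : Fin (i + 1),
          (h s (n + 1) + h s n) * (h (i - s) n + h (i - s) (n - 1))
        - ∑ s : Fin i, h (s + 1) n * h (i - s) n
termination_by i => i
decreasing_by all_goals omega

/-- The value of `h^{(i)}_n` on a sequence `u`. -/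
def hVal (i : ℕ) (n : ℤ) (u : ℤ → ℂ) : ℂ := eval u (h i n)

/-- The derivative `h^{(i)}_{n,ξ}` of `h^{(i)}_n` along the flow
`u_{s,ξ} = u_s (y_{s+1} - y_{s-1})`. -/
def hXi (i : ℕ) (n : ℤ) (u y : ℤ → ℂ) : ℂ :=
  ∑ s ∈ (h i n).vars, eval u (pderiv s (h i n)) * (u s * (y (s + 1) - y (s - 1)))

/-- The parameters `ω^j`, `ε` that the transformations change, together with the
sequences `u_n` and `y^j_n`. -/
@[ext]
structure State (m : ℕ) where
  ω : Fin m → ℂ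
  ε : ℂ
  u : ℤ → ℂ
  y : Fin m → ℤ → ℂ

variable {m r : ℕ}

/-- `2 ∑_{i=1}^{r} i t_i h^{(i)}_n(u)`; the time `t_i` is `t (i - 1)`. -/
def timeSum (t : Fin r → ℂ) (u : ℤ → ℂ) (n : ℤ) : ℂ :=
  2 * ∑ i : Fin r, ((i : ℂ) + 1) * t i * hVal (i + 1) n u

/-- `(-1)^n` for an integer `n`. -/
def sgn (n : ℤ) : ℂ := (-1 : ℂ) ^ n

/-- The non-autonomous system of difference equations. -/
structure IsSolution (α : Fin m → ℂ) (δ : ℂ) (t : Fin r → ℂ) (S : State m) : Prop where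
  local_eq : ∀ j n, S.u n * (S.y j (n + 1) + S.y j n) * (S.y j n + S.y j (n - 1)) =
    α j * (S.y j n ^ 2 - S.ω j ^ 2)
  sum_eq : ∀ n, timeSum t S.u n + n - δ + sgn n * S.ε = ∑ j, S.y j n

/-- The nondegenerate states: the coefficients `y^j_n + y^j_{n-1}`, by which one divides when the
system is solved for `y^j_{n+1}`, and the other denominators `(y^j_n)^2 - (ω^j)^2` of the
maps `B_j` do not vanish. -/
def Nondegenerate (S : State m) : Prop :=
  ∀ j n, S.y j n + S.y j (n - 1) ≠ 0 ∧ S.y j n ^ 2 - S.ω j ^ 2 ≠ 0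

/-- The sign change `A_k`. -/
def A (k : Fin m) (S : State m) : State m :=
  { S with ω := Function.update S.ω k (-S.ω k) }

/-- The sequence `ũ_n` of `B_k`. -/
def Bu (k : Fin m) (S : State m) (n : ℤ) : ℂ :=
  S.u n * ((S.y k (n + 1) - S.ω k) * (S.y k (n - 1) + S.ω k)) / (S.y k n ^ 2 - S.ω k ^ 2)

/-- The sequences `ỹ^j_n` of `B_k` for `j ≠ k`. -/
def ByOff (α : Fin m → ℂ) (k : Fin m) (S : State m) (j : Fin m) (n : ℤ) : ℂ :=
  1 / (α j - α k) *
    ((α j + α k) * S.y j n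
      - α k * (S.y k n + S.ω k) *
          ((S.y j (n + 1) + S.y j n) / (S.y k (n + 1) + S.y k n))
      - α k * (S.y k n - S.ω k) *
          ((S.y j n + S.y j (n - 1)) / (S.y k n + S.y k (n - 1))))

/-- The sequence `ỹ^k_n` of `B_k`. -/
def ByDiag (α : Fin m → ℂ) (δ : ℂ) (t : Fin r → ℂ) (k : Fin m) (S : State m) (n : ℤ) : ℂ :=
  -(∑ j ∈ Finset.univ.erase k, ByOff α k S j n) + timeSum t (Bu k S) n + n - δ - sgn n * S.ε

/-- The rational map `B_k`. It is used on the nondegenerate states only. -/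
def B (α : Fin m → ℂ) (δ : ℂ) (t : Fin r → ℂ) (k : Fin m) (S : State m) : State m where
  ω := Function.update S.ω k (1 - S.ω k)
  ε := -S.ε
  u := Bu k S
  y j := if j = k then ByDiag α δ t k S else ByOff α k S j

/-- The evolution equations in `t_1, …, t_r` at the point `t`, for a family of states that
depends on `t` (with constant `ω^j` and `ε`):
`u_{n,t_i} = u_n (h^{(i)}_{n+1} - h^{(i)}_{n-1})` and `y^j_{n,t_i} = h^{(i)}_{n,ξ^j}`. -/
def FlowsAt (t : Fin r → ℂ) (S : (Fin r → ℂ) → State m) : Prop :=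
  (∀ s, (S s).ω = (S t).ω ∧ (S s).ε = (S t).ε) ∧
  (∀ (i : Fin r) (n : ℤ),
    HasDerivAt (fun z : ℂ => (S (Function.update t i z)).u n)
      ((S t).u n * (hVal (i + 1) (n + 1) (S t).u - hVal (i + 1) (n - 1) (S t).u)) (t i)) ∧
  (∀ (i : Fin r) (j : Fin m) (n : ℤ),
    HasDerivAt (fun z : ℂ => (S (Function.update t i z)).y j n)
      (hXi (i + 1) n (S t).u ((S t).y j)) (t i))

/-- The transformation named by a letter: `A_k` for `inl k` and `B_k` for `inr k`. -/
def letter (α : Fin m → ℂ) (δ : ℂ) (t : Fin r → ℂ) : Fin m ⊕ Fin m → State m → State m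
  | .inl k => A k
  | .inr k => B α δ t k

/-- The composition of the transformations named by a word. -/
def applyWord (α : Fin m → ℂ) (δ : ℂ) (t : Fin r → ℂ) (w : List (Fin m ⊕ Fin m))
    (S : State m) : State m :=
  w.foldr (letter α δ t) S

/-- The solutions on which all compositions of the maps `A_k` and `B_k` are defined
(their values are nondegenerate). -/
def Regular (α : Fin m → ℂ) (δ : ℂ) (t : Fin r → ℂ) : Type :=
  {S : State m // IsSolution α δ t S ∧
    ∀ w : List (Fin m ⊕ Fin m), Nondegenerate (applyWord α δ t w S)}

/-- The group `ℤ_2^m = {1, -1}^m` acts on `ℤ^m` by changing the signs of the coordinates. -/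
def signAction (m : ℕ) : (Fin m → ℤˣ) →* MulAut (Multiplicative (Fin m → ℤ)) where
  toFun σ :=
    { toFun := fun v => Multiplicative.ofAdd fun k => (σ k : ℤ) * v.toAdd k
      invFun := fun v => Multiplicative.ofAdd fun k => (σ k : ℤ) * v.toAdd k
      left_inv := fun v => by
        apply Multiplicative.toAdd.injective
        funext k
        simp [← mul_assoc, ← Units.val_mul]
      right_inv := fun v => by
        apply Multiplicative.toAdd.injective
        funext k
        simp [← mul_assoc, ← Units.val_mul]
      map_mul' := fun v w => by
        apply Multiplicative.toAdd.injective
        funext k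
        simp [mul_add] }
  map_one' := by
    ext v
    simp
  map_mul' σ τ := by
    ext v
    simp [mul_assoc]

/-- The group `ℤ^m ⋊ ℤ_2^m`. -/
abbrev ShiftSignGroup (m : ℕ) : Type :=
  SemidirectProduct (Multiplicative (Fin m → ℤ)) (Fin m → ℤˣ) (signAction m)

end Volterra

end

/-! The map $B_k$ is a Darboux transformation. The generating series $H_n=\sum_i h^{(i)}_nX^i$
satisfies $X\,u_n(H_{n+1}+H_n)(H_n+H_{n-1})=H_n^2-\frac14$, and each $y^j$ satisfies an equation of
the same shape, $u_n(y_{n+1}+y_n)(y_n+y_{n-1})=\alpha^j(y_n^2-(\omega^j)^2)$. Both are instances of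
$p\,u_n(y_{n+1}+y_n)(y_n+y_{n-1})=q(y_n^2-c)$, so every argument about this equation serves $H$ and
the $y^j$ at once.

Put $a_n=(y^k_n-\omega^k)/(y^k_n+y^k_{n-1})$ (`aVar`) and $L_ay_n=(1-a_n)y_n-a_ny_{n-1}$
(`firstOrder`). Then $L_ay^k=\omega^k$ and $u_n=\alpha^ka_n(1-a_{n+1})$, so the linear difference
operator behind the quadratic equation factors through $L_a$ and $L_{1-a}$ (`firstOrder_comp`). The
map $B_k$ is the exchange $a\mapsto1-a$. A solution $y$ goes to
$y-\frac{\alpha^kp}{q-\alpha^kp}\Delta L_ay$, where $\Delta v_n=v_{n+1}-v_n$; the image satisfies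
$L_{1-a}\tilde y=-L_ay$ and the quadratic equation with the same $p,q,c$ (`firstOrder_transform`,
`quadratic_transform`). For $H$, uniqueness of the power series solution shows that the image is the
series of $\tilde u$ (`hSeriesB_eq`). For $y^k$ itself $q-\alpha^kp=0$, and the sum equation takes
over: it gives $L_{1-a}\tilde y^k=1-\omega^k$, where the 1 is the increment of the term $n$
(`firstOrder_ByDiag`).

The derivatives of $H$ along a flow solve a linearized equation with a unique solution. Hence the
flows generated by the $y^j$ have closed forms (`dSeries_eigen`), the flows of the hierarchy are
consistent, and Euler's identity holds. The closed forms give the evolution of $\tilde u$ and of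
$\tilde y^j$, $j\ne k$ (`flow_transform`); $\tilde y^k$ follows by differentiating the sum equation,
in which Euler's identity accounts for the explicit time dependence.

Since $a\mapsto1-a$ is an involution, so is $B_k$. Commutativity rests on an explicit rational
formula for the action of $B_k$ on the coefficient of $B_j$ (`aVar_B`). The products $B_kA_k$ then
commute for different $k$, are inverted by $A_k$ and shift $\omega^k$ by 1, which yields a
homomorphism from $\mathbb Z^m\rtimes\mathbb Z_2^m$ onto the generated group. Its action on the
parameters shows that it is injective as soon as, for each $k$, some regular solution has
$2\omega^k\notin\mathbb Z$.

Such a solution is found by transcendence. If $t\ne0$, the equations can be solved forwards and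
backwards from finitely many data at one point. Take these data algebraically independent over the
countable field generated by $\alpha,\delta,t$. The data at another point, or of the image under
some $A_k$ or $B_k$, generate a field that contains the old data; being equally many, they are
independent again (`algebraicIndependent_of_mem_adjoin`). A degeneracy would be an algebraic
relation between independent quantities, so none ever occurs (`GenericSolution.applyWord`). -/

noncomputable section

/-! ### The generating series of the $h^{(i)}_n$ -/

namespace Volterra

open MvPolynomial

/-- The recurrence for `h` as a quadratic convolution identity. -/
theorem h_quadratic (i : ℕ) (n : ℤ) :
    X n * ∑ p ∈ Finset.HasAntidiagonal.antidiagonal i,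
        (h p.1 (n + 1) + h p.1 n) * (h p.2 n + h p.2 (n - 1)) =
      ∑ p ∈ Finset.HasAntidiagonal.antidiagonal (i + 1), h p.1 n * h p.2 n := by
  have e : h (i + 1) n = X n * ∑ p ∈ Finset.HasAntidiagonal.antidiagonal i,
        (h p.1 (n + 1) + h p.1 n) * (h p.2 n + h p.2 (n - 1))
        - ∑ s ∈ Finset.range i, h (s + 1) n * h (i - s) n := by
    rw [h, Finset.Nat.sum_antidiagonal_eq_sum_range_succ
      (fun a b => (h a (n + 1) + h a n) * (h b n + h b (n - 1))), ← Fin.sum_univ_eq_sum_range,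
      ← Fin.sum_univ_eq_sum_range (fun s => h (s + 1) n * h (i - s) n)]
  have h0 : h 0 n = C (1 / 2) := by rw [h]
  rw [Finset.Nat.sum_antidiagonal_eq_sum_range_succ (fun a b => h a n * h b n),
    Finset.sum_range_succ', Finset.sum_range_succ]
  have hc : (C (1 / 2) : MvPolynomial ℤ ℂ) + C (1 / 2) = 1 := by
    rw [← C_add]; norm_num
  have e2 : ∑ s ∈ Finset.range i, h (s + 1) n * h (i + 1 - (s + 1)) n =
      ∑ s ∈ Finset.range i, h (s + 1) n * h (i - s) n := by
    refine Finset.sum_congr rfl fun s _ => ?_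
    rw [Nat.add_sub_add_right]
  rw [e2, Nat.sub_self, Nat.sub_zero, h0]
  linear_combination -e - h (i + 1) n * hc

theorem hVal_zero (n : ℤ) (u : ℤ → ℂ) : hVal 0 n u = 1 / 2 := by
  rw [hVal, h, eval_C]

/-- The generating series `∑ h^{(i)}_n X^i` of the values of the polynomials `h^{(i)}_n`. -/
def hSeries (u : ℤ → ℂ) (n : ℤ) : PowerSeries ℂ := PowerSeries.mk fun i => hVal i n u

@[simp] theorem coeff_hSeries (u : ℤ → ℂ) (n : ℤ) (i : ℕ) :
    PowerSeries.coeff i (hSeries u n) = hVal i n u := PowerSeries.coeff_mk _ _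

@[simp] theorem constantCoeff_hSeries (u : ℤ → ℂ) (n : ℤ) :
    PowerSeries.constantCoeff (hSeries u n) = 1 / 2 := by
  rw [← PowerSeries.coeff_zero_eq_constantCoeff_apply, coeff_hSeries, hVal_zero]

theorem hVal_quadratic (i : ℕ) (n : ℤ) (u : ℤ → ℂ) :
    u n * ∑ p ∈ Finset.HasAntidiagonal.antidiagonal i,
        (hVal p.1 (n + 1) u + hVal p.1 n u) * (hVal p.2 n u + hVal p.2 (n - 1) u) =
      ∑ p ∈ Finset.HasAntidiagonal.antidiagonal (i + 1), hVal p.1 n u * hVal p.2 n u := by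
  simpa [hVal] using congrArg (eval u) (h_quadratic i n)

theorem hSeries_quadratic (u : ℤ → ℂ) (n : ℤ) :
    PowerSeries.X * (PowerSeries.C (u n) * ((hSeries u (n + 1) + hSeries u n) *
      (hSeries u n + hSeries u (n - 1)))) = hSeries u n ^ 2 - PowerSeries.C (1 / 4) := by
  ext i
  cases i with
  | zero => simp; norm_num
  | succ i =>
    rw [PowerSeries.coeff_succ_X_mul, PowerSeries.coeff_C_mul, PowerSeries.coeff_mul, map_sub,
      pow_two, PowerSeries.coeff_mul, PowerSeries.coeff_C]
    simpa using hVal_quadratic i n u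

/-- A sequence of power series that is a multiple of `X` times its neighbours vanishes. -/
theorem series_eq_zero_of_mul_eq {D U P Q R : ℤ → PowerSeries ℂ} (hU : ∀ n, IsUnit (U n))
    (hD : ∀ n, U n * D n = PowerSeries.X * (P n * D (n + 1) + Q n * D n + R n * D (n - 1))) :
    ∀ n, D n = 0 := by
  -- The induction runs over all $n$ at once, because the neighbours enter; each use of `hD` gains
  -- one factor $X$.
  have key : ∀ k : ℕ, ∀ n, PowerSeries.X ^ k ∣ D n := by
    intro k
    induction k with
    | zero => intro n; simp
    | succ k ih =>
      intro n
      rw [← (hU n).dvd_mul_left, hD, pow_succ']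
      exact mul_dvd_mul_left _ (dvd_add (dvd_add ((ih _).mul_left _) ((ih _).mul_left _))
        ((ih _).mul_left _))
  intro n
  ext k
  have := (PowerSeries.X_pow_dvd_iff.1 (key (k + 1) n)) k (Nat.lt_succ_self k)
  simpa using this

theorem isUnit_of_constantCoeff {f : PowerSeries ℂ} (hf : PowerSeries.constantCoeff f ≠ 0) :
    IsUnit f := PowerSeries.isUnit_iff_constantCoeff.2 (isUnit_iff_ne_zero.2 hf)

/-- The quadratic equation determines the generating series. -/
theorem eq_hSeries_of_quadratic {u : ℤ → ℂ} {G : ℤ → PowerSeries ℂ}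
    (h0 : ∀ n, PowerSeries.constantCoeff (G n) = 1 / 2)
    (hG : ∀ n, PowerSeries.X * (PowerSeries.C (u n) * ((G (n + 1) + G n) * (G n + G (n - 1)))) =
      G n ^ 2 - PowerSeries.C (1 / 4)) (n : ℤ) : G n = hSeries u n := by
  -- The difference of the two quadratic equations is linear in $D=G-H$ with the factor $G+H$ on the
  -- right, whose constant term 1 makes it a unit.
  refine sub_eq_zero.1 (series_eq_zero_of_mul_eq (D := fun n => G n - hSeries u n)
    (U := fun n => G n + hSeries u n)
    (P := fun n => PowerSeries.C (u n) * (G n + G (n - 1)))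
    (Q := fun n => PowerSeries.C (u n) *
      ((G n + G (n - 1)) + (hSeries u (n + 1) + hSeries u n)))
    (R := fun n => PowerSeries.C (u n) * (hSeries u (n + 1) + hSeries u n))
    (fun n => isUnit_of_constantCoeff ?_) (fun n => ?_) n)
  · rw [map_add, h0, constantCoeff_hSeries]; norm_num
  · linear_combination hSeries_quadratic u n - hG n

theorem hSeries_add_ne_zero (u : ℤ → ℂ) (n k : ℤ) : hSeries u n + hSeries u k ≠ 0 := by
  intro e
  have := congrArg PowerSeries.constantCoeff e
  rw [map_add, constantCoeff_hSeries, constantCoeff_hSeries, map_zero] at this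
  norm_num at this

/-- In an integral domain the quadratic equation implies a linear one. -/
theorem linear_of_quadratic {R : Type*} [CommRing R] [IsDomain R] {u y : ℤ → R} {p q c : R}
    (hne : ∀ n, y n + y (n - 1) ≠ 0)
    (hy : ∀ n, p * (u n * ((y (n + 1) + y n) * (y n + y (n - 1)))) = q * (y n ^ 2 - c)) (n : ℤ) :
    p * (u n * (y (n + 1) + y n) - u (n - 1) * (y (n - 1) + y (n - 2))) =
      q * (y n - y (n - 1)) := by
  have h1 := hy n
  have h2 := hy (n - 1)
  rw [sub_add_cancel, show n - 1 - 1 = n - 2 by ring] at h2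
  refine mul_right_cancel₀ (hne n) ?_
  linear_combination h1 - h2

/-- In coefficients this is the linear recursion that produces $h^{(i+1)}$ from $h^{(i)}$ up to a
constant of summation. The division it needs is legitimate because $H_n+H_{n-1}$ has constant term
1. -/
theorem hSeries_linear (u : ℤ → ℂ) (n : ℤ) :
    PowerSeries.X * (PowerSeries.C (u n) * (hSeries u (n + 1) + hSeries u n) -
      PowerSeries.C (u (n - 1)) * (hSeries u (n - 1) + hSeries u (n - 2))) =
      hSeries u n - hSeries u (n - 1) := by
  have := linear_of_quadratic (R := PowerSeries ℂ) (u := fun n => PowerSeries.C (u n))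
    (y := hSeries u) (p := PowerSeries.X) (q := 1) (c := PowerSeries.C (1 / 4))
    (fun n => hSeries_add_ne_zero u _ _)
    (fun n => by rw [one_mul]; exact hSeries_quadratic u n) n
  rwa [one_mul] at this

theorem hVal_linear (i : ℕ) (u : ℤ → ℂ) (n : ℤ) :
    u n * (hVal i (n + 1) u + hVal i n u) - u (n - 1) * (hVal i (n - 1) u + hVal i (n - 2) u) =
      hVal (i + 1) n u - hVal (i + 1) (n - 1) u := by
  have := congrArg (PowerSeries.coeff (i + 1)) (hSeries_linear u n)
  simpa [PowerSeries.coeff_succ_X_mul] using this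

end Volterra

/-! ### Derivatives along the flows, consistency of the hierarchy, Euler's identity -/

namespace Volterra

open MvPolynomial

/-- The derivation of the polynomials in `u_s` with `u_s ↦ V_s`. -/
def fieldDerivation (V : ℤ → ℂ) : Derivation ℂ (MvPolynomial ℤ ℂ) (MvPolynomial ℤ ℂ) :=
  mkDerivation ℂ fun s => C (V s)

/-- The derivative of `h^{(i)}_n` at `u` along the vector field `V`. -/
def hDer (i : ℕ) (n : ℤ) (u V : ℤ → ℂ) : ℂ := eval u (fieldDerivation V (h i n))

theorem fieldDerivation_X (V : ℤ → ℂ) (s : ℤ) : fieldDerivation V (X s) = C (V s) :=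
  mkDerivation_X _ _ _

theorem derivation_sum_apply {ι : Type*} (I : Finset ι)
    (D : ι → Derivation ℂ (MvPolynomial ℤ ℂ) (MvPolynomial ℤ ℂ)) (p : MvPolynomial ℤ ℂ) :
    (∑ i ∈ I, D i) p = ∑ i ∈ I, D i p := by
  classical
  induction I using Finset.induction_on with
  | empty => simp
  | insert a I ha ih => rw [Finset.sum_insert ha, Finset.sum_insert ha, Derivation.add_apply, ih]

/-- This identifies the finite sum in `hXi` with the value of a derivation, so that the Leibniz rule
applies. -/
theorem fieldDerivation_eq_sum (V : ℤ → ℂ) (p : MvPolynomial ℤ ℂ) :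
    fieldDerivation V p = ∑ s ∈ p.vars, pderiv s p * C (V s) := by
  have : fieldDerivation V p = (∑ s ∈ p.vars, (C (V s) : MvPolynomial ℤ ℂ) • pderiv (R := ℂ) s :
      Derivation ℂ (MvPolynomial ℤ ℂ) (MvPolynomial ℤ ℂ)) p := by
    refine derivation_eq_of_forall_mem_vars fun i hi => ?_
    rw [fieldDerivation_X, derivation_sum_apply, Finset.sum_eq_single i]
    · simp
    · intro b _ hb
      simp [pderiv_X_of_ne hb.symm]
    · exact fun hh => absurd hi hh
  rw [this, derivation_sum_apply]
  simp [mul_comm]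

/-- The vector field of the flow generated by the sequence `y`. -/
def flowField (u y : ℤ → ℂ) (s : ℤ) : ℂ := u s * (y (s + 1) - y (s - 1))

theorem hXi_eq_hDer (i : ℕ) (n : ℤ) (u y : ℤ → ℂ) :
    hXi i n u y = hDer i n u (flowField u y) := by
  rw [hDer, fieldDerivation_eq_sum, map_sum]
  simp [hXi, flowField]

theorem hasDerivAt_eval {U : ℂ → ℤ → ℂ} {V : ℤ → ℂ} {z : ℂ}
    (hU : ∀ s, HasDerivAt (fun x => U x s) (V s) z) (p : MvPolynomial ℤ ℂ) :
    HasDerivAt (fun x => eval (U x) p) (eval (U z) (fieldDerivation V p)) z := by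
  induction p using MvPolynomial.induction_on with
  | C a => simpa using hasDerivAt_const z a
  | add p q hp hq => 
    rw [map_add, map_add]
    refine (hp.add hq).congr_of_eventuallyEq (Filter.Eventually.of_forall fun x => ?_)
    simp
  | mul_X p s hp =>
    have := hp.mul (hU s)
    rw [Derivation.leibniz, fieldDerivation_X]
    have e : eval (U z) (p • (C (V s) : MvPolynomial ℤ ℂ) + (X s : MvPolynomial ℤ ℂ) • fieldDerivation V p) =
        eval (U z) (fieldDerivation V p) * U z s + eval (U z) p * V s := by
      simp only [smul_eq_mul, map_add, map_mul, eval_C, eval_X]; ring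
    rw [e]
    refine this.congr_of_eventuallyEq (Filter.Eventually.of_forall fun x => ?_)
    simp

theorem hasDerivAt_hVal {U : ℂ → ℤ → ℂ} {V : ℤ → ℂ} {z : ℂ}
    (hU : ∀ s, HasDerivAt (fun x => U x s) (V s) z) (i : ℕ) (n : ℤ) :
    HasDerivAt (fun x => hVal i n (U x)) (hDer i n (U z) V) z :=
  hasDerivAt_eval hU _

theorem hDer_sum {ι : Type*} (I : Finset ι) (i : ℕ) (n : ℤ) (u : ℤ → ℂ) (c : ι → ℂ)
    (V : ι → ℤ → ℂ) :
    hDer i n u (fun s => ∑ k ∈ I, c k * V k s) = ∑ k ∈ I, c k * hDer i n u (V k) := by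
  simp only [hDer, fieldDerivation_eq_sum, map_sum, map_mul, eval_C, Finset.mul_sum]
  rw [Finset.sum_comm]
  refine Finset.sum_congr rfl fun k _ => Finset.sum_congr rfl fun s _ => ?_
  ring

theorem hDer_add (i : ℕ) (n : ℤ) (u V W : ℤ → ℂ) :
    hDer i n u (fun s => V s + W s) = hDer i n u V + hDer i n u W := by
  simp only [hDer, fieldDerivation_eq_sum, map_sum, map_mul, eval_C, ← Finset.sum_add_distrib,
    mul_add]

theorem hDer_smul (i : ℕ) (n : ℤ) (u V : ℤ → ℂ) (c : ℂ) :
    hDer i n u (fun s => c * V s) = c * hDer i n u V := by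
  simp only [hDer, fieldDerivation_eq_sum, map_sum, map_mul, eval_C, Finset.mul_sum]
  exact Finset.sum_congr rfl fun s _ => by ring

theorem hDer_zero (n : ℤ) (u V : ℤ → ℂ) : hDer 0 n u V = 0 := by
  rw [hDer, h, ← algebraMap_eq, Derivation.map_algebraMap, map_zero]

/-- The generating series of the derivatives of the `h^{(i)}_n` along a vector field. -/
def dSeries (u V : ℤ → ℂ) (n : ℤ) : PowerSeries ℂ := PowerSeries.mk fun i => hDer i n u V

@[simp] theorem coeff_dSeries (u V : ℤ → ℂ) (n : ℤ) (i : ℕ) :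
    PowerSeries.coeff i (dSeries u V n) = hDer i n u V := PowerSeries.coeff_mk _ _

/-- Leibniz's rule applied to the polynomial identity `h_quadratic` and evaluated at $u$. It is a
linear equation for the derivative series, with an inhomogeneity given by $V$. -/
theorem dSeries_quadratic (u V : ℤ → ℂ) (n : ℤ) :
    PowerSeries.X * (PowerSeries.C (V n) * ((hSeries u (n + 1) + hSeries u n) *
        (hSeries u n + hSeries u (n - 1))) +
      PowerSeries.C (u n) * ((dSeries u V (n + 1) + dSeries u V n) *
        (hSeries u n + hSeries u (n - 1)) +
        (hSeries u (n + 1) + hSeries u n) * (dSeries u V n + dSeries u V (n - 1)))) =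
      2 * (hSeries u n * dSeries u V n) := by
  ext i
  cases i with
  | zero =>
    have h0 : PowerSeries.constantCoeff (dSeries u V n) = 0 := by
      rw [← PowerSeries.coeff_zero_eq_constantCoeff_apply, coeff_dSeries, hDer_zero]
    simp [two_mul, h0]
  | succ i =>
    have key := congrArg (fun p => eval u (fieldDerivation V p)) (h_quadratic i n)
    simp only [Derivation.leibniz, map_add, map_sum, fieldDerivation_X, smul_eq_mul, map_mul,
      eval_C, eval_X] at key
    rw [PowerSeries.coeff_succ_X_mul, map_add, PowerSeries.coeff_C_mul, PowerSeries.coeff_C_mul,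
      map_add, PowerSeries.coeff_mul, PowerSeries.coeff_mul, PowerSeries.coeff_mul,
      two_mul, map_add]
    nth_rw 2 [mul_comm (hSeries u n)]
    rw [PowerSeries.coeff_mul, PowerSeries.coeff_mul]
    simp only [map_add, coeff_dSeries, coeff_hSeries, ← Finset.sum_add_distrib]
    rw [add_comm]
    convert key using 1
    · rw [mul_comm (V n)]
      congr 2
      refine Finset.sum_congr rfl fun x _ => ?_
      simp only [hDer, hVal]; ring
    · refine Finset.sum_congr rfl fun x _ => ?_
      simp only [hDer, hVal]; ring

/-- The linearized quadratic equation determines its solution. -/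
theorem eq_of_linearized {u V : ℤ → ℂ} {c : PowerSeries ℂ} {F G : ℤ → PowerSeries ℂ}
    (hF : ∀ n, PowerSeries.X * (c * (PowerSeries.C (V n) *
        ((hSeries u (n + 1) + hSeries u n) * (hSeries u n + hSeries u (n - 1)))) +
      PowerSeries.C (u n) * ((F (n + 1) + F n) * (hSeries u n + hSeries u (n - 1)) +
        (hSeries u (n + 1) + hSeries u n) * (F n + F (n - 1)))) = 2 * (hSeries u n * F n))
    (hG : ∀ n, PowerSeries.X * (c * (PowerSeries.C (V n) *
        ((hSeries u (n + 1) + hSeries u n) * (hSeries u n + hSeries u (n - 1)))) +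
      PowerSeries.C (u n) * ((G (n + 1) + G n) * (hSeries u n + hSeries u (n - 1)) +
        (hSeries u (n + 1) + hSeries u n) * (G n + G (n - 1)))) = 2 * (hSeries u n * G n))
    (n : ℤ) : F n = G n := by
  refine sub_eq_zero.1 (series_eq_zero_of_mul_eq (D := fun n => F n - G n)
    (U := fun n => 2 * hSeries u n)
    (P := fun n => PowerSeries.C (u n) * (hSeries u n + hSeries u (n - 1)))
    (Q := fun n => PowerSeries.C (u n) *
      ((hSeries u n + hSeries u (n - 1)) + (hSeries u (n + 1) + hSeries u n)))
    (R := fun n => PowerSeries.C (u n) * (hSeries u (n + 1) + hSeries u n))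
    (fun n => isUnit_of_constantCoeff ?_) (fun n => ?_) n)
  · rw [two_mul, map_add, constantCoeff_hSeries]; norm_num
  · linear_combination hG n - hF n

/-- The derivatives along two flows whose generating sequences are related by the linear
equation. -/
theorem dSeries_flowField {u y y' : ℤ → ℂ}
    (hy : ∀ n, u n * (y (n + 1) + y n) - u (n - 1) * (y (n - 1) + y (n - 2)) =
      y' n - y' (n - 1)) (n : ℤ) :
    PowerSeries.X * dSeries u (flowField u y') n = dSeries u (flowField u y) n +
      PowerSeries.X * (PowerSeries.C (u n) *
        ((hSeries u (n + 1) + hSeries u n) * PowerSeries.C (y n + y (n - 1)) -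
          (hSeries u n + hSeries u (n - 1)) * PowerSeries.C (y (n + 1) + y n))) := by
  -- Both sides solve the linearized equation whose inhomogeneity carries the extra factor $X$. For
  -- the right side the two linear relations, for $H$ and for the pair $y,y'$, are needed at $n$ and
  -- $n+1$.
  refine eq_of_linearized (u := u) (V := flowField u y') (c := PowerSeries.X)
    (F := fun n => PowerSeries.X * dSeries u (flowField u y') n)
    (G := fun n => dSeries u (flowField u y) n +
      PowerSeries.X * (PowerSeries.C (u n) *
        ((hSeries u (n + 1) + hSeries u n) * PowerSeries.C (y n + y (n - 1)) -
          (hSeries u n + hSeries u (n - 1)) * PowerSeries.C (y (n + 1) + y n))))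
    (fun n => ?_) (fun n => ?_) n
  · linear_combination PowerSeries.X * dSeries_quadratic u (flowField u y') n
  · have h0 := hSeries_linear u n
    have h1 := hSeries_linear u (n + 1)
    have y0 := congrArg (PowerSeries.C (R := ℂ)) (hy n)
    have y1 := congrArg (PowerSeries.C (R := ℂ)) (hy (n + 1))
    have hd := dSeries_quadratic u (flowField u y) n
    simp only [add_sub_cancel_right, sub_add_cancel, show n + 1 + 1 = n + 2 by ring,
      show n - 1 - 1 = n - 2 by ring, show n + 1 - 2 = n - 1 by ring, flowField,
      map_add, map_sub, map_mul] at h0 h1 y0 y1 hd ⊢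
    linear_combination hd +
      PowerSeries.X * PowerSeries.C (u n) *
        (PowerSeries.C (y (n + 1)) + PowerSeries.C (y n)) *
        (hSeries u n + hSeries u (n - 1)) * h1 +
      PowerSeries.X * PowerSeries.C (u n) *
        (PowerSeries.C (y n) + PowerSeries.C (y (n - 1))) *
        (hSeries u (n + 1) + hSeries u n) * h0 -
      PowerSeries.X ^ 2 * PowerSeries.C (u n) * (hSeries u (n + 1) + hSeries u n) *
        (hSeries u n + hSeries u (n - 1)) * (y0 + y1)

/-- The flow with number `i` of the hierarchy. -/
def hierarchyField (i : ℕ) (u : ℤ → ℂ) : ℤ → ℂ := flowField u fun s => hVal i s u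

theorem hDer_hierarchyField_succ (i l : ℕ) (n : ℤ) (u : ℤ → ℂ) :
    hDer l n u (hierarchyField (i + 1) u) = hDer (l + 1) n u (hierarchyField i u) +
      u n * ((hVal l (n + 1) u + hVal l n u) * (hVal i n u + hVal i (n - 1) u) -
        (hVal l n u + hVal l (n - 1) u) * (hVal i (n + 1) u + hVal i n u)) := by
  have := congrArg (PowerSeries.coeff (l + 1))
    (dSeries_flowField (y := fun s => hVal i s u) (y' := fun s => hVal (i + 1) s u)
      (fun n => hVal_linear i u n) n)
  simp only [map_add, map_sub, mul_add, PowerSeries.coeff_succ_X_mul, PowerSeries.coeff_C_mul,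
    PowerSeries.coeff_mul_C, coeff_dSeries, coeff_hSeries] at this
  simp only [hierarchyField]
  linear_combination this

theorem hierarchyField_zero (u : ℤ → ℂ) : hierarchyField 0 u = fun _ => 0 := by
  funext s
  simp [hierarchyField, flowField, hVal_zero]

theorem hDer_field_zero (i : ℕ) (n : ℤ) (u : ℤ → ℂ) : hDer i n u (fun _ => 0) = 0 := by
  simpa using hDer_smul i n u (fun _ => 0) 0

/-- The flows of the hierarchy are consistent: the derivatives are symmetric. -/
theorem hDer_hierarchyField_comm (i l : ℕ) (n : ℤ) (u : ℤ → ℂ) :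
    hDer l n u (hierarchyField i u) = hDer i n u (hierarchyField l u) := by
  induction i generalizing l with
  | zero => rw [hierarchyField_zero, hDer_field_zero, hDer_zero]
  | succ i ih =>
    have h1 := hDer_hierarchyField_succ i l n u
    have h2 := hDer_hierarchyField_succ l i n u
    -- The correction terms in `h1` and `h2` are antisymmetric in $i,l$ and cancel.
    linear_combination h1 + h2 + ih (l + 1)

/-- Euler's identity: `h^{(i)}_n` is homogeneous of degree `i`. -/
theorem hDer_self (i : ℕ) (n : ℤ) (u : ℤ → ℂ) : hDer i n u u = i * hVal i n u := by
  -- The operator $X\,d/dX$ multiplies the coefficient of $X^i$ by $i$. Applied to the quadratic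
  -- equation it produces the linearized equation with $V=u$.
  have key := eq_of_linearized (u := u) (V := u) (c := 1)
    (F := fun n => dSeries u u n)
    (G := fun n => PowerSeries.X * PowerSeries.derivative ℂ (hSeries u n))
    (fun n => by rw [one_mul]; exact dSeries_quadratic u u n)
    (fun n => by
      have h := congrArg (PowerSeries.derivative ℂ) (hSeries_quadratic u n)
      simp only [Derivation.leibniz, map_add, map_sub, smul_eq_mul, pow_two,
        PowerSeries.derivative_C, PowerSeries.derivative_X] at h
      linear_combination PowerSeries.X * h) n
  have := congrArg (PowerSeries.coeff i) key
  cases i with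
  | zero => simp [hDer_zero]
  | succ i =>
    simp only [coeff_dSeries, PowerSeries.coeff_succ_X_mul, PowerSeries.coeff_derivative,
      coeff_hSeries] at this
    rw [this]
    push_cast
    ring

/-- The derivatives of the `h^{(i)}_n` along the flow generated by a solution of the linear
equation. -/
theorem dSeries_eigen {u y : ℤ → ℂ} {lam : ℂ}
    (hy : ∀ n, u n * (y (n + 1) + y n) - u (n - 1) * (y (n - 1) + y (n - 2)) =
      lam * (y n - y (n - 1))) (n : ℤ) :
    (1 - PowerSeries.C lam * PowerSeries.X) * dSeries u (flowField u y) n =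
      -(PowerSeries.X * (PowerSeries.C (u n) *
        ((hSeries u (n + 1) + hSeries u n) * PowerSeries.C (y n + y (n - 1)) -
          (hSeries u n + hSeries u (n - 1)) * PowerSeries.C (y (n + 1) + y n)))) := by
  have h1 := dSeries_flowField (u := u) (y := y) (y' := fun n => lam * y n)
    (fun n => by rw [hy]; ring) n
  have h2 : dSeries u (flowField u fun n => lam * y n) n =
      PowerSeries.C lam * dSeries u (flowField u y) n := by
    have : (flowField u fun n => lam * y n) = fun s => lam * flowField u y s := by
      funext s; simp only [flowField]; ring
    ext i
    rw [this, coeff_dSeries, hDer_smul, PowerSeries.coeff_C_mul, coeff_dSeries]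
  rw [h2] at h1
  linear_combination -h1

end Volterra

/-! ### The Darboux transformation; the maps preserve the system -/

namespace Volterra

section Darboux

variable {R : Type*} [CommRing R]

/-- The first order operator `y ↦ (1 - a_n) y_n - a_n y_{n-1}` with the coefficients `a_n`. -/
def firstOrder (a y : ℤ → R) (n : ℤ) : R := (1 - a n) * y n - a n * y (n - 1)

/-- The factorization behind $B_k$: up to the eigenvalue term, the linear operator is $\beta
L_{1-a}\Delta L_a$. The exchange of $a$ and $1-a$ interchanges the outer factors. -/
theorem firstOrder_comp {a u : ℤ → R} {β : R} (hu : ∀ n, u n = β * (a n * (1 - a (n + 1))))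
    (y : ℤ → R) (n : ℤ) :
    β * firstOrder (fun n => 1 - a n) (fun n => firstOrder a y (n + 1) - firstOrder a y n) n =
      u n * (y (n + 1) + y n) - u (n - 1) * (y (n - 1) + y (n - 2)) - β * (y n - y (n - 1)) := by
  rw [hu, hu (n - 1)]
  simp only [firstOrder, sub_add_cancel, add_sub_cancel_right, show n - 1 - 1 = n - 2 by ring]
  ring

theorem mul_eq_firstOrder {a u : ℤ → R} {β : R} (hu : ∀ n, u n = β * (a n * (1 - a (n + 1))))
    (y : ℤ → R) (n : ℤ) :
    u n * ((y (n + 1) + y n) * (y n + y (n - 1))) =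
      β * ((y n + firstOrder a y (n + 1)) * (y n - firstOrder a y n)) := by
  rw [hu]
  simp only [firstOrder, add_sub_cancel_right]
  ring

/-- The linear equation and the factorization give $(q-\beta p)(y_n-y_{n-1})=\beta p\,L_{1-a}\Delta
L_ay$; the claim follows from $L_ay+L_{1-a}y=y_n-y_{n-1}$. The factor $q-\beta p$ is kept so that
the statement makes sense over any commutative ring. -/
theorem firstOrder_transform {a u y y' : ℤ → R} {β p q : R}
    (hu : ∀ n, u n = β * (a n * (1 - a (n + 1))))
    (hy : ∀ n, p * (u n * (y (n + 1) + y n) - u (n - 1) * (y (n - 1) + y (n - 2))) =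
      q * (y n - y (n - 1)))
    (hy' : ∀ n, (q - β * p) * (y' n - y n) =
      -(β * p * (firstOrder a y (n + 1) - firstOrder a y n))) (n : ℤ) :
    (q - β * p) * firstOrder (fun n => 1 - a n) y' n = -((q - β * p) * firstOrder a y n) := by
  have h1 := firstOrder_comp hu y n
  have h2 := hy n
  have h3 := hy' n
  have h4 := hy' (n - 1)
  simp only [firstOrder, sub_add_cancel, add_sub_cancel_right] at h1 h3 h4 ⊢
  linear_combination -p * h1 + a n * h3 - (1 - a n) * h4 - h2

/-- With $v=L_ay$ both products factor: $\beta(y_n+v_{n+1})(y_n-v_n)$ before the transformation and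
$\beta(y'_n-v_{n+1})(y'_n+v_n)$ after it. By `hy'` they differ, after multiplication by $p$, exactly
by $q(y_n'^2-y_n^2)$, so $c$ is unchanged. -/
theorem quadratic_transform {a u u' y y' : ℤ → R} {β p q c : R}
    (hu : ∀ n, u n = β * (a n * (1 - a (n + 1))))
    (hu' : ∀ n, u' n = β * ((1 - a n) * a (n + 1)))
    (hy : ∀ n, p * (u n * ((y (n + 1) + y n) * (y n + y (n - 1)))) = q * (y n ^ 2 - c))
    (hy' : ∀ n, (q - β * p) * (y' n - y n) =
      -(β * p * (firstOrder a y (n + 1) - firstOrder a y n)))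
    (hL : ∀ n, firstOrder (fun n => 1 - a n) y' n = -firstOrder a y n) (n : ℤ) :
    p * (u' n * ((y' (n + 1) + y' n) * (y' n + y' (n - 1)))) = q * (y' n ^ 2 - c) := by
  have h1 := hy n
  rw [mul_eq_firstOrder hu] at h1
  rw [mul_eq_firstOrder (a := fun n => 1 - a n) (β := β)
    (fun n => by rw [hu']; ring), hL, hL]
  linear_combination h1 - (y' n + y n) * hy' n

end Darboux

variable {m r : ℕ}

/-- The coefficient `(y^k_n - ω^k) / (y^k_n + y^k_{n-1})` of the first order operator that
belongs to `B_k`. -/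
def aVar (k : Fin m) (S : State m) (n : ℤ) : ℂ :=
  (S.y k n - S.ω k) / (S.y k n + S.y k (n - 1))

section

variable {S : State m} {k : Fin m} {n : ℤ}

theorem sub_eq_aVar_mul (h : S.y k n + S.y k (n - 1) ≠ 0) :
    S.y k n - S.ω k = aVar k S n * (S.y k n + S.y k (n - 1)) := by
  rw [aVar, div_mul_cancel₀ _ h]

theorem add_eq_one_sub_aVar_mul (h : S.y k n + S.y k (n - 1) ≠ 0) :
    S.y k (n - 1) + S.ω k = (1 - aVar k S n) * (S.y k n + S.y k (n - 1)) := by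
  linear_combination -sub_eq_aVar_mul h

theorem firstOrder_aVar (h : S.y k n + S.y k (n - 1) ≠ 0) :
    firstOrder (aVar k S) (S.y k) n = S.ω k := by
  rw [firstOrder]
  linear_combination sub_eq_aVar_mul h

theorem one_sub_aVar (h : S.y k n + S.y k (n - 1) ≠ 0) :
    1 - aVar k S n = (S.y k (n - 1) + S.ω k) / (S.y k n + S.y k (n - 1)) := by
  rw [eq_div_iff h, add_eq_one_sub_aVar_mul h]

/-- The explicit formula for $\tilde y^j$ is the Darboux transformation with $p=1$, $q=\alpha^j$,
$\beta=\alpha^k$. -/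
theorem ByOff_eq {α : Fin m → ℂ} {j : Fin m} (hjk : α j ≠ α k)
    (h : S.y k n + S.y k (n - 1) ≠ 0) (h' : S.y k (n + 1) + S.y k n ≠ 0) :
    ByOff α k S j n = S.y j n - α k / (α j - α k) *
      (firstOrder (aVar k S) (S.y j) (n + 1) - firstOrder (aVar k S) (S.y j) n) := by
  have e1 := one_sub_aVar (S := S) (k := k) (n := n + 1) (by rwa [add_sub_cancel_right])
  rw [add_sub_cancel_right] at e1
  have e1' : aVar k S (n + 1) = 1 - (S.y k n + S.ω k) / (S.y k (n + 1) + S.y k n) := by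
    linear_combination -e1
  have hne := sub_ne_zero.2 hjk
  simp only [ByOff, firstOrder, e1', add_sub_cancel_right]
  rw [aVar]
  field_simp
  ring

theorem Bu_eq_mul_div (h : S.y k n + S.y k (n - 1) ≠ 0) (h' : S.y k (n + 1) + S.y k n ≠ 0) :
    Bu k S n = S.u n * (aVar k S (n + 1) * (1 - aVar k S n)) /
      (aVar k S n * (1 - aVar k S (n + 1))) := by
  have hs : S.y k (n + 1) + S.y k (n + 1 - 1) ≠ 0 := by rwa [add_sub_cancel_right]
  have e1 := sub_eq_aVar_mul hs
  have e2 := add_eq_one_sub_aVar_mul hs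
  rw [add_sub_cancel_right] at e1 e2
  rw [Bu, e1, add_eq_one_sub_aVar_mul h, show S.y k n ^ 2 - S.ω k ^ 2 =
    (S.y k n - S.ω k) * (S.y k n + S.ω k) by ring, sub_eq_aVar_mul h, e2]
  rw [show S.u n * (aVar k S (n + 1) * (S.y k (n + 1) + S.y k n) *
      ((1 - aVar k S n) * (S.y k n + S.y k (n - 1)))) =
      (S.u n * (aVar k S (n + 1) * (1 - aVar k S n))) *
        ((S.y k n + S.y k (n - 1)) * (S.y k (n + 1) + S.y k n)) by ring,
    show aVar k S n * (S.y k n + S.y k (n - 1)) *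
      ((1 - aVar k S (n + 1)) * (S.y k (n + 1) + S.y k n)) =
      (aVar k S n * (1 - aVar k S (n + 1))) *
        ((S.y k n + S.y k (n - 1)) * (S.y k (n + 1) + S.y k n)) by ring,
    mul_div_mul_right _ _ (mul_ne_zero h h')]

end

theorem Nondegenerate.add_ne {S : State m} (h : Nondegenerate S) (k : Fin m) (n : ℤ) :
    S.y k n + S.y k (n - 1) ≠ 0 := (h k n).1

theorem Nondegenerate.add_ne' {S : State m} (h : Nondegenerate S) (k : Fin m) (n : ℤ) :
    S.y k (n + 1) + S.y k n ≠ 0 := by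
  simpa using (h k (n + 1)).1

theorem Nondegenerate.aVar_ne_zero {S : State m} (h : Nondegenerate S) (k : Fin m) (n : ℤ) :
    aVar k S n ≠ 0 := by
  refine div_ne_zero (fun e => (h k n).2 ?_) (h k n).1
  linear_combination (S.y k n + S.ω k) * e

theorem Nondegenerate.one_sub_aVar_ne_zero {S : State m} (h : Nondegenerate S) (k : Fin m)
    (n : ℤ) : 1 - aVar k S n ≠ 0 := by
  rw [one_sub_aVar (h k n).1]
  refine div_ne_zero (fun e => (h k (n - 1)).2 ?_) (h k n).1
  linear_combination (S.y k (n - 1) - S.ω k) * e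

/-- The right side of the equation for $y^k$ splits into $(y^k_n-\omega^k)(y^k_n+\omega^k)$; these
factors contain $a_n$ and $1-a_{n+1}$, and the sums $y^k_n+y^k_{n-1}$, $y^k_{n+1}+y^k_n$ cancel. -/
theorem IsSolution.u_eq {α : Fin m → ℂ} {δ : ℂ} {t : Fin r → ℂ} {S : State m}
    (hS : IsSolution α δ t S) (h : Nondegenerate S) (k : Fin m) (n : ℤ) :
    S.u n = α k * (aVar k S n * (1 - aVar k S (n + 1))) := by
  have e1 := sub_eq_aVar_mul (h.add_ne k n)
  have e2 := add_eq_one_sub_aVar_mul (h.add_ne k (n + 1))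
  rw [add_sub_cancel_right] at e2
  have := hS.local_eq k n
  refine mul_right_cancel₀ (mul_ne_zero (h.add_ne' k n) (h.add_ne k n)) ?_
  linear_combination this + α k * (S.y k n + S.ω k) * e1 +
    α k * aVar k S n * (S.y k n + S.y k (n - 1)) * e2

theorem IsSolution.Bu_eq {α : Fin m → ℂ} {δ : ℂ} {t : Fin r → ℂ}
    {S : State m} (hS : IsSolution α δ t S) (h : Nondegenerate S) (k : Fin m) (n : ℤ) :
    Bu k S n = α k * ((1 - aVar k S n) * aVar k S (n + 1)) := by
  rw [Bu_eq_mul_div (h.add_ne k n) (h.add_ne' k n), hS.u_eq h k n,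
    div_eq_iff (mul_ne_zero (h.aVar_ne_zero k n) (h.one_sub_aVar_ne_zero k (n + 1)))]
  ring

theorem IsSolution.linear {α : Fin m → ℂ} {δ : ℂ} {t : Fin r → ℂ} {S : State m}
    (hS : IsSolution α δ t S) (h : Nondegenerate S) (j : Fin m) (n : ℤ) :
    S.u n * (S.y j (n + 1) + S.y j n) - S.u (n - 1) * (S.y j (n - 1) + S.y j (n - 2)) =
      α j * (S.y j n - S.y j (n - 1)) := by
  have := linear_of_quadratic (u := S.u) (y := S.y j) (p := 1) (q := α j) (c := S.ω j ^ 2)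
    (h.add_ne j) (fun n => by rw [one_mul, ← hS.local_eq]; ring) n
  rwa [one_mul] at this

section

variable {α : Fin m → ℂ} {δ : ℂ} {t : Fin r → ℂ} {S : State m}

theorem ByOff_sub {k j : Fin m} (hjk : α j ≠ α k) (h : Nondegenerate S) (n : ℤ) :
    (α j - α k) * (ByOff α k S j n - S.y j n) =
      -(α k * (firstOrder (aVar k S) (S.y j) (n + 1) - firstOrder (aVar k S) (S.y j) n)) := by
  rw [ByOff_eq hjk (h.add_ne k n) (h.add_ne' k n)]
  have := sub_ne_zero.2 hjk
  field_simp
  ring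

theorem firstOrder_ByOff (hS : IsSolution α δ t S) (h : Nondegenerate S) {k j : Fin m}
    (hjk : α j ≠ α k) (n : ℤ) :
    firstOrder (fun n => 1 - aVar k S n) (ByOff α k S j) n =
      -firstOrder (aVar k S) (S.y j) n := by
  have := firstOrder_transform (a := aVar k S) (u := S.u) (y := S.y j) (y' := ByOff α k S j)
    (β := α k) (p := 1) (q := α j) (hS.u_eq h k) (fun n => by rw [one_mul, hS.linear h])
    (fun n => by rw [mul_one, ByOff_sub hjk h]) n
  refine mul_left_cancel₀ (sub_ne_zero.2 hjk) ?_
  rw [mul_one] at this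
  rw [this]; ring

theorem ByOff_local_eq (hS : IsSolution α δ t S) (h : Nondegenerate S)
    {k j : Fin m} (hjk : α j ≠ α k) (n : ℤ) :
    Bu k S n * (ByOff α k S j (n + 1) + ByOff α k S j n) *
        (ByOff α k S j n + ByOff α k S j (n - 1)) =
      α j * (ByOff α k S j n ^ 2 - S.ω j ^ 2) := by
  have := quadratic_transform (a := aVar k S) (u := S.u) (u' := Bu k S) (y := S.y j)
    (y' := ByOff α k S j) (β := α k) (p := 1) (q := α j) (c := S.ω j ^ 2) (hS.u_eq h k)
    (hS.Bu_eq h k) (fun n => by rw [one_mul, ← hS.local_eq]; ring)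
    (fun n => by rw [mul_one, ByOff_sub hjk h]) (firstOrder_ByOff hS h hjk) n
  rw [← this]; ring

/-- The transformed generating series. -/
def hSeriesB (α : Fin m → ℂ) (k : Fin m) (S : State m) (n : ℤ) : PowerSeries ℂ :=
  hSeries S.u n - PowerSeries.C (α k) * PowerSeries.X *
    (1 - PowerSeries.C (α k) * PowerSeries.X)⁻¹ *
      (firstOrder (fun n => PowerSeries.C (aVar k S n)) (hSeries S.u) (n + 1) -
        firstOrder (fun n => PowerSeries.C (aVar k S n)) (hSeries S.u) n)

theorem constantCoeff_one_sub (c : ℂ) :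
    PowerSeries.constantCoeff (1 - PowerSeries.C c * PowerSeries.X) = 1 := by
  simp

theorem one_sub_C_mul_X_ne_zero (c : ℂ) : (1 - PowerSeries.C c * PowerSeries.X) ≠ 0 := by
  intro e
  have := constantCoeff_one_sub c
  rw [e] at this
  simp at this

theorem hSeriesB_sub (k : Fin m) (n : ℤ) :
    (1 - PowerSeries.C (α k) * PowerSeries.X) * (hSeriesB α k S n - hSeries S.u n) =
      -(PowerSeries.C (α k) * PowerSeries.X *
        (firstOrder (fun n => PowerSeries.C (aVar k S n)) (hSeries S.u) (n + 1) -
          firstOrder (fun n => PowerSeries.C (aVar k S n)) (hSeries S.u) n)) := by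
  have hinv := PowerSeries.mul_inv_cancel (1 - PowerSeries.C (α k) * PowerSeries.X)
    (by rw [constantCoeff_one_sub]; exact one_ne_zero)
  rw [hSeriesB]
  linear_combination (-(PowerSeries.C (α k) * PowerSeries.X *
        (firstOrder (fun n => PowerSeries.C (aVar k S n)) (hSeries S.u) (n + 1) -
          firstOrder (fun n => PowerSeries.C (aVar k S n)) (hSeries S.u) n))) * hinv

theorem firstOrder_hSeriesB (hS : IsSolution α δ t S) (h : Nondegenerate S) (k : Fin m) (n : ℤ) :
    firstOrder (fun n => 1 - PowerSeries.C (aVar k S n)) (hSeriesB α k S) n =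
      -firstOrder (fun n => PowerSeries.C (aVar k S n)) (hSeries S.u) n := by
  have := firstOrder_transform (R := PowerSeries ℂ) (a := fun n => PowerSeries.C (aVar k S n))
    (u := fun n => PowerSeries.C (S.u n)) (y := hSeries S.u) (y' := hSeriesB α k S)
    (β := PowerSeries.C (α k)) (p := PowerSeries.X) (q := 1)
    (fun n => by rw [hS.u_eq h k]; simp) (fun n => by rw [one_mul]; exact hSeries_linear _ n)
    (fun n => hSeriesB_sub k n) n
  refine mul_left_cancel₀ (one_sub_C_mul_X_ne_zero (α k)) ?_
  rw [this]; ring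

/-- The transformed generating series is the generating series of the transformed sequence. -/
theorem hSeriesB_eq (hS : IsSolution α δ t S) (h : Nondegenerate S)
    (k : Fin m) (n : ℤ) : hSeriesB α k S n = hSeries (Bu k S) n := by
  refine eq_hSeries_of_quadratic (fun n => ?_) (fun n => ?_) n
  · rw [hSeriesB]; simp
  · have := quadratic_transform (R := PowerSeries ℂ) (a := fun n => PowerSeries.C (aVar k S n))
      (u := fun n => PowerSeries.C (S.u n)) (u' := fun n => PowerSeries.C (Bu k S n))
      (y := hSeries S.u) (y' := hSeriesB α k S)
      (β := PowerSeries.C (α k)) (p := PowerSeries.X) (q := 1) (c := PowerSeries.C (1 / 4))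
      (fun n => by rw [hS.u_eq h k]; simp) (fun n => by rw [hS.Bu_eq h k]; simp)
      (fun n => by rw [one_mul]; exact hSeries_quadratic _ n)
      (fun n => hSeriesB_sub k n) (firstOrder_hSeriesB hS h k) n
    rwa [one_mul] at this

/-- The relation $L_{1-a}\tilde H=-L_aH$ does not involve $X$ explicitly, so it holds for each
coefficient, and hence for the linear combination `timeSum`. -/
theorem firstOrder_hVal_Bu (hS : IsSolution α δ t S) (h : Nondegenerate S)
    (k : Fin m) (i : ℕ) (n : ℤ) :
    firstOrder (fun n => 1 - aVar k S n) (fun n => hVal i n (Bu k S)) n =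
      -firstOrder (aVar k S) (fun n => hVal i n S.u) n := by
  have := congrArg (PowerSeries.coeff i) (firstOrder_hSeriesB hS h k n)
  simp only [firstOrder, hSeriesB_eq hS h, sub_sub_cancel, sub_mul, one_mul, map_sub, map_neg,
    PowerSeries.coeff_C_mul, coeff_hSeries] at this ⊢
  exact this

theorem firstOrder_sum {ι : Type*} (I : Finset ι) (a : ℤ → ℂ) (c : ι → ℂ) (y : ι → ℤ → ℂ)
    (n : ℤ) : firstOrder a (fun n => ∑ i ∈ I, c i * y i n) n =
      ∑ i ∈ I, c i * firstOrder a (y i) n := by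
  simp only [firstOrder, Finset.mul_sum, ← Finset.sum_sub_distrib]
  exact Finset.sum_congr rfl fun i _ => by ring

theorem timeSum_eq (t : Fin r → ℂ) (u : ℤ → ℂ) (n : ℤ) :
    timeSum t u n = ∑ i : Fin r, (2 * ((i : ℂ) + 1) * t i) * hVal (i + 1) n u := by
  rw [timeSum, Finset.mul_sum]
  exact Finset.sum_congr rfl fun i _ => by ring

theorem firstOrder_timeSum_Bu (hS : IsSolution α δ t S)
    (h : Nondegenerate S) (k : Fin m) (s : Fin r → ℂ) (n : ℤ) :
    firstOrder (fun n => 1 - aVar k S n) (timeSum s (Bu k S)) n =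
      -firstOrder (aVar k S) (timeSum s S.u) n := by
  have e (u : ℤ → ℂ) : timeSum s u =
      fun n => ∑ i : Fin r, (2 * ((i : ℂ) + 1) * s i) * hVal (i + 1) n u :=
    funext fun n => timeSum_eq s u n
  rw [e, e, firstOrder_sum, firstOrder_sum, ← Finset.sum_neg_distrib]
  refine Finset.sum_congr rfl fun i _ => ?_
  rw [firstOrder_hVal_Bu hS h]; ring

theorem sgn_sub_one (n : ℤ) : sgn (n - 1) = -sgn n := by
  rw [sgn, sgn, zpow_sub_one₀ (by norm_num)]; norm_num

theorem sgn_add_one (n : ℤ) : sgn (n + 1) = -sgn n := by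
  rw [sgn, sgn, zpow_add_one₀ (by norm_num)]; norm_num

theorem sum_B_y (k : Fin m) (n : ℤ) :
    ∑ j, (B α δ t k S).y j n = timeSum t (Bu k S) n + n - δ - sgn n * S.ε := by
  rw [← Finset.add_sum_erase _ _ (Finset.mem_univ k)]
  have : ∑ j ∈ Finset.univ.erase k, (B α δ t k S).y j n =
      ∑ j ∈ Finset.univ.erase k, ByOff α k S j n :=
    Finset.sum_congr rfl fun j hj => by simp only [B, if_neg (Finset.ne_of_mem_erase hj)]
  rw [this]
  simp only [B, if_true, ByDiag]
  ring

/-- Apply $L_{1-a}$ to the new sum equation and add $L_a$ of the old one. The time sums and the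
$y^j$, $j\ne k$, cancel; $\delta$ drops out because $L_a+L_{1-a}$ kills constants; both operators
fix $(-1)^n$, so reversing $\varepsilon$ cancels that term. The term $n$ leaves 1, and
$L_ay^k=\omega^k$. -/
theorem firstOrder_ByDiag (hinj : Function.Injective α)
    (hS : IsSolution α δ t S) (h : Nondegenerate S) (k : Fin m) (n : ℤ) :
    firstOrder (fun n => 1 - aVar k S n) (ByDiag α δ t k S) n = 1 - S.ω k := by
  have h1 := firstOrder_timeSum_Bu hS h k t n
  have h2 := firstOrder_aVar (S := S) (k := k) (n := n) (h.add_ne k n)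
  have h3 : ∀ j ∈ Finset.univ.erase k, firstOrder (fun n => 1 - aVar k S n) (ByOff α k S j) n =
      -firstOrder (aVar k S) (S.y j) n := fun j hj =>
    firstOrder_ByOff hS h (fun e => Finset.ne_of_mem_erase hj (hinj e)) n
  have h4 := Finset.sum_congr rfl h3
  have h5 : ∀ n, S.y k n + ∑ j ∈ Finset.univ.erase k, S.y j n = _ := fun n =>
    (Finset.add_sum_erase _ (fun j => S.y j n) (Finset.mem_univ k)).trans (hS.sum_eq n).symm
  have h6 := h5 n
  have h7 := h5 (n - 1)
  simp only [firstOrder, Finset.sum_sub_distrib, ← Finset.mul_sum, Finset.sum_neg_distrib] at *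
  simp only [ByDiag, sgn_sub_one] at *
  push_cast at *
  linear_combination h1 - h4 - h2 + (1 - aVar k S n) * h6 - aVar k S n * h7

/-- Since $L_{1-a}\tilde y^k$ is the constant $1-\omega^k$, the factored form of the product is
already the required difference of squares. -/
theorem ByDiag_local_eq (hinj : Function.Injective α)
    (hS : IsSolution α δ t S) (h : Nondegenerate S) (k : Fin m) (n : ℤ) :
    Bu k S n * (ByDiag α δ t k S (n + 1) + ByDiag α δ t k S n) *
        (ByDiag α δ t k S n + ByDiag α δ t k S (n - 1)) =
      α k * (ByDiag α δ t k S n ^ 2 - (1 - S.ω k) ^ 2) := by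
  have h1 := mul_eq_firstOrder (a := fun n => 1 - aVar k S n) (u := Bu k S) (β := α k)
    (fun n => by rw [hS.Bu_eq h]; ring) (ByDiag α δ t k S) n
  rw [firstOrder_ByDiag hinj hS h, firstOrder_ByDiag hinj hS h] at h1
  linear_combination h1

theorem isSolution_A (hS : IsSolution α δ t S) (k : Fin m) : IsSolution α δ t (A k S) where
  local_eq j n := by
    have := hS.local_eq j n
    simp only [A]
    rw [this]
    rcases eq_or_ne j k with rfl | hj
    · rw [Function.update_self]; ring
    · rw [Function.update_of_ne hj]
  sum_eq n := hS.sum_eq n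

theorem isSolution_B (hinj : Function.Injective α)
    (hS : IsSolution α δ t S) (h : Nondegenerate S) (k : Fin m) :
    IsSolution α δ t (B α δ t k S) where
  local_eq j n := by
    rcases eq_or_ne j k with rfl | hj
    · simp only [B, if_true, Function.update_self]
      exact ByDiag_local_eq hinj hS h j n
    · simp only [B, if_neg hj, Function.update_of_ne hj]
      exact ByOff_local_eq hS h (fun e => hj (hinj e)) n
  sum_eq n := by
    rw [sum_B_y]
    simp only [B]
    ring

end

end Volterra

/-! ### The Darboux transformation of the flows: algebraic identities -/

namespace Volterra

section Darboux

variable {R : Type*} [CommRing R]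

theorem firstOrder_one_sub_add (a y : ℤ → R) (n : ℤ) :
    firstOrder (fun n => 1 - a n) y n + firstOrder a y n = y n - y (n - 1) := by
  simp only [firstOrder]; ring

/-- Another reading of the factorization: it eliminates $L_ay$ at the outer points $n\pm1$ in favour
of increments of $y$. -/
theorem three_term {a u y : ℤ → R} {β p q : R}
    (hu : ∀ n, u n = β * (a n * (1 - a (n + 1))))
    (hy : ∀ n, p * (u n * (y (n + 1) + y n) - u (n - 1) * (y (n - 1) + y (n - 2))) =
      q * (y n - y (n - 1))) (n : ℤ) :
    β * p * (a n * firstOrder a y (n + 1) - firstOrder a y n +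
      (1 - a n) * firstOrder a y (n - 1)) = (q - β * p) * (y n - y (n - 1)) := by
  have h1 := firstOrder_comp hu y n
  have h2 := hy n
  simp only [firstOrder, sub_add_cancel, add_sub_cancel_right] at h1 ⊢
  linear_combination p * h1 + h2

theorem linear_transform {a u' y y' : ℤ → R} {β p q : R}
    (hu' : ∀ n, u' n = β * ((1 - a n) * a (n + 1)))
    (hy' : ∀ n, (q - β * p) * (y' n - y n) =
      -(β * p * (firstOrder a y (n + 1) - firstOrder a y n)))
    (hL : ∀ n, firstOrder (fun n => 1 - a n) y' n = -firstOrder a y n) (n : ℤ) :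
    p * (u' n * (y' (n + 1) + y' n) - u' (n - 1) * (y' (n - 1) + y' (n - 2))) =
      q * (y' n - y' (n - 1)) := by
  have h1 := firstOrder_comp (a := fun n => 1 - a n) (u := u') (β := β)
    (fun n => by rw [hu']; ring) y' n
  simp only [hL, sub_sub_cancel] at h1
  have h2 := hy' n
  have h3 := hy' (n - 1)
  have h4 := firstOrder_one_sub_add a y' n
  rw [hL] at h4
  simp only [firstOrder, sub_add_cancel, add_sub_cancel_right] at h1 h2 h3 h4 ⊢
  linear_combination -p * h1 - (1 - a n) * h2 + a n * h3 + (q - β * p) * h4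

theorem firstOrder_flow {a u y H G : ℤ → R} {β z e : R}
    (hu : ∀ n, u n = β * (a n * (1 - a (n + 1))))
    (hG : ∀ n, e * G n = -(z * (u n * ((H (n + 1) + H n) * (y n + y (n - 1)) -
      (H n + H (n - 1)) * (y (n + 1) + y n))))) (n : ℤ) :
    e * firstOrder a G n = -(β * z * (a n * (1 - a n)) *
      ((y n + y (n - 1)) * (firstOrder a H (n + 1) - firstOrder a H (n - 1)) -
        (H n + H (n - 1)) * (firstOrder a y (n + 1) - firstOrder a y (n - 1)))) := by
  have h1 := hG n
  have h2 := hG (n - 1)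
  rw [hu] at h1 h2
  simp only [firstOrder, sub_add_cancel, add_sub_cancel_right] at h1 h2 ⊢
  linear_combination (1 - a n) * h1 - a n * h2

/-- The transformation of the flows. -/
theorem flow_transform [IsDomain R] {a u u' y y' H H' G G' D : ℤ → R} {β lam z : R}
    (he : 1 - lam * z ≠ 0) (hd : 1 - β * z ≠ 0)
    (hu : ∀ n, u n = β * (a n * (1 - a (n + 1))))
    (hu' : ∀ n, u' n = β * ((1 - a n) * a (n + 1)))
    (hy : ∀ n, u n * (y (n + 1) + y n) - u (n - 1) * (y (n - 1) + y (n - 2)) =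
      lam * (y n - y (n - 1)))
    (hH : ∀ n, z * (u n * (H (n + 1) + H n) - u (n - 1) * (H (n - 1) + H (n - 2))) =
      H n - H (n - 1))
    (hy' : ∀ n, (lam - β) * (y' n - y n) = -(β * (firstOrder a y (n + 1) - firstOrder a y n)))
    (hH' : ∀ n, (1 - β * z) * (H' n - H n) =
      -(β * z * (firstOrder a H (n + 1) - firstOrder a H n)))
    (hyL : ∀ n, firstOrder (fun n => 1 - a n) y' n = -firstOrder a y n)
    (hHL : ∀ n, firstOrder (fun n => 1 - a n) H' n = -firstOrder a H n)
    (hG : ∀ n, (1 - lam * z) * G n = -(z * (u n * ((H (n + 1) + H n) * (y n + y (n - 1)) -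
      (H n + H (n - 1)) * (y (n + 1) + y n)))))
    (hG' : ∀ n, (1 - lam * z) * G' n = -(z * (u' n * ((H' (n + 1) + H' n) * (y' n + y' (n - 1)) -
      (H' n + H' (n - 1)) * (y' (n + 1) + y' n)))))
    (hD : ∀ n, (1 - β * z) * D n = -(β * z * (a n * (1 - a n)) *
      (firstOrder a H (n + 1) - firstOrder a H (n - 1)))) (n : ℤ) :
    (lam - β) * (G' n - G n) =
      -(β * ((firstOrder a G (n + 1) - D (n + 1) * (y (n + 1) + y n)) -
        (firstOrder a G n - D n * (y n + y (n - 1))))) := by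
  -- The bracket is the derivative of $L_ay$ along the flow: $L_aG$ from $y$, and
  -- $-D_n(y_n+y_{n-1})$ from $a_n$. Denominators are cleared, as the series are only known after
  -- multiplication by $1-\lambda z$ and $1-\beta z$.
  have key (n : ℤ) : (1 - lam * z) * ((1 - β * z) *
      (firstOrder a G n - D n * (y n + y (n - 1)))) =
      β * z * ((1 - β * z) * (a n * (1 - a n)) * (H n + H (n - 1)) *
        (firstOrder a y (n + 1) - firstOrder a y (n - 1)) -
        (lam - β) * z * (a n * (1 - a n)) * (y n + y (n - 1)) *
        (firstOrder a H (n + 1) - firstOrder a H (n - 1))) := by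
    linear_combination (1 - β * z) * firstOrder_flow hu hG n -
      (1 - lam * z) * (y n + y (n - 1)) * hD n
  have t0 := three_term (p := 1) (q := lam) hu (fun n => by rw [one_mul, hy]) n
  have t1 := three_term (p := 1) (q := lam) hu (fun n => by rw [one_mul, hy]) (n + 1)
  have T0 := three_term (p := z) (q := 1) hu (fun n => by rw [one_mul, hH]) n
  have T1 := three_term (p := z) (q := 1) hu (fun n => by rw [one_mul, hH]) (n + 1)
  have k0 := key n
  have k1 := key (n + 1)
  have g := hG n
  have g' := hG' n
  have yy := hy' n
  have HH := hH' n
  -- the flows in terms of the images of the first order operator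
  have E : u n * ((H (n + 1) + H n) * (y n + y (n - 1)) -
      (H n + H (n - 1)) * (y (n + 1) + y n)) =
      β * ((H n + firstOrder a H (n + 1)) * (y n - firstOrder a y n) -
        (H n - firstOrder a H n) * (y n + firstOrder a y (n + 1))) := by
    rw [hu]; simp only [firstOrder, add_sub_cancel_right]; ring
  have E' : u' n * ((H' (n + 1) + H' n) * (y' n + y' (n - 1)) -
      (H' n + H' (n - 1)) * (y' (n + 1) + y' n)) =
      β * ((H' n - firstOrder a H (n + 1)) * (y' n + firstOrder a y n) -
        (H' n + firstOrder a H n) * (y' n - firstOrder a y (n + 1))) := by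
    have e1 := hyL n
    have e2 := hyL (n + 1)
    have e3 := hHL n
    have e4 := hHL (n + 1)
    rw [← neg_eq_iff_eq_neg] at e1 e2 e3 e4
    rw [← e1, ← e2, ← e3, ← e4, hu']
    simp only [firstOrder, add_sub_cancel_right]; ring
  rw [E] at g
  rw [E'] at g'
  have w0 : firstOrder a y n = (1 - a n) * y n - a n * y (n - 1) := rfl
  have W0 : firstOrder a H n = (1 - a n) * H n - a n * H (n - 1) := rfl
  have w1 : firstOrder a y (n + 1) = (1 - a (n + 1)) * y (n + 1) - a (n + 1) * y n := by
    simp only [firstOrder, add_sub_cancel_right]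
  have W1 : firstOrder a H (n + 1) = (1 - a (n + 1)) * H (n + 1) - a (n + 1) * H n := by
    simp only [firstOrder, add_sub_cancel_right]
  simp only [add_sub_cancel_right] at t1 T1 k1
  generalize firstOrder a y (n + 1 + 1) = w2 at *
  generalize firstOrder a H (n + 1 + 1) = W2 at *
  generalize firstOrder a y (n - 1) = wm at *
  generalize firstOrder a H (n - 1) = Wm at *
  generalize firstOrder a G (n + 1) - D (n + 1) * (y (n + 1) + y n) = q1 at *
  generalize firstOrder a G n - D n * (y n + y (n - 1)) = q0 at *
  generalize firstOrder a y (n + 1) = v1 at *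
  generalize firstOrder a H (n + 1) = V1 at *
  generalize firstOrder a y n = v0 at *
  generalize firstOrder a H n = V0 at *
  generalize H' n = h' at *
  generalize y' n = x' at *
  refine mul_left_cancel₀ (mul_ne_zero he hd) ?_
  -- the values of `q1` and `q0` without the outer terms of the three-term relations
  have m1 : (1 - lam * z) * ((1 - β * z) * q1) * β = β * z * (
      (1 - β * z) * (V1 + H n) * (β * (v1 - v0) + (lam - β) * (y (n + 1) - y n)) -
      (lam - β) * (v1 + y n) * (β * z * (V1 - V0) + (1 - β * z) * (H (n + 1) - H n))) := by
    linear_combination β * k1 + β * z * (1 - β * z) * (1 - a (n + 1)) * (H (n + 1) + H n) * t1 -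
      β * z * (lam - β) * (1 - a (n + 1)) * (y (n + 1) + y n) * T1 -
      β * z * (1 - β * z) * (β * (v1 - v0) + (lam - β) * (y (n + 1) - y n)) * W1 +
      β * z * (lam - β) * (β * z * (V1 - V0) + (1 - β * z) * (H (n + 1) - H n)) * w1
  have m0 : (1 - lam * z) * ((1 - β * z) * q0) * β = β * z * (
      (1 - β * z) * (H n - V0) * (β * (v1 - v0) - (lam - β) * (y n - y (n - 1))) -
      (lam - β) * (y n - v0) * (β * z * (V1 - V0) - (1 - β * z) * (H n - H (n - 1)))) := by
    linear_combination β * k0 - β * z * (1 - β * z) * a n * (H n + H (n - 1)) * t0 +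
      β * z * (lam - β) * a n * (y n + y (n - 1)) * T0 +
      β * z * (1 - β * z) * (β * (v1 - v0) - (lam - β) * (y n - y (n - 1))) * W0 -
      β * z * (lam - β) * (β * z * (V1 - V0) - (1 - β * z) * (H n - H (n - 1))) * w0
  have fin : (1 - lam * z) * ((1 - β * z) * ((lam - β) * (G' n - G n))) =
      - (β * z) * ((1 - β * z) * (V1 + V0) * (-2 * (lam - β) * y n + β * (v1 - v0)) +
        (lam - β) * (v1 + v0) * (2 * (1 - β * z) * H n - β * z * (V1 - V0))) := by
    linear_combination (lam - β) * (1 - β * z) * (g' - g) +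
      z * β * (1 - β * z) * (V1 + V0) * yy - z * β * (lam - β) * (v1 + v0) * HH
  -- What remains after the transformation formulas and the three-term relations are used; it holds
  -- by the definition of $L_a$ alone.
  have id2 : (V1 + H n) * (y (n + 1) - y n) + (H n - V0) * (y n - y (n - 1))
      - (v1 + y n) * (H (n + 1) - H n) - (y n - v0) * (H n - H (n - 1)) =
      - 2 * y n * (V1 + V0) + 2 * H n * (v1 + v0) := by
    rw [w0, W0, w1, W1]; ring
  linear_combination fin + m1 - m0 + (β * z) * (1 - β * z) * (lam - β) * id2

end Darboux

end Volterra

/-! ### The flows of $a_n$, $\tilde u_n$ and $\tilde y^j_n$ as power series -/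

namespace Volterra

variable {m r : ℕ} {α : Fin m → ℂ} {δ : ℂ} {t : Fin r → ℂ} {S : State m}

/-- The generating series of the derivatives of the sequence `y^j_n` along the flows. -/
abbrev yFlow (S : State m) (j : Fin m) (n : ℤ) : PowerSeries ℂ :=
  dSeries S.u (flowField S.u (S.y j)) n

/-- The generating series of the derivatives of the coefficient `a_n`. -/
def aFlow (k : Fin m) (S : State m) (n : ℤ) : PowerSeries ℂ :=
  PowerSeries.C (S.y k n + S.y k (n - 1))⁻¹ *
    firstOrder (fun n => PowerSeries.C (aVar k S n)) (yFlow S k) n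

theorem coeff_firstOrder (a : ℤ → ℂ) (F : ℤ → PowerSeries ℂ) (n : ℤ) (i : ℕ) :
    PowerSeries.coeff i (firstOrder (fun n => PowerSeries.C (a n)) F n) =
      firstOrder a (fun n => PowerSeries.coeff i (F n)) n := by
  simp [firstOrder, sub_mul]

theorem firstOrder_C (a y : ℤ → ℂ) (n : ℤ) :
    firstOrder (fun n => PowerSeries.C (a n)) (fun n => PowerSeries.C (y n)) n =
      PowerSeries.C (firstOrder a y n) := by
  simp [firstOrder]

theorem yFlow_eq (hS : IsSolution α δ t S) (h : Nondegenerate S) (j : Fin m) (n : ℤ) :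
    (1 - PowerSeries.C (α j) * PowerSeries.X) * yFlow S j n =
      -(PowerSeries.X * (PowerSeries.C (S.u n) *
        ((hSeries S.u (n + 1) + hSeries S.u n) *
            (PowerSeries.C (S.y j n) + PowerSeries.C (S.y j (n - 1))) -
          (hSeries S.u n + hSeries S.u (n - 1)) *
            (PowerSeries.C (S.y j (n + 1)) + PowerSeries.C (S.y j n))))) := by
  rw [dSeries_eigen (hS.linear h j), map_add, map_add]

/-- In the formula for $L_a$ of the derivative of $y^k$ the increments of $L_ay^k=\omega^k$ vanish,
and the factor $y^k_n+y^k_{n-1}$ cancels against the denominator of $a_n$. -/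
theorem aFlow_eq (hS : IsSolution α δ t S) (h : Nondegenerate S) (k : Fin m) (n : ℤ) :
    (1 - PowerSeries.C (α k) * PowerSeries.X) * aFlow k S n =
      -(PowerSeries.C (α k) * PowerSeries.X *
        (PowerSeries.C (aVar k S n) * (1 - PowerSeries.C (aVar k S n))) *
        (firstOrder (fun n => PowerSeries.C (aVar k S n)) (hSeries S.u) (n + 1) -
          firstOrder (fun n => PowerSeries.C (aVar k S n)) (hSeries S.u) (n - 1))) := by
  have h1 := firstOrder_flow (R := PowerSeries ℂ) (a := fun n => PowerSeries.C (aVar k S n))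
    (u := fun n => PowerSeries.C (S.u n)) (y := fun n => PowerSeries.C (S.y k n))
    (H := hSeries S.u) (G := yFlow S k) (β := PowerSeries.C (α k)) (z := PowerSeries.X)
    (fun n => by rw [hS.u_eq h k]; simp) (fun n => yFlow_eq hS h k n) n
  rw [firstOrder_C, firstOrder_C, firstOrder_aVar (h.add_ne k _),
    firstOrder_aVar (h.add_ne k _), sub_self, mul_zero, sub_zero] at h1
  have h2 : PowerSeries.C (S.y k n + S.y k (n - 1))⁻¹ *
      (PowerSeries.C (S.y k n) + PowerSeries.C (S.y k (n - 1))) = 1 := by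
    rw [← map_add, ← map_mul, inv_mul_cancel₀ (h.add_ne k n), map_one]
  rw [aFlow]
  linear_combination PowerSeries.C (S.y k n + S.y k (n - 1))⁻¹ * h1 -
    (PowerSeries.C (α k) * PowerSeries.X *
        (PowerSeries.C (aVar k S n) * (1 - PowerSeries.C (aVar k S n))) *
        (firstOrder (fun n => PowerSeries.C (aVar k S n)) (hSeries S.u) (n + 1) -
          firstOrder (fun n => PowerSeries.C (aVar k S n)) (hSeries S.u) (n - 1))) * h2

/-- The left side collects the logarithmic derivatives of $u_n$ and of $\tilde
u_n/u_n=\frac{a_{n+1}(1-a_n)}{a_n(1-a_{n+1})}$. -/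
theorem u_flow_transform (hS : IsSolution α δ t S) (h : Nondegenerate S) (k : Fin m) (n : ℤ) :
    hSeries S.u (n + 1) - hSeries S.u (n - 1) +
      PowerSeries.C (aVar k S (n + 1) * (1 - aVar k S (n + 1)))⁻¹ * aFlow k S (n + 1) -
      PowerSeries.C (aVar k S n * (1 - aVar k S n))⁻¹ * aFlow k S n =
    hSeries (Bu k S) (n + 1) - hSeries (Bu k S) (n - 1) := by
  have inv (n : ℤ) : PowerSeries.C (aVar k S n * (1 - aVar k S n))⁻¹ *
      (PowerSeries.C (aVar k S n) * (1 - PowerSeries.C (aVar k S n))) = 1 := by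
    rw [← map_one PowerSeries.C, ← map_sub, ← map_mul, ← map_mul, inv_mul_cancel₀
      (mul_ne_zero (h.aVar_ne_zero k n) (h.one_sub_aVar_ne_zero k n))]
  have i0 := inv n
  have i1 := inv (n + 1)
  have a0 := aFlow_eq hS h k n
  have a1 := aFlow_eq hS h k (n + 1)
  have b0 := hSeriesB_sub (α := α) (S := S) k (n + 1)
  have b1 := hSeriesB_sub (α := α) (S := S) k (n - 1)
  rw [hSeriesB_eq hS h] at b0 b1
  simp only [add_sub_cancel_right, sub_add_cancel] at a1 b1
  refine mul_left_cancel₀ (one_sub_C_mul_X_ne_zero (α k)) ?_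
  generalize firstOrder (fun n => PowerSeries.C (aVar k S n)) (hSeries S.u) (n + 1 + 1) = W2 at *
  generalize firstOrder (fun n => PowerSeries.C (aVar k S n)) (hSeries S.u) (n + 1) = W1 at *
  generalize firstOrder (fun n => PowerSeries.C (aVar k S n)) (hSeries S.u) n = W0 at *
  generalize firstOrder (fun n => PowerSeries.C (aVar k S n)) (hSeries S.u) (n - 1) = Wm at *
  linear_combination -b0 + b1 +
    PowerSeries.C (aVar k S (n + 1) * (1 - aVar k S (n + 1)))⁻¹ * a1 -
    PowerSeries.C (aVar k S n * (1 - aVar k S n))⁻¹ * a0 -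
    PowerSeries.C (α k) * PowerSeries.X * (W2 - W0) * i1 +
    PowerSeries.C (α k) * PowerSeries.X * (W1 - Wm) * i0

theorem ByOff_linear (hS : IsSolution α δ t S) (h : Nondegenerate S) {k j : Fin m}
    (hjk : α j ≠ α k) (n : ℤ) :
    Bu k S n * (ByOff α k S j (n + 1) + ByOff α k S j n) -
      Bu k S (n - 1) * (ByOff α k S j (n - 1) + ByOff α k S j (n - 2)) =
      α j * (ByOff α k S j n - ByOff α k S j (n - 1)) := by
  have := linear_transform (p := 1) (q := α j) (y := S.y j) (hS.Bu_eq h k)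
    (fun n => by rw [mul_one, ByOff_sub hjk h]) (firstOrder_ByOff hS h hjk) n
  rwa [one_mul] at this

theorem y_flow_transform (hS : IsSolution α δ t S) (h : Nondegenerate S) {k j : Fin m}
    (hjk : α j ≠ α k) (n : ℤ) :
    (PowerSeries.C (α j) - PowerSeries.C (α k)) *
      (dSeries (Bu k S) (flowField (Bu k S) (ByOff α k S j)) n - yFlow S j n) =
    -(PowerSeries.C (α k) *
      ((firstOrder (fun n => PowerSeries.C (aVar k S n)) (yFlow S j) (n + 1) -
          aFlow k S (n + 1) * (PowerSeries.C (S.y j (n + 1)) + PowerSeries.C (S.y j n))) -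
        (firstOrder (fun n => PowerSeries.C (aVar k S n)) (yFlow S j) n -
          aFlow k S n * (PowerSeries.C (S.y j n) + PowerSeries.C (S.y j (n - 1)))))) :=
  flow_transform (R := PowerSeries ℂ) (a := fun n => PowerSeries.C (aVar k S n))
    (u := fun n => PowerSeries.C (S.u n)) (u' := fun n => PowerSeries.C (Bu k S n))
    (y := fun n => PowerSeries.C (S.y j n)) (y' := fun n => PowerSeries.C (ByOff α k S j n))
    (H := hSeries S.u) (H' := hSeries (Bu k S)) (G := yFlow S j)
    (G' := dSeries (Bu k S) (flowField (Bu k S) (ByOff α k S j))) (D := aFlow k S)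
    (β := PowerSeries.C (α k)) (lam := PowerSeries.C (α j)) (z := PowerSeries.X)
    (one_sub_C_mul_X_ne_zero _) (one_sub_C_mul_X_ne_zero _)
    (fun n => by rw [hS.u_eq h k]; simp) (fun n => by rw [hS.Bu_eq h k]; simp)
    (fun n => by simpa using congrArg (PowerSeries.C (R := ℂ)) (hS.linear h j n))
    (hSeries_linear _)
    (fun n => by
      rw [firstOrder_C, firstOrder_C]
      simpa using congrArg (PowerSeries.C (R := ℂ)) (ByOff_sub hjk h n))
    (fun n => by rw [← hSeriesB_eq hS h, hSeriesB_sub])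
    (fun n => by
      have := congrArg (PowerSeries.C (R := ℂ)) (firstOrder_ByOff hS h hjk n)
      rw [map_neg, ← firstOrder_C, ← firstOrder_C] at this
      simpa using this)
    (fun n => by
      rw [← firstOrder_hSeriesB hS h, funext (hSeriesB_eq hS h k)])
    (yFlow_eq hS h j)
    (fun n => by
      rw [dSeries_eigen (ByOff_linear hS h hjk), map_add, map_add])
    (aFlow_eq hS h k) n

end Volterra

/-! ### Consistency with the evolution equations -/

namespace Volterra

variable {m r : ℕ} {α : Fin m → ℂ} {δ : ℂ} {t : Fin r → ℂ}

theorem coeff_aFlow (k : Fin m) (S : State m) (n : ℤ) (i : ℕ) :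
    PowerSeries.coeff i (aFlow k S n) = (S.y k n + S.y k (n - 1))⁻¹ *
      ((1 - aVar k S n) * hDer i n S.u (flowField S.u (S.y k)) -
        aVar k S n * hDer i (n - 1) S.u (flowField S.u (S.y k))) := by
  rw [aFlow, PowerSeries.coeff_C_mul, coeff_firstOrder]
  simp only [firstOrder, coeff_dSeries]

/-- The derivative of `ũ_n` along a flow. -/
theorem hasDerivAt_Bu {S : State m} (hS : IsSolution α δ t S) (h : Nondegenerate S) (k : Fin m)
    (n : ℤ) (i : ℕ) {U : ℂ → State m} {z : ℂ} (hz : U z = S) (hω : ∀ x, (U x).ω = S.ω)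
    (hu : ∀ n, HasDerivAt (fun x => (U x).u n)
      (S.u n * (hVal i (n + 1) S.u - hVal i (n - 1) S.u)) z)
    (hy : ∀ j n, HasDerivAt (fun x => (U x).y j n)
      (hDer i n S.u (flowField S.u (S.y j))) z) :
    HasDerivAt (fun x => Bu k (U x) n)
      (Bu k S n * (hVal i (n + 1) (Bu k S) - hVal i (n - 1) (Bu k S))) z := by
  have key := congrArg (PowerSeries.coeff i) (u_flow_transform hS h k n)
  simp only [map_add, map_sub, coeff_hSeries, PowerSeries.coeff_C_mul, coeff_aFlow,
    add_sub_cancel_right] at key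
  have hs := h.add_ne k n
  have hs' := h.add_ne' k n
  have hs1 : S.y k (n + 1) + S.y k (n + 1 - 1) ≠ 0 := h.add_ne k (n + 1)
  have ha := h.aVar_ne_zero k n
  have hb := h.one_sub_aVar_ne_zero k n
  have ha' := h.aVar_ne_zero k (n + 1)
  have hb' := h.one_sub_aVar_ne_zero k (n + 1)
  have e1 := sub_eq_aVar_mul hs
  have e2 := add_eq_one_sub_aVar_mul hs
  have e3 := sub_eq_aVar_mul hs1
  have e4 := add_eq_one_sub_aVar_mul hs1
  rw [add_sub_cancel_right] at e3 e4
  have hden : S.y k n ^ 2 - S.ω k ^ 2 ≠ 0 := (h k n).2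
  have D := ((hu n).mul (((hy k (n + 1)).sub_const (S.ω k)).mul
    ((hy k (n - 1)).add_const (S.ω k)))).div (((hy k n).pow 2).sub_const (S.ω k ^ 2))
    (by simpa [hz] using hden)
  have D' := D.congr_of_eventuallyEq (f₁ := fun x => Bu k (U x) n)
    (Filter.Eventually.of_forall fun x => by simp [Bu, hω])
  refine D'.congr_deriv ?_
  rw [← key]
  simp only [hz, Bu, Pi.mul_apply, Pi.pow_apply]
  have q : S.y k n ^ 2 - S.ω k ^ 2 = (S.y k n - S.ω k) * (S.y k n + S.ω k) := by ring
  have yy : S.y k n = ((S.y k n - S.ω k) + (S.y k n + S.ω k)) / 2 := by ring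
  simp only [Nat.cast_ofNat, Nat.add_one_sub_one, pow_one]
  rw [q]
  -- With $2y=(y-\omega)+(y+\omega)$ the sequence $y^k$ enters the coefficients only through the
  -- factors that `e1`–`e4` express by $a_n$, $a_{n+1}$.
  rw [show ∀ x : ℂ, 2 * S.y k n * x = ((S.y k n - S.ω k) + (S.y k n + S.ω k)) * x from
    fun x => by ring]
  rw [e1, e2, e3, e4]
  field_simp
  ring

theorem hasDerivAt_ByOff {S : State m} (hS : IsSolution α δ t S) (h : Nondegenerate S)
    {k j : Fin m} (hjk : α j ≠ α k)
    (n : ℤ) (i : ℕ) {U : ℂ → State m} {z : ℂ} (hz : U z = S) (hω : ∀ x, (U x).ω = S.ω)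
    (hy : ∀ j n, HasDerivAt (fun x => (U x).y j n)
      (hDer i n S.u (flowField S.u (S.y j))) z) :
    HasDerivAt (fun x => ByOff α k (U x) j n)
      (hDer i n (Bu k S) (flowField (Bu k S) (ByOff α k S j))) z := by
  have key := congrArg (PowerSeries.coeff i) (y_flow_transform hS h hjk n)
  simp only [← map_sub, ← map_add, map_neg, PowerSeries.coeff_C_mul] at key
  simp only [map_sub, PowerSeries.coeff_mul_C, coeff_firstOrder, coeff_dSeries,
    coeff_aFlow, add_sub_cancel_right] at key
  simp only [firstOrder, add_sub_cancel_right] at key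
  have hs := h.add_ne k n
  have hs' := h.add_ne' k n
  have hs1 : S.y k (n + 1) + S.y k (n + 1 - 1) ≠ 0 := h.add_ne k (n + 1)
  have hne := sub_ne_zero.2 hjk
  have e1 := sub_eq_aVar_mul hs
  have e4 := add_eq_one_sub_aVar_mul hs1
  rw [add_sub_cancel_right] at e4
  have f1 := (((hy k n).add_const (S.ω k)).const_mul (α k)).mul
    (((hy j (n + 1)).add (hy j n)).div ((hy k (n + 1)).add (hy k n)) (by simpa [hz] using hs'))
  have f2 := (((hy k n).sub_const (S.ω k)).const_mul (α k)).mul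
    (((hy j n).add (hy j (n - 1))).div ((hy k n).add (hy k (n - 1))) (by simpa [hz] using hs))
  have D := ((((hy j n).const_mul (α j + α k)).sub f1).sub f2).const_mul (1 / (α j - α k))
  have D' := D.congr_of_eventuallyEq (f₁ := fun x => ByOff α k (U x) j n)
    (Filter.Eventually.of_forall fun x => by simp [ByOff, hω])
  refine D'.congr_deriv ?_
  simp only [hz, Pi.add_apply, Pi.div_apply]
  rw [e1, e4]
  refine mul_left_cancel₀ hne ?_
  generalize hDer i n (Bu k S) (flowField (Bu k S) (ByOff α k S j)) = g at *
  rw [mul_sub, sub_eq_iff_eq_add] at key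
  rw [key]
  field_simp
  ring

/-- The sum of the derivatives along the flows of the sequences `y^j`. -/
theorem sum_hDer {S : State m} (hS : IsSolution α δ t S) (i : ℕ) (n : ℤ) :
    ∑ j, hDer i n S.u (flowField S.u (S.y j)) =
      (∑ l : Fin r, (2 * ((l : ℂ) + 1) * t l) * hDer (l + 1) n S.u (hierarchyField i S.u)) +
        2 * (i * hVal i n S.u) := by
  -- The vector field takes the difference of the sum equation at $s+1$ and $s-1$: $\delta$ and the
  -- alternating term cancel, and the term $n$ contributes $2u_s$, to which Euler's identity
  -- applies.
  have e : (fun s => ∑ j, 1 * flowField S.u (S.y j) s) =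
      fun s => (∑ l : Fin r, (2 * ((l : ℂ) + 1) * t l) * hierarchyField (l + 1) S.u s) +
        2 * S.u s := by
    funext s
    have h1 := hS.sum_eq (s + 1)
    have h2 := hS.sum_eq (s - 1)
    rw [timeSum_eq, sgn_add_one] at h1
    rw [timeSum_eq, sgn_sub_one] at h2
    simp only [one_mul, flowField, hierarchyField, ← Finset.mul_sum, Finset.sum_sub_distrib]
    rw [← h1, ← h2]
    simp only [mul_left_comm _ (S.u s), ← Finset.mul_sum, mul_sub, Finset.sum_sub_distrib]
    push_cast
    ring
  have h1 := hDer_sum Finset.univ i n S.u (fun _ => 1) fun j => flowField S.u (S.y j)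
  simp only [one_mul] at h1 e
  rw [← h1, e, hDer_add, hDer_sum, hDer_smul, hDer_self]
  simp only [hDer_hierarchyField_comm]

theorem hasDerivAt_update (t : Fin r → ℂ) (i l : Fin r) :
    HasDerivAt (fun z => Function.update t i z l) (if l = i then 1 else 0) (t i) := by
  split_ifs with hl
  · subst hl
    simpa using hasDerivAt_id' (t l)
  · simpa [Function.update_of_ne hl] using hasDerivAt_const (t i) (t l)

theorem flowsAt_A {S : (Fin r → ℂ) → State m} (hF : FlowsAt t S) (k : Fin m) :
    FlowsAt t fun s => A k (S s) :=
  ⟨fun s => ⟨by simp only [A, (hF.1 s).1], (hF.1 s).2⟩, hF.2.1, hF.2.2⟩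

theorem flowsAt_B (hinj : Function.Injective α) {S : (Fin r → ℂ) → State m}
    (hS : IsSolution α δ t (S t)) (hF : FlowsAt t S) (h : Nondegenerate (S t)) (k : Fin m) :
    FlowsAt t fun s => B α δ s k (S s) := by
  have hT := isSolution_B hinj hS h k
  obtain ⟨hω, hu, hy⟩ := hF
  simp only [hXi_eq_hDer] at hy
  have Du (i : Fin r) (n : ℤ) : HasDerivAt (fun z => Bu k (S (Function.update t i z)) n) _ (t i) :=
    hasDerivAt_Bu hS h k n (i + 1) (U := fun z => S (Function.update t i z)) (by simp)
      (fun x => (hω _).1) (hu i) (hy i)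
  have Dy (i : Fin r) (j : Fin m) (hj : j ≠ k) (n : ℤ) :
      HasDerivAt (fun z => ByOff α k (S (Function.update t i z)) j n) _ (t i) :=
    hasDerivAt_ByOff hS h (fun e => hj (hinj e)) n (i + 1)
      (U := fun z => S (Function.update t i z)) (by simp) (fun x => (hω _).1) (hy i)
  refine ⟨fun s => ⟨by simp only [B, (hω s).1], by simp only [B, (hω s).2]⟩, Du,
    fun i j n => ?_⟩
  rw [hXi_eq_hDer]
  rcases eq_or_ne j k with rfl | hj
  -- For $\tilde y^k$ the sum equation of the image is differentiated. Its explicit dependence on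
  -- $t_i$ gives $2i\,h^{(i)}_n(\tilde u)$, which is the Euler term in `sum_hDer`; the remaining
  -- terms match by the consistency of the hierarchy.
  · have hsum := sum_hDer hT (i + 1) n
    rw [← Finset.add_sum_erase _ _ (Finset.mem_univ j)] at hsum
    have e : ∑ l ∈ Finset.univ.erase j, hDer (i + 1) n (B α δ t j (S t)).u
        (flowField (B α δ t j (S t)).u ((B α δ t j (S t)).y l)) =
        ∑ l ∈ Finset.univ.erase j, hDer (i + 1) n (Bu j (S t))
          (flowField (Bu j (S t)) (ByOff α j (S t) l)) :=
      Finset.sum_congr rfl fun l hl => by simp only [B, if_neg (Finset.ne_of_mem_erase hl)]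
    rw [e] at hsum
    have D1 := HasDerivAt.fun_sum (u := Finset.univ.erase j)
      (fun l hl => Dy i l (Finset.ne_of_mem_erase hl) n)
    have D2 := HasDerivAt.fun_sum (u := Finset.univ) (fun (l : Fin r) _ =>
      ((hasDerivAt_update t i l).const_mul (2 * ((l : ℂ) + 1))).mul
        (hasDerivAt_hVal (Du i) (l + 1) n))
    have D := (((D1.neg.add D2).add_const (n : ℂ)).sub_const δ).sub_const (sgn n * (S t).ε)
    have D' := D.congr_of_eventuallyEq
      (f₁ := fun z => (B α δ (Function.update t i z) j (S (Function.update t i z))).y j n)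
      (Filter.Eventually.of_forall fun x => by
        simp [B, ByDiag, timeSum_eq, (hω _).2])
    refine D'.congr_deriv ?_
    simp only [Function.update_eq_self, Finset.sum_add_distrib, mul_ite, ite_mul, mul_one,
      mul_zero, zero_mul, Finset.sum_ite_eq', Finset.mem_univ, if_true]
    have hu : (B α δ t j (S t)).u = Bu j (S t) := rfl
    rw [hu] at hsum ⊢
    rw [eq_sub_of_add_eq hsum]
    have hf : hierarchyField (i + 1) (Bu j (S t)) = fun s => Bu j (S t) s *
      (hVal (i + 1) (s + 1) (Bu j (S t)) - hVal (i + 1) (s - 1) (Bu j (S t))) := rfl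
    rw [hf]
    push_cast
    ring
  · simp only [B, if_neg hj]
    exact Dy i j hj n

end Volterra

/-! ### Relations between the maps -/

namespace Volterra

variable {m r : ℕ} {α : Fin m → ℂ} {δ : ℂ} {t : Fin r → ℂ} {S : State m}

theorem A_A (k : Fin m) (S : State m) : A k (A k S) = S := by
  ext <;> simp [A]

theorem A_comm {j k : Fin m} (hjk : j ≠ k) (S : State m) : A j (A k S) = A k (A j S) := by
  simp only [A, Function.update_of_ne hjk, Function.update_of_ne hjk.symm]
  rw [Function.update_comm hjk.symm]

theorem A_B {j k : Fin m} (hjk : j ≠ k) (S : State m) :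
    A j (B α δ t k S) = B α δ t k (A j S) := by
  have hω : (A j S).ω k = S.ω k := by simp [A, Function.update_of_ne hjk.symm]
  have hu : Bu k (A j S) = Bu k S := by
    funext n; simp only [Bu, hω]; rfl
  have hy : ByOff α k (A j S) = ByOff α k S := by
    funext l n; simp only [ByOff, hω]; rfl
  have hd : ByDiag α δ t k (A j S) = ByDiag α δ t k S := by
    funext n; simp only [ByDiag, hu, hy]; rfl
  simp only [B, hu, hy, hd]
  simp only [A, Function.update_of_ne hjk, Function.update_of_ne hjk.symm]
  rw [Function.update_comm hjk.symm]

@[simp] theorem B_ε (k : Fin m) : (B α δ t k S).ε = -S.ε := rfl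

@[simp] theorem B_ω_self (k : Fin m) : (B α δ t k S).ω k = 1 - S.ω k := by simp [B]

theorem B_ω_of_ne {j k : Fin m} (hjk : j ≠ k) : (B α δ t k S).ω j = S.ω j := by
  simp [B, Function.update_of_ne hjk]

@[simp] theorem B_y_self (k : Fin m) : (B α δ t k S).y k = ByDiag α δ t k S := by
  simp [B]

theorem B_y_of_ne {j k : Fin m} (hjk : j ≠ k) : (B α δ t k S).y j = ByOff α k S j := by
  simp [B, hjk]

/-- The relation $L_{1-a}\tilde y^k=1-\omega^k=\tilde\omega^k$ characterizes $1-a$ as the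
coefficient of the image. Therefore a second application of $B_k$ restores $a$. -/
theorem aVar_B_self (hinj : Function.Injective α) (hS : IsSolution α δ t S)
    (h : Nondegenerate S) {k : Fin m} (hT : Nondegenerate (B α δ t k S)) (n : ℤ) :
    aVar k (B α δ t k S) n = 1 - aVar k S n := by
  have h1 := firstOrder_ByDiag hinj hS h k n
  rw [aVar, div_eq_iff (hT.add_ne k n), B_ω_self, B_y_self]
  simp only [firstOrder] at h1
  linear_combination h1

/-- Solutions with the same `u`, `ε` and the same `y^j` for `j ≠ k` are equal. -/
theorem y_eq_of_others {S T : State m} (hsum : ∀ n, ∑ j, S.y j n = ∑ j, T.y j n) (k : Fin m)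
    (h : ∀ j, j ≠ k → S.y j = T.y j) : S.y k = T.y k := by
  funext n
  have := hsum n
  rw [← Finset.add_sum_erase _ _ (Finset.mem_univ k),
    ← Finset.add_sum_erase _ _ (Finset.mem_univ k)] at this
  rw [Finset.sum_congr rfl fun j hj => congrFun (h j (Finset.ne_of_mem_erase hj)) n] at this
  exact add_right_cancel this

theorem B_B (hinj : Function.Injective α) (hS : IsSolution α δ t S)
    (h : Nondegenerate S) {k : Fin m} (hT : Nondegenerate (B α δ t k S)) :
    B α δ t k (B α δ t k S) = S := by
  have sT := isSolution_B hinj hS h k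
  have ha := aVar_B_self hinj hS h hT
  have hu : Bu k (B α δ t k S) = S.u := by
    funext n
    rw [sT.Bu_eq hT, ha, ha, hS.u_eq h k]; ring
  have hy (j : Fin m) (hj : j ≠ k) : (B α δ t k (B α δ t k S)).y j = S.y j := by
    funext n
    have hjk : α j ≠ α k := fun e => hj (hinj e)
    have e1 := ByOff_sub hjk hT n
    have e2 := ByOff_sub hjk h n
    rw [funext ha, B_y_of_ne hj, firstOrder_ByOff hS h hjk, firstOrder_ByOff hS h hjk] at e1
    rw [B_y_of_ne hj]
    refine mul_left_cancel₀ (sub_ne_zero.2 hjk) ?_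
    linear_combination e1 + e2
  have hk : (B α δ t k (B α δ t k S)).y k = S.y k := by
    refine y_eq_of_others (fun n => ?_) k hy
    rw [sum_B_y, hu, ← hS.sum_eq, B_ε]; ring
  refine State.ext ?_ ?_ hu ?_
  · simp [B]
  · simp
  · funext j
    rcases eq_or_ne j k with rfl | hj
    · exact hk
    · exact hy j hj

theorem u_eq_u (hS : IsSolution α δ t S) (h : Nondegenerate S) (j k : Fin m) (n : ℤ) :
    α k * (aVar k S n * (1 - aVar k S (n + 1))) = α j * (aVar j S n * (1 - aVar j S (n + 1))) := by
  rw [← hS.u_eq h, ← hS.u_eq h]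

theorem one_sub_aVar_mul_ByOff_add (hS : IsSolution α δ t S) (h : Nondegenerate S)
    {k j : Fin m} (hjk : α j ≠ α k) (n : ℤ) :
    (1 - aVar k S n) * (ByOff α k S j n + ByOff α k S j (n - 1)) =
      ByOff α k S j n + firstOrder (aVar k S) (S.y j) n := by
  have := firstOrder_ByOff hS h hjk n
  simp only [firstOrder] at this ⊢
  linear_combination -this

/-- The two expressions for $u_n$ turn $a_n(1-a_{n+1})$ into a multiple of $b_n(1-b_{n+1})$, where
$b$ belongs to $j$; this eliminates $y^j_{n+1}$ and $a_{n+1}$, leaving only data at $n$ and $n-1$.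
-/
theorem aVar_mul_ByOff (hS : IsSolution α δ t S) (h : Nondegenerate S)
    {k j : Fin m} (hjk : α j ≠ α k) (n : ℤ) :
    (α j - α k) * (aVar k S n * ByOff α k S j n) =
      α j * (aVar k S n * S.y j n) + α k * (aVar k S n * S.y j n) -
        α j * (aVar j S n * (S.y j n + S.ω j)) -
        α k * (aVar k S n ^ 2 * (S.y j n + S.y j (n - 1))) := by
  have h1 := ByOff_sub hjk h n
  have h2 := u_eq_u hS h j k n
  have h3 := add_eq_one_sub_aVar_mul (h.add_ne j (n + 1))
  simp only [firstOrder, add_sub_cancel_right] at h1 h3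
  linear_combination aVar k S n * h1 - (S.y j (n + 1) + S.y j n) * h2 +
    α j * aVar j S n * h3

theorem ByOff_add_eq (hS : IsSolution α δ t S) (h : Nondegenerate S)
    {k j : Fin m} (hjk : α j ≠ α k) (n : ℤ) :
    (α j - α k) * (aVar k S n * ((1 - aVar k S n) *
        (ByOff α k S j n + ByOff α k S j (n - 1)))) =
      (aVar j S n - aVar k S n) * (α j *
        (aVar k S n * (S.y j n + S.y j (n - 1)) - (S.y j n + S.ω j))) := by
  rw [one_sub_aVar_mul_ByOff_add hS h hjk]
  have h1 := aVar_mul_ByOff hS h hjk n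
  have h2 := sub_eq_aVar_mul (h.add_ne j n)
  simp only [firstOrder] at h1 ⊢
  linear_combination h1 + α j * aVar k S n * h2

theorem ByOff_sub_eq (hS : IsSolution α δ t S) (h : Nondegenerate S)
    {k j : Fin m} (hjk : α j ≠ α k) (n : ℤ) :
    α j * (aVar j S n - aVar k S n) * (ByOff α k S j n - S.ω j) =
      (1 - aVar k S n) * (α j * aVar j S n - α k * aVar k S n) *
        (ByOff α k S j n + ByOff α k S j (n - 1)) := by
  have h0 := one_sub_aVar_mul_ByOff_add hS h hjk n
  have h1 := aVar_mul_ByOff hS h hjk n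
  have h2 := sub_eq_aVar_mul (h.add_ne j n)
  refine mul_left_cancel₀ (sub_ne_zero.2 hjk) (mul_left_cancel₀ (h.aVar_ne_zero k n) ?_)
  simp only [firstOrder] at h0
  linear_combination -(α j - α k) * aVar k S n * (α j * aVar j S n - α k * aVar k S n) * h0 -
    (α j - α k) * aVar k S n * h1 - (α j - α k) * α j * aVar k S n ^ 2 * h2

/-- Equality of the coefficients would annihilate $\tilde y^j_n+\tilde y^j_{n-1}$. -/
theorem aVar_ne_aVar (hS : IsSolution α δ t S) (h : Nondegenerate S)
    {k j : Fin m} (hjk : α j ≠ α k) (hT : Nondegenerate (B α δ t k S)) (n : ℤ) :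
    aVar j S n - aVar k S n ≠ 0 := by
  intro e
  have h1 := ByOff_add_eq hS h hjk n
  rw [e, zero_mul] at h1
  have h2 := hT.add_ne j n
  rw [B_y_of_ne (fun e => hjk (by rw [e]))] at h2
  exact mul_ne_zero (sub_ne_zero.2 hjk) (mul_ne_zero (h.aVar_ne_zero k n)
    (mul_ne_zero (h.one_sub_aVar_ne_zero k n) h2)) h1

theorem aVar_B (hα : ∀ j, α j ≠ 0) (hS : IsSolution α δ t S) (h : Nondegenerate S)
    {k j : Fin m} (hjk : α j ≠ α k) (hT : Nondegenerate (B α δ t k S)) (n : ℤ) :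
    aVar j (B α δ t k S) n = (1 - aVar k S n) * (α j * aVar j S n - α k * aVar k S n) /
      (α j * (aVar j S n - aVar k S n)) := by
  have hne : j ≠ k := fun e => hjk (by rw [e])
  have h1 := ByOff_sub_eq hS h hjk n
  rw [eq_div_iff (mul_ne_zero (hα j) (aVar_ne_aVar hS h hjk hT n)), aVar, div_mul_eq_mul_div,
    div_eq_iff (hT.add_ne j n), B_ω_of_ne hne, B_y_of_ne hne]
  linear_combination h1

theorem aVar_B' (hα : ∀ j, α j ≠ 0) (hS : IsSolution α δ t S) (h : Nondegenerate S)
    {k j : Fin m} (hjk : α j ≠ α k) (hU : Nondegenerate (B α δ t j S)) (n : ℤ) :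
    aVar k (B α δ t j S) n = (1 - aVar j S n) * (α j * aVar j S n - α k * aVar k S n) /
      (α k * (aVar j S n - aVar k S n)) := by
  rw [aVar_B hα hS h hjk.symm hU, ← neg_div_neg_eq]
  congr 1 <;> ring

/-- After the rational formulas for the new coefficients are inserted, the two sides agree modulo
the relation $\alpha^ka_n(1-a_{n+1})=\alpha^jb_n(1-b_{n+1})$. -/
theorem Bu_comm (hα : ∀ j, α j ≠ 0) (hinj : Function.Injective α) (hS : IsSolution α δ t S)
    (h : Nondegenerate S) {k j : Fin m} (hjk : α j ≠ α k) (hT : Nondegenerate (B α δ t k S))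
    (hU : Nondegenerate (B α δ t j S)) :
    Bu j (B α δ t k S) = Bu k (B α δ t j S) := by
  funext n
  rw [(isSolution_B hinj hS h k).Bu_eq hT, (isSolution_B hinj hS h j).Bu_eq hU,
    aVar_B hα hS h hjk hT, aVar_B hα hS h hjk hT, aVar_B' hα hS h hjk hU,
    aVar_B' hα hS h hjk hU]
  have e := u_eq_u hS h j k n
  have n0 := aVar_ne_aVar hS h hjk hT n
  have n1 := aVar_ne_aVar hS h hjk hT (n + 1)
  have hj := hα j
  have hk := hα k
  generalize aVar j S n = b at *
  generalize aVar k S n = a at *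
  generalize aVar j S (n + 1) = b' at *
  generalize aVar k S (n + 1) = a' at *
  generalize α j = q at *
  generalize α k = p at *
  have c1 : 1 - (1 - a) * (q * b - p * a) / (q * (b - a)) =
      -(a * (q * (1 - b) - p * (1 - a))) / (q * (b - a)) := by
    field_simp; ring
  have c2 : 1 - (1 - b) * (q * b - p * a) / (p * (b - a)) =
      -(b * (q * (1 - b) - p * (1 - a))) / (p * (b - a)) := by
    field_simp; ring
  rw [c1, c2]
  field_simp
  linear_combination -((q * (1 - b) - p * (1 - a)) * (q * b' - p * a')) * e

/-- The image of $y^l$ under both maps is $y^l-\Delta(\dots)$; this says that the expression in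
brackets does not depend on the order. -/
theorem firstOrder_ByOff_symm (hα : ∀ j, α j ≠ 0)
    (hS : IsSolution α δ t S) (h : Nondegenerate S) {k j l : Fin m} (hjk : α j ≠ α k)
    (hlj : α l ≠ α j) (hlk : α l ≠ α k)
    (hT : Nondegenerate (B α δ t k S)) (hU : Nondegenerate (B α δ t j S)) (n : ℤ) :
    α k / (α l - α k) * firstOrder (aVar k S) (S.y l) n +
      α j / (α l - α j) * firstOrder (aVar j (B α δ t k S)) (ByOff α k S l) n =
    α j / (α l - α j) * firstOrder (aVar j S) (S.y l) n +
      α k / (α l - α k) * firstOrder (aVar k (B α δ t j S)) (ByOff α j S l) n := by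
  have e := u_eq_u hS h j k n
  have n0 := aVar_ne_aVar hS h hjk hT n
  have f1 := one_sub_aVar_mul_ByOff_add hS h hlk n
  have f2 := one_sub_aVar_mul_ByOff_add hS h hlj n
  have g1 := aVar_B hα hS h hjk hT n
  have g2 := aVar_B' hα hS h hjk hU n
  have r1 : firstOrder (aVar j (B α δ t k S)) (ByOff α k S l) n = ByOff α k S l n -
      (α j * aVar j S n - α k * aVar k S n) / (α j * (aVar j S n - aVar k S n)) *
        (ByOff α k S l n + firstOrder (aVar k S) (S.y l) n) := by
    rw [← f1, firstOrder, g1]; ring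
  have r2 : firstOrder (aVar k (B α δ t j S)) (ByOff α j S l) n = ByOff α j S l n -
      (α j * aVar j S n - α k * aVar k S n) / (α k * (aVar j S n - aVar k S n)) *
        (ByOff α j S l n + firstOrder (aVar j S) (S.y l) n) := by
    rw [← f2, firstOrder, g2]; ring
  rw [r1, r2, ByOff_eq hlk (h.add_ne k n) (h.add_ne' k n),
    ByOff_eq hlj (h.add_ne j n) (h.add_ne' j n)]
  have hj := hα j
  have hk := hα k
  have q1 := sub_ne_zero.2 hlj
  have q2 := sub_ne_zero.2 hlk
  have hb := h.aVar_ne_zero j n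
  have ha := h.aVar_ne_zero k n
  simp only [firstOrder, add_sub_cancel_right]
  -- The parameter $\tau=u_n/(\alpha^j\alpha^kb_na_n)$ solves the relation between the two
  -- expressions for $u_n$ rationally, so that a field identity without side conditions remains.
  obtain ⟨τ, hτ⟩ : ∃ τ, 1 - aVar k S (n + 1) = α j * aVar j S n * τ :=
    ⟨(1 - aVar k S (n + 1)) / (α j * aVar j S n), by field_simp⟩
  have hτ' : 1 - aVar j S (n + 1) = α k * aVar k S n * τ := by
    rw [hτ] at e
    refine mul_left_cancel₀ (mul_ne_zero hj hb) ?_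
    linear_combination -e
  have p1 : aVar k S (n + 1) = 1 - α j * aVar j S n * τ := by linear_combination -hτ
  have p2 : aVar j S (n + 1) = 1 - α k * aVar k S n * τ := by linear_combination -hτ'
  rw [p1, p2]
  generalize aVar j S n = b at *
  generalize aVar k S n = a at *
  generalize α j = q at *
  generalize α k = p at *
  field_simp
  ring

/-- The sequences $y^l$, $l\ne j,k$, agree by the symmetric formula, and the sum equation makes the
discrepancies of $y^k$ and $y^j$ opposite. In both orders $y^k$ has the same coefficient, and so has
$y^j$, so the discrepancy satisfies two homogeneous first order relations with different
coefficients and vanishes. -/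
theorem B_comm (hα : ∀ j, α j ≠ 0) (hinj : Function.Injective α) (hS : IsSolution α δ t S)
    (h : Nondegenerate S) {k j : Fin m} (hne : j ≠ k) (hT : Nondegenerate (B α δ t k S))
    (hU : Nondegenerate (B α δ t j S)) :
    B α δ t j (B α δ t k S) = B α δ t k (B α δ t j S) := by
  have hjk : α j ≠ α k := fun e => hne (hinj e)
  have sT := isSolution_B hinj hS h k
  have sU := isSolution_B hinj hS h j
  have hu := Bu_comm hα hinj hS h hjk hT hU
  have hy (l : Fin m) (hlk : l ≠ k) (hlj : l ≠ j) :
      (B α δ t j (B α δ t k S)).y l = (B α δ t k (B α δ t j S)).y l := by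
    funext n
    have hlk' : α l ≠ α k := fun e => hlk (hinj e)
    have hlj' : α l ≠ α j := fun e => hlj (hinj e)
    rw [B_y_of_ne hlk, B_y_of_ne hlj, ByOff_eq hlj' (hT.add_ne j n) (hT.add_ne' j n),
      ByOff_eq hlk' (hU.add_ne k n) (hU.add_ne' k n), B_y_of_ne hlk, B_y_of_ne hlj,
      ByOff_eq hlk' (h.add_ne k n) (h.add_ne' k n), ByOff_eq hlj' (h.add_ne j n) (h.add_ne' j n)]
    have z0 := firstOrder_ByOff_symm hα hS h hjk hlj' hlk' hT hU n
    have z1 := firstOrder_ByOff_symm hα hS h hjk hlj' hlk' hT hU (n + 1)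
    linear_combination z0 - z1
  have hsum (n : ℤ) : ∑ l, (B α δ t j (B α δ t k S)).y l n =
      ∑ l, (B α δ t k (B α δ t j S)).y l n := by
    rw [sum_B_y, sum_B_y, hu, B_ε, B_ε]
  -- the remaining two sequences differ by a common sequence with two first order relations
  have hd (n : ℤ) : ((B α δ t j (B α δ t k S)).y k n - (B α δ t k (B α δ t j S)).y k n) +
      ((B α δ t j (B α δ t k S)).y j n - (B α δ t k (B α δ t j S)).y j n) = 0 := by
    have e := hsum n
    have hmem : j ∈ Finset.univ.erase k := Finset.mem_erase.2 ⟨hne, Finset.mem_univ j⟩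
    rw [← Finset.add_sum_erase _ _ (Finset.mem_univ k), ← Finset.add_sum_erase _ _ hmem,
      ← Finset.add_sum_erase _ _ (Finset.mem_univ k), ← Finset.add_sum_erase _ _ hmem] at e
    rw [Finset.sum_congr rfl fun l hl => congrFun (hy l
      (Finset.ne_of_mem_erase (Finset.mem_of_mem_erase hl)) (Finset.ne_of_mem_erase hl)) n] at e
    linear_combination e
  have key (n : ℤ) : (B α δ t j (B α δ t k S)).y k n = (B α δ t k (B α δ t j S)).y k n := by
    have f1 := firstOrder_ByDiag hinj sT hT j n
    have f2 := firstOrder_ByDiag hinj sU hU k n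
    have f3 := ByOff_sub_eq sT hT hjk.symm n
    have f4 := ByOff_sub_eq sU hU hjk n
    have d0 := hd n
    have d1 := hd (n - 1)
    rw [B_y_of_ne hne.symm, B_y_of_ne hne, B_y_self, B_y_self] at d0 d1
    rw [B_y_of_ne hne.symm, B_y_self]
    have g1 := aVar_B hα hS h hjk hT n
    have g2 := aVar_B' hα hS h hjk hU n
    have hab := aVar_ne_aVar hS h hjk hT n
    have hcT := hT.one_sub_aVar_ne_zero j n
    have hbT := hT.aVar_ne_zero j n
    have ha := h.aVar_ne_zero k n
    have hb := h.aVar_ne_zero j n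
    have ha' := h.one_sub_aVar_ne_zero k n
    have hb' := h.one_sub_aVar_ne_zero j n
    have hq := hα j
    have hp := hα k
    have hpq := sub_ne_zero.2 hjk
    rw [aVar_B_self hinj hS h hT, B_ω_self] at f3
    rw [aVar_B_self hinj hS h hU, B_ω_self] at f4
    rw [B_ω_of_ne hne] at f1
    rw [B_ω_of_ne hne.symm] at f2
    rw [eq_div_iff (mul_ne_zero hq hab)] at g1
    rw [eq_div_iff (mul_ne_zero hp hab)] at g2
    simp only [firstOrder] at f1 f2
    generalize ByOff α j (B α δ t k S) k n = Pk at *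
    generalize ByOff α j (B α δ t k S) k (n - 1) = Pk' at *
    generalize ByOff α k (B α δ t j S) j n = Qj at *
    generalize ByOff α k (B α δ t j S) j (n - 1) = Qj' at *
    generalize ByDiag α δ t j (B α δ t k S) n = Pj at *
    generalize ByDiag α δ t j (B α δ t k S) (n - 1) = Pj' at *
    generalize ByDiag α δ t k (B α δ t j S) n = Qk at *
    generalize ByDiag α δ t k (B α δ t j S) (n - 1) = Qk' at *
    generalize aVar j (B α δ t k S) n = bT at *
    generalize aVar k (B α δ t j S) n = aU at *
    generalize aVar j S n = b at *
    generalize aVar k S n = a at *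
    generalize α j = q at *
    generalize α k = p at *
    have r : q * b * (1 - bT) = p * a * (1 - aU) := by
      refine mul_right_cancel₀ hab ?_
      linear_combination -b * g1 + a * g2
    have x1 : p * (1 - a - bT) * (q * (b - a)) = p * (1 - a) * a * (p - q) := by
      linear_combination -p * g1
    have x2 : (p * (1 - a) - q * bT) * (b - a) = (1 - a) * b * (p - q) := by
      linear_combination -g1
    have y1 : q * (1 - b - aU) * (p * (b - a)) = q * (1 - b) * b * (p - q) := by
      linear_combination -q * g2
    have y2 : (q * (1 - b) - p * aU) * (b - a) = (1 - b) * a * (p - q) := by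
      linear_combination -g2
    have hpq' : p - q ≠ 0 := by rw [← neg_sub]; exact neg_ne_zero.2 hpq
    -- This is the relation that `f2` gives for $y^k$ in the other order of the maps; `z2` is its
    -- counterpart for $y^j$ and `f1`.
    have z1 : Pk - (1 - S.ω k) = (1 - aU) * (Pk + Pk') := by
      refine mul_left_cancel₀ (mul_ne_zero (mul_ne_zero (mul_ne_zero hp ha') ha) hpq') ?_
      linear_combination q * (b - a) * f3 - (Pk - (1 - S.ω k)) * x1 +
        (1 - bT) * (Pk + Pk') * q * x2 + (1 - a) * (p - q) * (Pk + Pk') * r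
    have z2 : Qj - (1 - S.ω j) = (1 - bT) * (Qj + Qj') := by
      refine mul_left_cancel₀ (mul_ne_zero (mul_ne_zero (mul_ne_zero hq hb') hb) hpq') ?_
      linear_combination p * (b - a) * f4 - (Qj - (1 - S.ω j)) * y1 +
        (1 - aU) * (Qj + Qj') * p * y2 - (1 - b) * (p - q) * (Qj + Qj') * r
    have hne' : bT - aU ≠ 0 := by
      intro e
      have e1 : (1 - bT) * (q * b - p * a) = 0 := by linear_combination r + p * a * e
      rcases mul_eq_zero.1 e1 with e2 | e2
      · exact hcT e2
      · rw [e2, mul_zero] at g1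
        exact (mul_ne_zero hbT (mul_ne_zero hq hab)) g1
    -- The discrepancy $d$ satisfies $d_n=c(d_n+d_{n-1})$ for $c=1-a_U$ and for $c=1-b_T$, where
    -- $a_U$, $b_T$ stand for `aU`, `bT`; subtract.
    have s0 : (Pk - Qk) + (Pk' - Qk') = 0 := by
      refine (mul_eq_zero.1 ?_).resolve_left hne'
      linear_combination d0 - z1 + f2 - f1 + z2 - (1 - bT) * (d0 + d1)
    refine sub_eq_zero.1 ?_
    linear_combination z1 - f2 + (1 - aU) * s0
  refine State.ext ?_ ?_ hu ?_
  · simp only [B, Function.update_of_ne hne, Function.update_of_ne hne.symm]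
    rw [Function.update_comm hne.symm]
  · simp
  · funext l
    rcases eq_or_ne l k with rfl | hlk
    · exact funext key
    · rcases eq_or_ne l j with rfl | hlj
      · funext n
        have := hd n
        rw [key n] at this
        linear_combination this
      · exact hy l hlk hlj

end Volterra

/-! ### Groups generated by involutions with these relations -/

namespace Volterra

section Group

variable {m : ℕ} {M : Type*} [Group M]

/-- The homomorphism from `{1, -1}` given by an involution. -/
def signHom (x : M) (hx : x * x = 1) : ℤˣ →* M where
  toFun e := if e = 1 then 1 else x
  map_one' := if_pos rfl
  map_mul' e f := by
    rcases Int.units_eq_one_or e with rfl | rfl <;> rcases Int.units_eq_one_or f with rfl | rfl <;>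
      simp [hx]

theorem signHom_neg_one (x : M) (hx : x * x = 1) : signHom x hx (-1) = x := by
  simp [signHom]

theorem signHom_mem (x : M) (hx : x * x = 1) (e : ℤˣ) : signHom x hx e = 1 ∨ signHom x hx e = x := by
  rcases Int.units_eq_one_or e with rfl | rfl
  · exact Or.inl (map_one _)
  · exact Or.inr (signHom_neg_one x hx)

theorem signHom_pairwise {a : Fin m → M} (ha : ∀ k, a k * a k = 1)
    (hc : ∀ j k, j ≠ k → Commute (a j) (a k)) :
    Pairwise fun j k => ∀ x y, Commute (signHom (a j) (ha j) x) (signHom (a k) (ha k) y) := by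
  intro j k hjk x y
  rcases signHom_mem (a j) (ha j) x with h1 | h1 <;>
    rcases signHom_mem (a k) (ha k) y with h2 | h2 <;> simp only [h1, h2]
  · exact Commute.one_left _
  · exact Commute.one_left _
  · exact Commute.one_right _
  · exact hc j k hjk

/-- The homomorphism from `{1, -1}^m` given by commuting involutions. -/
def signsHom (a : Fin m → M) (ha : ∀ k, a k * a k = 1)
    (hc : ∀ j k, j ≠ k → Commute (a j) (a k)) : (Fin m → ℤˣ) →* M :=
  MonoidHom.noncommPiCoprod (fun k => signHom (a k) (ha k)) (signHom_pairwise ha hc)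

theorem signsHom_mulSingle (a : Fin m → M) (ha : ∀ k, a k * a k = 1)
    (hc : ∀ j k, j ≠ k → Commute (a j) (a k)) (k : Fin m) :
    signsHom a ha hc (Pi.mulSingle k (-1)) = a k := by
  rw [signsHom, MonoidHom.noncommPiCoprod_mulSingle, signHom_neg_one]

theorem zpowersHom_pairwise {c : Fin m → M} (hc : ∀ j k, j ≠ k → Commute (c j) (c k)) :
    Pairwise fun j k => ∀ x y, Commute (zpowersHom M (c j) x) (zpowersHom M (c k) y) := by
  intro j k hjk x y
  simp only [zpowersHom_apply]
  exact (hc j k hjk).zpow_zpow _ _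

/-- The homomorphism from `ℤ^m` given by commuting elements. -/
def shiftsHom (c : Fin m → M) (hc : ∀ j k, j ≠ k → Commute (c j) (c k)) :
    Multiplicative (Fin m → ℤ) →* M :=
  (MonoidHom.noncommPiCoprod (fun k => zpowersHom M (c k)) (zpowersHom_pairwise hc)).comp
  { toFun := fun v k => Multiplicative.ofAdd (v.toAdd k)
    map_one' := rfl
    map_mul' := fun _ _ => rfl }

theorem shiftsHom_single (c : Fin m → M) (hc : ∀ j k, j ≠ k → Commute (c j) (c k)) (k : Fin m)
    (n : ℤ) : shiftsHom c hc (Multiplicative.ofAdd (Pi.single k n)) = c k ^ n := by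
  have e : (fun l => Multiplicative.ofAdd ((Pi.single k n : Fin m → ℤ) l)) =
      Pi.mulSingle k (Multiplicative.ofAdd n) := by
    funext l
    rcases eq_or_ne l k with rfl | h
    · simp
    · simp [h]
  rw [shiftsHom, MonoidHom.comp_apply]
  simp only [MonoidHom.coe_mk, OneHom.coe_mk, toAdd_ofAdd]
  rw [e, MonoidHom.noncommPiCoprod_mulSingle, zpowersHom_apply, toAdd_ofAdd]

theorem mem_of_mulSingle_mem (P : Submonoid (Fin m → ℤˣ)) (h : ∀ k, Pi.mulSingle k (-1) ∈ P)
    (σ : Fin m → ℤˣ) : σ ∈ P := by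
  rw [← Finset.univ_prod_mulSingle σ]
  refine Submonoid.prod_mem _ fun k _ => ?_
  rcases Int.units_eq_one_or (σ k) with e | e
  · rw [e, Pi.mulSingle_one]; exact P.one_mem
  · rw [e]; exact h k

theorem mem_of_single_mem (P : Submonoid (Multiplicative (Fin m → ℤ)))
    (h : ∀ k n, Multiplicative.ofAdd (Pi.single k n) ∈ P) (v : Multiplicative (Fin m → ℤ)) :
    v ∈ P := by
  have e : v = ∏ k, Multiplicative.ofAdd (Pi.single k (v.toAdd k) : Fin m → ℤ) := by
    rw [← ofAdd_sum, Finset.univ_sum_single, ofAdd_toAdd]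
  rw [e]
  exact Submonoid.prod_mem _ fun k _ => h k _

theorem signAction_mulSingle_self (k : Fin m) (n : ℤ) :
    signAction m (Pi.mulSingle k (-1)) (Multiplicative.ofAdd (Pi.single k n)) =
      Multiplicative.ofAdd (Pi.single k (-n)) := by
  apply Multiplicative.toAdd.injective
  funext l
  change ((Pi.mulSingle k (-1) : Fin m → ℤˣ) l : ℤ) * (Pi.single k n : Fin m → ℤ) l =
    (Pi.single k (-n) : Fin m → ℤ) l
  rcases eq_or_ne l k with rfl | h
  · simp
  · simp [h]

theorem signAction_mulSingle_of_ne {j k : Fin m} (hjk : j ≠ k) (n : ℤ) :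
    signAction m (Pi.mulSingle k (-1)) (Multiplicative.ofAdd (Pi.single j n)) =
      Multiplicative.ofAdd (Pi.single j n) := by
  apply Multiplicative.toAdd.injective
  funext l
  change ((Pi.mulSingle k (-1) : Fin m → ℤˣ) l : ℤ) * (Pi.single j n : Fin m → ℤ) l =
    (Pi.single j n : Fin m → ℤ) l
  rcases eq_or_ne l j with rfl | h
  · simp [hjk]
  · simp [h]

variable {a b : Fin m → M}

/-- On generators: conjugation by $a_k$ turns $b_ka_k$ into $a_kb_k=(b_ka_k)^{-1}$ and fixes
$b_ja_j$ for $j\ne k$. -/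
theorem shiftsHom_signAction (ha : ∀ k, a k * a k = 1) (hb : ∀ k, b k * b k = 1)
    (haa : ∀ j k, j ≠ k → Commute (a j) (a k)) (hab : ∀ j k, j ≠ k → Commute (a j) (b k))
    (hc : ∀ j k, j ≠ k → Commute (b j * a j) (b k * a k)) (σ : Fin m → ℤˣ)
    (v : Multiplicative (Fin m → ℤ)) :
    shiftsHom (fun k => b k * a k) hc (signAction m σ v) =
      signsHom a ha haa σ * shiftsHom (fun k => b k * a k) hc v * (signsHom a ha haa σ)⁻¹ := by
  set f := shiftsHom (fun k => b k * a k) hc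
  set g := signsHom a ha haa
  -- The elements for which the identity holds form a submonoid, first in $\sigma$ and then, for a
  -- fixed generator $\sigma$, in $v$; so generators suffice.
  let P : Submonoid (Fin m → ℤˣ) :=
    { carrier := {σ | ∀ v, f (signAction m σ v) = g σ * f v * (g σ)⁻¹}
      one_mem' := fun v => by simp
      mul_mem' := fun {σ τ} h1 h2 v => by
        rw [map_mul, MulAut.mul_apply, h1, h2, map_mul]; group }
  refine mem_of_mulSingle_mem P (fun k v => ?_) σ v
  let Q : Submonoid (Multiplicative (Fin m → ℤ)) :=
    { carrier := {v | f (signAction m (Pi.mulSingle k (-1)) v) =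
        g (Pi.mulSingle k (-1)) * f v * (g (Pi.mulSingle k (-1)))⁻¹}
      one_mem' := by simp
      mul_mem' := fun {v w} (h1 : _ = _) (h2 : _ = _) => by
        change _ = _
        rw [map_mul, map_mul, h1, h2, map_mul]; group }
  refine mem_of_single_mem Q (fun j n => ?_) v
  change f _ = g _ * f _ * (g _)⁻¹
  have hg : g (Pi.mulSingle k (-1)) = a k := signsHom_mulSingle a ha haa k
  have hinv : (a k)⁻¹ = a k := inv_eq_of_mul_eq_one_left (ha k)
  have hinv' : (b k)⁻¹ = b k := inv_eq_of_mul_eq_one_left (hb k)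
  rcases eq_or_ne j k with rfl | hjk
  · rw [signAction_mulSingle_self, hg, shiftsHom_single, shiftsHom_single, ← conj_zpow, zpow_neg,
      ← inv_zpow]
    congr 1
    rw [mul_inv_rev, hinv, hinv', mul_assoc (a j), mul_assoc (b j), ha j, mul_one]
  · rw [signAction_mulSingle_of_ne hjk, hg, shiftsHom_single, ← conj_zpow]
    congr 1
    have : Commute (a k) (b j * a j) := (hab k j hjk.symm).mul_right (haa k j hjk.symm)
    rw [this.eq, mul_assoc, mul_inv_cancel, mul_one]

/-- The homomorphism from `ℤ^m ⋊ {1, -1}^m` given by involutions with the relations of the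
transformations `A_k` and `B_k`. -/
def shiftSignHom (ha : ∀ k, a k * a k = 1) (hb : ∀ k, b k * b k = 1)
    (haa : ∀ j k, j ≠ k → Commute (a j) (a k)) (hab : ∀ j k, j ≠ k → Commute (a j) (b k))
    (hc : ∀ j k, j ≠ k → Commute (b j * a j) (b k * a k)) : ShiftSignGroup m →* M :=
  SemidirectProduct.lift (shiftsHom (fun k => b k * a k) hc) (signsHom a ha haa) fun σ => by
    ext v
    exact shiftsHom_signAction ha hb haa hab hc σ v

theorem subgroup_eq_top (P : Subgroup (ShiftSignGroup m))
    (h1 : ∀ k, SemidirectProduct.inr (Pi.mulSingle k (-1)) ∈ P)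
    (h2 : ∀ k, SemidirectProduct.inl (Multiplicative.ofAdd (Pi.single k 1)) ∈ P) : P = ⊤ := by
  rw [eq_top_iff]
  intro g _
  rw [← SemidirectProduct.inl_left_mul_inr_right g]
  refine P.mul_mem ?_ ?_
  · refine mem_of_single_mem (P.comap SemidirectProduct.inl).toSubmonoid (fun k n => ?_) g.left
    have : Multiplicative.ofAdd (Pi.single k n : Fin m → ℤ) =
        Multiplicative.ofAdd (Pi.single k 1 : Fin m → ℤ) ^ n := by
      rw [← ofAdd_zsmul, ← Pi.single_smul, smul_eq_mul, mul_one]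
    rw [this, Subgroup.mem_toSubmonoid]
    exact Subgroup.zpow_mem (P.comap SemidirectProduct.inl) (h2 k) n
  · exact mem_of_mulSingle_mem (P.comap SemidirectProduct.inr).toSubmonoid h1 g.right

variable (ha : ∀ k, a k * a k = 1) (hb : ∀ k, b k * b k = 1)
    (haa : ∀ j k, j ≠ k → Commute (a j) (a k)) (hab : ∀ j k, j ≠ k → Commute (a j) (b k))
    (hc : ∀ j k, j ≠ k → Commute (b j * a j) (b k * a k))

theorem shiftSignHom_inr (k : Fin m) :
    shiftSignHom ha hb haa hab hc (SemidirectProduct.inr (Pi.mulSingle k (-1))) = a k := by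
  rw [shiftSignHom, SemidirectProduct.lift_inr, signsHom_mulSingle]

theorem shiftSignHom_inl (k : Fin m) :
    shiftSignHom ha hb haa hab hc
      (SemidirectProduct.inl (Multiplicative.ofAdd (Pi.single k 1))) = b k * a k := by
  rw [shiftSignHom, SemidirectProduct.lift_inl, shiftsHom_single, zpow_one]

theorem range_shiftSignHom :
    (shiftSignHom ha hb haa hab hc).range = Subgroup.closure (Set.range a ∪ Set.range b) := by
  have hak (k : Fin m) : a k ∈ Subgroup.closure (Set.range a ∪ Set.range b) :=
    Subgroup.subset_closure (Or.inl ⟨k, rfl⟩)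
  have hbk (k : Fin m) : b k ∈ Subgroup.closure (Set.range a ∪ Set.range b) :=
    Subgroup.subset_closure (Or.inr ⟨k, rfl⟩)
  have ra (k : Fin m) : a k ∈ (shiftSignHom ha hb haa hab hc).range :=
    ⟨_, shiftSignHom_inr ha hb haa hab hc k⟩
  apply le_antisymm
  · rw [MonoidHom.range_eq_map, Subgroup.map_le_iff_le_comap, top_le_iff]
    refine subgroup_eq_top _ (fun k => ?_) (fun k => ?_)
    · rw [Subgroup.mem_comap, shiftSignHom_inr]; exact hak k
    · rw [Subgroup.mem_comap, shiftSignHom_inl]; exact mul_mem (hbk k) (hak k)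
  · rw [Subgroup.closure_le]
    rintro _ (⟨k, rfl⟩ | ⟨k, rfl⟩)
    · exact ra k
    · have h1 : b k * a k ∈ (shiftSignHom ha hb haa hab hc).range :=
        ⟨_, shiftSignHom_inl ha hb haa hab hc k⟩
      have := mul_mem h1 (ra k)
      rwa [mul_assoc, ha, mul_one] at this

end Group

/-! ### The action on the regular solutions -/

section Action

variable {m r : ℕ} {α : Fin m → ℂ} {δ : ℂ} {t : Fin r → ℂ}

theorem applyWord_append (w w' : List (Fin m ⊕ Fin m)) (S : State m) :
    applyWord α δ t (w ++ w') S = applyWord α δ t w (applyWord α δ t w' S) :=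
  List.foldr_append ..

/-- The permutation of the regular solutions given by `A_k`. -/
def permA (k : Fin m) : Equiv.Perm (Regular α δ t) :=
  Function.Involutive.toPerm
    (fun S => ⟨A k S.1, isSolution_A S.2.1 k, fun w => by
      -- The last letter of a word acts first, so words applied to the image are longer words
      -- applied to $S$.
      have := S.2.2 (w ++ [.inl k])
      rwa [applyWord_append] at this⟩)
    fun S => Subtype.ext (A_A k S.1)

theorem Regular.nondegenerate (S : Regular α δ t) : Nondegenerate S.1 := S.2.2 []

theorem Regular.nondegenerate_B (S : Regular α δ t) (k : Fin m) :
    Nondegenerate (B α δ t k S.1) := S.2.2 [.inr k]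

/-- The permutation of the regular solutions given by `B_k`. -/
def permB (hinj : Function.Injective α) (k : Fin m) : Equiv.Perm (Regular α δ t) :=
  Function.Involutive.toPerm
    (fun S => ⟨B α δ t k S.1, isSolution_B hinj S.2.1 S.nondegenerate k, fun w => by
      have := S.2.2 (w ++ [.inr k])
      rwa [applyWord_append] at this⟩)
    fun S => Subtype.ext (B_B hinj S.2.1 S.nondegenerate (S.nondegenerate_B k))

theorem permA_val (k : Fin m) (S : Regular α δ t) : (permA k S).1 = A k S.1 := rfl

theorem permB_val (hinj : Function.Injective α) (k : Fin m) (S : Regular α δ t) :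
    (permB hinj k S).1 = B α δ t k S.1 := rfl

theorem permA_mul_self (k : Fin m) : (permA k : Equiv.Perm (Regular α δ t)) * permA k = 1 :=
  Equiv.ext fun S => Subtype.ext (A_A k S.1)

theorem permB_mul_self (hinj : Function.Injective α) (k : Fin m) :
    (permB hinj k : Equiv.Perm (Regular α δ t)) * permB hinj k = 1 :=
  Equiv.ext fun S => Subtype.ext (B_B hinj S.2.1 S.nondegenerate (S.nondegenerate_B k))

theorem permA_comm (j k : Fin m) (hjk : j ≠ k) :
    Commute (permA j : Equiv.Perm (Regular α δ t)) (permA k) :=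
  Equiv.ext fun S => Subtype.ext (A_comm hjk S.1)

theorem permA_permB_comm (hinj : Function.Injective α) (j k : Fin m) (hjk : j ≠ k) :
    Commute (permA j : Equiv.Perm (Regular α δ t)) (permB hinj k) :=
  Equiv.ext fun S => Subtype.ext (A_B hjk S.1)

theorem permB_comm (hα : ∀ j, α j ≠ 0) (hinj : Function.Injective α) (j k : Fin m) (hjk : j ≠ k) :
    Commute (permB hinj j : Equiv.Perm (Regular α δ t)) (permB hinj k) :=
  Equiv.ext fun S => Subtype.ext
    (B_comm hα hinj S.2.1 S.nondegenerate hjk (S.nondegenerate_B k) (S.nondegenerate_B j))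

theorem permB_mul_permA_comm (hα : ∀ j, α j ≠ 0) (hinj : Function.Injective α) (j k : Fin m)
    (hjk : j ≠ k) : Commute ((permB hinj j : Equiv.Perm (Regular α δ t)) * permA j)
      (permB hinj k * permA k) :=
  ((permB_comm hα hinj j k hjk).mul_left (permA_permB_comm hinj j k hjk)).mul_right
    ((permA_permB_comm hinj k j hjk.symm).symm.mul_left (permA_comm j k hjk))

/-- The action of `ℤ^m ⋊ {1, -1}^m` on the regular solutions. -/
def regularAction (hα : ∀ j, α j ≠ 0) (hinj : Function.Injective α) :
    ShiftSignGroup m →* Equiv.Perm (Regular α δ t) :=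
  shiftSignHom (a := permA) (b := permB hinj) permA_mul_self (permB_mul_self hinj) permA_comm
    (permA_permB_comm hinj) (permB_mul_permA_comm hα hinj)

/-- The transformations for which the formula holds form a subgroup. It contains the generators:
$A_k$ changes the sign of $\omega^k$, and $B_kA_k$ gives $1-(-\omega^k)=\omega^k+1$. -/
theorem regularAction_ω (hα : ∀ j, α j ≠ 0) (hinj : Function.Injective α) (g : ShiftSignGroup m)
    (S : Regular α δ t) (k : Fin m) :
    (regularAction hα hinj g S).1.ω k =
      ((g.right k : ℤ) : ℂ) * S.1.ω k + ((g.left.toAdd k : ℤ) : ℂ) := by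
  have sq (e : ℤˣ) : ((e : ℤ) : ℂ) * ((e : ℤ) : ℂ) = 1 := by
    rw [← Int.cast_mul, ← Units.val_mul, Int.units_mul_self]; simp
  let P : Subgroup (ShiftSignGroup m) :=
    { carrier := {g | ∀ (S : Regular α δ t) k, (regularAction hα hinj g S).1.ω k =
        ((g.right k : ℤ) : ℂ) * S.1.ω k + ((g.left.toAdd k : ℤ) : ℂ)}
      one_mem' := fun S k => by simp
      mul_mem' := fun {g g'} h1 h2 S k => by
        rw [map_mul, Equiv.Perm.mul_apply, h1, h2]
        have : (g * g').left.toAdd k = g.left.toAdd k + (g.right k : ℤ) * g'.left.toAdd k := rfl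
        rw [this, SemidirectProduct.mul_right, Pi.mul_apply]
        push_cast
        ring
      inv_mem' := fun {g} h1 S k => by
        have h2 := h1 (regularAction hα hinj g⁻¹ S) k
        rw [← Equiv.Perm.mul_apply, ← map_mul, mul_inv_cancel, map_one, Equiv.Perm.one_apply] at h2
        have h3 : (g⁻¹).left.toAdd k = ((g.right⁻¹ : Fin m → ℤˣ) k : ℤ) * -(g.left.toAdd k) := rfl
        have h4 := sq (g.right k)
        rw [h3, SemidirectProduct.inv_right, Pi.inv_apply, Int.units_inv_eq_self, h2]
        push_cast
        linear_combination (-(regularAction hα hinj g⁻¹ S).1.ω k) * h4 }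
  have htop : P = ⊤ := by
    refine subgroup_eq_top P (fun j S k => ?_) (fun j S k => ?_)
    · rw [regularAction, shiftSignHom_inr, permA_val]
      rcases eq_or_ne k j with rfl | h
      · simp [A]
      · simp [A, h]
    · rw [regularAction, shiftSignHom_inl, Equiv.Perm.mul_apply, permB_val, permA_val]
      rcases eq_or_ne k j with rfl | h
      · simp [A]; ring
      · simp [A, B_ω_of_ne h, h]
  have : g ∈ P := htop ▸ Subgroup.mem_top g
  exact this S k

/-- A trivially acting element with $\sigma_k=-1$ would force $2\omega^k=\nu_k$ on every regular
solution; with $\sigma_k=1$ the shift $\nu_k$ must vanish. -/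
theorem regularAction_injective (hα : ∀ j, α j ≠ 0) (hinj : Function.Injective α)
    (hgen : ∀ k : Fin m, ∃ S : Regular α δ t, ∀ n : ℤ, 2 * S.1.ω k ≠ n) :
    Function.Injective (regularAction hα hinj : ShiftSignGroup m →* Equiv.Perm (Regular α δ t)) := by
  rw [injective_iff_map_eq_one]
  intro g hg
  have key (k : Fin m) : g.right k = 1 ∧ g.left.toAdd k = 0 := by
    obtain ⟨S, hS⟩ := hgen k
    have h1 := regularAction_ω hα hinj g S k
    rw [hg, Equiv.Perm.one_apply] at h1
    rcases Int.units_eq_one_or (g.right k) with e | e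
    · refine ⟨e, ?_⟩
      rw [e] at h1
      simpa using h1
    · exfalso
      rw [e] at h1
      refine hS (g.left.toAdd k) ?_
      push_cast at h1
      linear_combination h1
  refine SemidirectProduct.ext ?_ ?_
  · exact Multiplicative.toAdd.injective (funext fun k => (key k).2)
  · exact funext fun k => (key k).1

theorem exists_group_iso (hα : ∀ j, α j ≠ 0) (hinj : Function.Injective α)
    (hgen : ∀ k : Fin m, ∃ S : Regular α δ t, ∀ n : ℤ, 2 * S.1.ω k ≠ n) :
    ∃ a b : Fin m → Equiv.Perm (Regular α δ t),
      (∀ k S, (a k S).1 = A k S.1) ∧ (∀ k S, (b k S).1 = B α δ t k S.1) ∧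
      ∃ Φ : Subgroup.closure (Set.range a ∪ Set.range b) ≃* ShiftSignGroup m,
        ∀ (g : Subgroup.closure (Set.range a ∪ Set.range b)) (S : Regular α δ t) (k : Fin m),
          (g.1 S).1.ω k =
            (((Φ g).right k : ℤ) : ℂ) * S.1.ω k + (((Φ g).left.toAdd k : ℤ) : ℂ) := by
  refine ⟨permA, permB hinj, permA_val, permB_val hinj, ?_⟩
  have hr : (regularAction hα hinj : ShiftSignGroup m →* Equiv.Perm (Regular α δ t)).range =
      Subgroup.closure (Set.range permA ∪ Set.range (permB hinj)) :=
    range_shiftSignHom permA_mul_self (permB_mul_self hinj) permA_comm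
    (permA_permB_comm hinj) (permB_mul_permA_comm hα hinj)
  rw [← hr]
  let Ψ := MonoidHom.ofInjective (regularAction_injective hα hinj hgen)
  refine ⟨Ψ.symm, fun g S k => ?_⟩
  rw [← regularAction_ω hα hinj]
  have : (Ψ (Ψ.symm g)).1 = g.1 := by rw [MulEquiv.apply_symm_apply]
  rw [← this]
  rfl

end Action

end Volterra

/-! ### Locality of the $h^{(i)}_n$ -/

namespace Volterra

section Locality

theorem hVal_succ (i : ℕ) (n : ℤ) (u : ℤ → ℂ) :
    hVal (i + 1) n u = u n * ∑ s ∈ Finset.range (i + 1),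
        (hVal s (n + 1) u + hVal s n u) * (hVal (i - s) n u + hVal (i - s) (n - 1) u)
      - ∑ s ∈ Finset.range i, hVal (s + 1) n u * hVal (i - s) n u := by
  rw [hVal, h, ← Fin.sum_univ_eq_sum_range (fun s => (hVal s (n + 1) u + hVal s n u) *
    (hVal (i - s) n u + hVal (i - s) (n - 1) u)),
    ← Fin.sum_univ_eq_sum_range (fun s => hVal (s + 1) n u * hVal (i - s) n u)]
  simp [hVal]

theorem hVal_congr {u v : ℤ → ℂ} (i : ℕ) (n : ℤ) (huv : ∀ s, n - i < s → s < n + i → u s = v s) :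
    hVal i n u = hVal i n v := by
  induction i using Nat.strong_induction_on generalizing n with
  | _ i ih =>
    cases i with
    | zero => rw [hVal_zero, hVal_zero]
    | succ i =>
      rw [hVal_succ, hVal_succ, huv n (by omega) (by omega)]
      congr 1
      · congr 1
        refine Finset.sum_congr rfl fun s hs => ?_
        rw [Finset.mem_range] at hs
        rw [ih s (by omega) (n + 1) fun x h1 h2 => huv x (by omega) (by omega),
          ih s (by omega) n fun x h1 h2 => huv x (by omega) (by omega),
          ih (i - s) (by omega) n fun x h1 h2 => huv x (by omega) (by omega),
          ih (i - s) (by omega) (n - 1) fun x h1 h2 => huv x (by omega) (by omega)]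
      · refine Finset.sum_congr rfl fun s hs => ?_
        rw [Finset.mem_range] at hs
        rw [ih (s + 1) (by omega) n fun x h1 h2 => huv x (by omega) (by omega),
          ih (i - s) (by omega) n fun x h1 h2 => huv x (by omega) (by omega)]

theorem hVal_mem (F : Subfield ℂ) {u : ℤ → ℂ} (i : ℕ) (n : ℤ)
    (hu : ∀ s, n - i < s → s < n + i → u s ∈ F) : hVal i n u ∈ F := by
  induction i using Nat.strong_induction_on generalizing n with
  | _ i ih =>
    cases i with
    | zero => rw [hVal_zero]; exact div_mem (one_mem F) (ofNat_mem F 2)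
    | succ i =>
      rw [hVal_succ]
      refine sub_mem (mul_mem (hu n (by omega) (by omega)) (sum_mem fun s hs => ?_))
        (sum_mem fun s hs => ?_) <;> rw [Finset.mem_range] at hs
      · exact mul_mem
          (add_mem (ih s (by omega) (n + 1) fun x h1 h2 => hu x (by omega) (by omega))
            (ih s (by omega) n fun x h1 h2 => hu x (by omega) (by omega)))
          (add_mem (ih (i - s) (by omega) n fun x h1 h2 => hu x (by omega) (by omega))
            (ih (i - s) (by omega) (n - 1) fun x h1 h2 => hu x (by omega) (by omega)))
      · exact mul_mem (ih (s + 1) (by omega) n fun x h1 h2 => hu x (by omega) (by omega))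
          (ih (i - s) (by omega) n fun x h1 h2 => hu x (by omega) (by omega))

/-- The polynomial `h^{(i+1)}_n` depends linearly on the variable `u_{n+i}`. -/
theorem hVal_top (i : ℕ) (n : ℤ) (u : ℤ → ℂ) :
    hVal (i + 1) n u = (∏ s ∈ Finset.range i, u (n + s)) * u (n + i) +
      hVal (i + 1) n (Function.update u (n + i) 0) := by
  induction i generalizing n with
  | zero =>
    have (v : ℤ → ℂ) : hVal 1 n v = v n := by
      rw [hVal_succ 0]; simp [hVal_zero]; ring
    rw [zero_add, this, this]; simp
  | succ i ih =>
    set v := Function.update u (n + (i + 1 : ℕ)) 0 with hv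
    have huv (s : ℤ) (hs : s ≠ n + (i + 1 : ℕ)) : v s = u s := Function.update_of_ne hs _ _
    rw [hVal_succ (i + 1) n u, hVal_succ (i + 1) n v, Finset.sum_range_succ,
      Finset.sum_range_succ _ (i + 1), huv n (by omega)]
    -- Only the summand with $s=i+1$, through $h^{(i+1)}_{n+1}$, reaches $u_{n+i+1}$; all others are
    -- unaffected when this variable is set to 0.
    have e1 : ∑ s ∈ Finset.range (i + 1), (hVal s (n + 1) v + hVal s n v) *
        (hVal (i + 1 - s) n v + hVal (i + 1 - s) (n - 1) v) =
        ∑ s ∈ Finset.range (i + 1), (hVal s (n + 1) u + hVal s n u) *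
        (hVal (i + 1 - s) n u + hVal (i + 1 - s) (n - 1) u) := by
      refine Finset.sum_congr rfl fun s hs => ?_
      rw [Finset.mem_range] at hs
      rw [hVal_congr s (n + 1) (fun x h1 h2 => huv x (by omega)),
        hVal_congr s n (fun x h1 h2 => huv x (by omega)),
        hVal_congr (i + 1 - s) n (fun x h1 h2 => huv x (by omega)),
        hVal_congr (i + 1 - s) (n - 1) (fun x h1 h2 => huv x (by omega))]
    have e2 : ∑ s ∈ Finset.range (i + 1), hVal (s + 1) n v * hVal (i + 1 - s) n v =
        ∑ s ∈ Finset.range (i + 1), hVal (s + 1) n u * hVal (i + 1 - s) n u := by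
      refine Finset.sum_congr rfl fun s hs => ?_
      rw [Finset.mem_range] at hs
      rw [hVal_congr (s + 1) n (fun x h1 h2 => huv x (by omega)),
        hVal_congr (i + 1 - s) n (fun x h1 h2 => huv x (by omega))]
    have e3 : hVal (i + 1) n v = hVal (i + 1) n u :=
      hVal_congr _ _ fun x h1 h2 => huv x (by omega)
    have e4 := ih (n + 1)
    have e5 : n + 1 + (i : ℤ) = n + (i + 1 : ℕ) := by push_cast; ring
    have e6 : ∏ s ∈ Finset.range i, u (n + 1 + s) =
        ∏ s ∈ Finset.range i, u (n + (s + 1 : ℕ)) :=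
      Finset.prod_congr rfl fun s _ => by congr 1; push_cast; ring
    rw [e5, ← hv, e6] at e4
    rw [e1, e2, e3, e4, Nat.sub_self, Finset.prod_range_succ']
    simp only [hVal_zero, Nat.cast_zero, add_zero]
    ring

/-- The quadratic equation is invariant under $n\mapsto-n$, and its solution is unique. -/
theorem hVal_reflect (i : ℕ) (n : ℤ) (u : ℤ → ℂ) :
    hVal i n (fun s => u (-s)) = hVal i (-n) u := by
  have := eq_hSeries_of_quadratic (u := fun s => u (-s)) (G := fun n => hSeries u (-n))
    (fun n => constantCoeff_hSeries u _) (fun n => by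
      have := hSeries_quadratic u (-n)
      rw [show -(n + 1) = -n - 1 by ring, show -(n - 1) = -n + 1 by ring]
      linear_combination this) n
  rw [← coeff_hSeries, ← this, coeff_hSeries]

end Locality

/-! ### Solutions are determined by the data at one point -/

section Windows

variable {m r : ℕ} {α : Fin m → ℂ} {δ : ℂ} {t : Fin r → ℂ}

/-- `t_q` is the last nonvanishing time. -/
structure IsLast (t : Fin r → ℂ) (q : Fin r) : Prop where
  ne_zero : t q ≠ 0
  eq_zero : ∀ i, q < i → t i = 0

theorem exists_isLast (ht : t ≠ 0) : ∃ q, IsLast t q := by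
  classical
  have hne : (Finset.univ.filter fun i => t i ≠ 0).Nonempty := by
    obtain ⟨i, hi⟩ := Function.ne_iff.1 ht
    exact ⟨i, by simpa using hi⟩
  refine ⟨(Finset.univ.filter fun i => t i ≠ 0).max' hne, ?_, fun i hi => ?_⟩
  · exact (Finset.mem_filter.1 (Finset.max'_mem _ hne)).2
  · by_contra h0
    exact absurd (Finset.le_max' _ i (by simpa using h0)) (not_le.2 hi)

theorem timeSum_congr {q : Fin r} (hq : IsLast t q) {u v : ℤ → ℂ} (n : ℤ)
    (huv : ∀ s, n - q ≤ s → s ≤ n + q → u s = v s) : timeSum t u n = timeSum t v n := by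
  rw [timeSum_eq, timeSum_eq]
  refine Finset.sum_congr rfl fun i _ => ?_
  rcases lt_or_ge q i with hi | hi
  · rw [hq.eq_zero i hi]; ring
  · have : (i : ℕ) ≤ q := hi
    rw [hVal_congr _ _ fun x h1 h2 => huv x (by push_cast at h1; omega) (by push_cast at h2; omega)]

theorem timeSum_mem {q : Fin r} (hq : IsLast t q) (F : Subfield ℂ) (ht : ∀ i, t i ∈ F)
    {u : ℤ → ℂ} (n : ℤ) (hu : ∀ s, n - q ≤ s → s ≤ n + q → u s ∈ F) : timeSum t u n ∈ F := by
  rw [timeSum_eq]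
  refine sum_mem fun i _ => ?_
  rcases lt_or_ge q i with hi | hi
  · rw [hq.eq_zero i hi, mul_zero, zero_mul]; exact zero_mem F
  · have : (i : ℕ) ≤ q := hi
    exact mul_mem (mul_mem (mul_mem (ofNat_mem F 2) (add_mem (natCast_mem F _) (one_mem F))) (ht i))
      (hVal_mem F _ _ fun x h1 h2 => hu x (by push_cast at h1; omega) (by push_cast at h2; omega))

/-- With the last nonzero time at index `q`, the variable $u_{n+q}$ enters linearly and only through
$h^{(q+1)}_n$. Thus the sum equation can be solved for it when $u_n,\dots,u_{n+q-1}$ do not vanish.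
-/
theorem timeSum_top {q : Fin r} (hq : IsLast t q) (u : ℤ → ℂ) (n : ℤ) :
    timeSum t u n = 2 * ((q : ℂ) + 1) * t q * (∏ s ∈ Finset.range q, u (n + s)) * u (n + q) +
      timeSum t (Function.update u (n + q) 0) n := by
  rw [timeSum_eq, timeSum_eq, ← Finset.add_sum_erase _ _ (Finset.mem_univ q),
    ← Finset.add_sum_erase (Finset.univ) _ (Finset.mem_univ q), hVal_top]
  have : ∑ i ∈ Finset.univ.erase q, 2 * ((i : ℂ) + 1) * t i *
      hVal (i + 1) n (Function.update u (n + q) 0) =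
      ∑ i ∈ Finset.univ.erase q, 2 * ((i : ℂ) + 1) * t i * hVal (i + 1) n u := by
    refine Finset.sum_congr rfl fun i hi => ?_
    rcases lt_or_ge q i with h | h
    · rw [hq.eq_zero i h]; ring
    · have h' : i < q := lt_of_le_of_ne h (Finset.ne_of_mem_erase hi)
      have : (i : ℕ) < q := h'
      rw [hVal_congr _ _ fun x h1 h2 => Function.update_of_ne (by push_cast at h2; omega) _ _]
  rw [this]
  ring

theorem coeff_top_ne_zero {q : Fin r} (hq : IsLast t q) : 2 * ((q : ℂ) + 1) * t q ≠ 0 :=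
  mul_ne_zero (mul_ne_zero two_ne_zero (Nat.cast_add_one_ne_zero _)) hq.ne_zero

/-- The reversal of the lattice. -/
def reflect (S : State m) : State m where
  ω := S.ω
  ε := -S.ε
  u n := S.u (-n)
  y j n := -S.y j (-n)

theorem reflect_reflect (S : State m) : reflect (reflect S) = S := by
  ext <;> simp [reflect]

/-- The equation at the point `n` for the sum of the sequences `y^j`. -/
def SumEq (δ : ℂ) (t : Fin r → ℂ) (S : State m) (n : ℤ) : Prop :=
  timeSum t S.u n + n - δ + sgn n * S.ε = ∑ j, S.y j n

/-- The equation at the point `n` for the sequence `y^j`. -/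
def LocalEq (α : Fin m → ℂ) (S : State m) (j : Fin m) (n : ℤ) : Prop :=
  S.u n * (S.y j (n + 1) + S.y j n) * (S.y j n + S.y j (n - 1)) = α j * (S.y j n ^ 2 - S.ω j ^ 2)

theorem sgn_neg (n : ℤ) : sgn (-n) = sgn n := by
  rw [sgn, sgn, zpow_neg, ← inv_zpow]; norm_num

/-- The reflection multiplies the equation by $-1$. It reduces the backward recursion to the forward
one. -/
theorem SumEq.reflect {S : State m} {n : ℤ} (h : SumEq δ t S n) :
    SumEq (-δ) (-t) (reflect S) (-n) := by
  have e : timeSum (-t) (Volterra.reflect S).u (-n) = -timeSum t S.u n := by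
    rw [timeSum_eq, timeSum_eq, ← Finset.sum_neg_distrib]
    refine Finset.sum_congr rfl fun i _ => ?_
    have : hVal (i + 1) (-n) (Volterra.reflect S).u = hVal (i + 1) n S.u := by
      have := hVal_reflect (i + 1) (-n) S.u
      rwa [neg_neg] at this
    rw [this, Pi.neg_apply]; ring
  have h' : timeSum t S.u n + n - δ + sgn n * S.ε = ∑ j, S.y j n := h
  change timeSum (-t) (Volterra.reflect S).u (-n) + _ - _ + _ * (-S.ε) = ∑ j, -S.y j (- -n)
  rw [e, Finset.sum_neg_distrib, neg_neg, ← h', sgn_neg]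
  push_cast
  ring

theorem LocalEq.reflect {S : State m} {j : Fin m} {n : ℤ} (h : LocalEq α S j n) :
    LocalEq α (reflect S) j (-n) := by
  have h' : S.u n * (S.y j (n + 1) + S.y j n) * (S.y j n + S.y j (n - 1)) = _ := h
  simp only [LocalEq, Volterra.reflect, neg_neg, show -(-n + 1) = n - 1 by ring,
    show -(-n - 1) = n + 1 by ring]
  linear_combination h'

theorem IsLast.neg {q : Fin r} (hq : IsLast t q) : IsLast (-t) q :=
  ⟨neg_ne_zero.2 hq.ne_zero, fun i hi => neg_eq_zero.2 (hq.eq_zero i hi)⟩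

/-- The values of a state near the point `n`, which determine a solution, lie in `F`. -/
structure WindowIn (F : Subfield ℂ) (q : ℕ) (S : State m) (n : ℤ) : Prop where
  u : ∀ s, n - q ≤ s → s < n + q → S.u s ∈ F
  y : ∀ j, S.y j n ∈ F
  y' : ∀ j, S.y j (n - 1) ∈ F
  ω : ∀ j, S.ω j ∈ F
  ε : S.ε ∈ F

/-- The window is symmetric about $n-\frac12$: the reflection exchanges $y_n$ and $y_{n-1}$ up to
sign and sends the point to $1-n$. -/
theorem WindowIn.reflect {F : Subfield ℂ} {q : ℕ} {S : State m} {n : ℤ} (h : WindowIn F q S n) :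
    WindowIn F q (reflect S) (1 - n) where
  u s h1 h2 := h.u (-s) (by omega) (by omega)
  y j := neg_mem (by
    have := h.y' j
    rwa [show n - 1 = -(1 - n) by ring] at this)
  y' j := neg_mem (by
    have := h.y j
    rwa [show n = -(1 - n - 1) by ring] at this)
  ω := h.ω
  ε := neg_mem h.ε

/-- The constants of the system lie in `F`. -/
structure ConstantsIn (F : Subfield ℂ) (α : Fin m → ℂ) (δ : ℂ) (t : Fin r → ℂ) : Prop where
  α : ∀ j, α j ∈ F
  δ : δ ∈ F
  t : ∀ i, t i ∈ F

theorem ConstantsIn.neg {F : Subfield ℂ} (h : ConstantsIn F α δ t) :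
    ConstantsIn F α (-δ) (-t) := ⟨h.α, neg_mem h.δ, fun i => neg_mem (h.t i)⟩

theorem sgn_mem (F : Subfield ℂ) (n : ℤ) : sgn n ∈ F := zpow_mem (neg_mem (one_mem F)) n

/-- The sum equation yields $u_{n+q}$, and then the local equations yield $y^j_{n+1}$, as rational
expressions in the window and the constants. For `q = 0` the new value is $u_n$ itself, which is why
its nonvanishing is a separate hypothesis. -/
theorem WindowIn.step {F : Subfield ℂ} (hF : ConstantsIn F α δ t) {q : Fin r} (hq : IsLast t q)
    {S : State m} {n : ℤ} (h : WindowIn F q S n) (hs : SumEq δ t S n)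
    (hl : ∀ j, LocalEq α S j n) (hu : ∀ s, n ≤ s → s < n + q → S.u s ≠ 0) (hun : S.u n ≠ 0)
    (hy : ∀ j, S.y j n + S.y j (n - 1) ≠ 0) : WindowIn F q S (n + 1) := by
  have hu' : ∀ s, n - q ≤ s → s ≤ n + q → S.u s ∈ F := by
    intro s h1 h2
    rcases lt_or_eq_of_le h2 with h3 | rfl
    · exact h.u s h1 h3
    · have e := timeSum_top hq S.u n
      have hs' : timeSum t S.u n + n - δ + sgn n * S.ε = ∑ j, S.y j n := hs
      have hP : 2 * ((q : ℂ) + 1) * t q * (∏ s ∈ Finset.range q, S.u (n + s)) ≠ 0 :=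
        mul_ne_zero (coeff_top_ne_zero hq) (Finset.prod_ne_zero_iff.2 fun s hs => by
          rw [Finset.mem_range] at hs
          exact hu _ (by omega) (by omega))
      have e2 : S.u (n + q) = (∑ j, S.y j n - n + δ - sgn n * S.ε -
          timeSum t (Function.update S.u (n + q) 0) n) /
          (2 * ((q : ℂ) + 1) * t q * (∏ s ∈ Finset.range q, S.u (n + s))) := by
        rw [eq_div_iff hP]
        linear_combination hs' - e
      rw [e2]
      refine div_mem (sub_mem (sub_mem (add_mem (sub_mem (sum_mem fun j _ => h.y j)
        (intCast_mem F n)) hF.δ) (mul_mem (sgn_mem F n) h.ε)) (timeSum_mem hq F hF.t n ?_))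
        (mul_mem (mul_mem (mul_mem (ofNat_mem F 2) (add_mem (natCast_mem F _) (one_mem F)))
          (hF.t q)) (prod_mem fun s hs => ?_))
      · intro s h1 h2
        rcases eq_or_ne s (n + q) with rfl | h3
        · rw [Function.update_self]; exact zero_mem F
        · rw [Function.update_of_ne h3]; exact h.u s h1 (by omega)
      · rw [Finset.mem_range] at hs
        exact h.u _ (by omega) (by omega)
  refine ⟨fun s h1 h2 => hu' s (by omega) (by omega), fun j => ?_, fun j => ?_, h.ω, h.ε⟩
  · have hl' : S.u n * (S.y j (n + 1) + S.y j n) * (S.y j n + S.y j (n - 1)) = _ := hl j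
    have e : S.y j (n + 1) = α j * (S.y j n ^ 2 - S.ω j ^ 2) /
        (S.u n * (S.y j n + S.y j (n - 1))) - S.y j n := by
      rw [eq_sub_iff_add_eq, eq_div_iff (mul_ne_zero hun (hy j))]
      linear_combination hl'
    rw [e]
    exact sub_mem (div_mem (mul_mem (hF.α j) (sub_mem (pow_mem (h.y j) 2) (pow_mem (h.ω j) 2)))
      (mul_mem (hu' n (by omega) (by omega)) (add_mem (h.y j) (h.y' j)))) (h.y j)
  · rw [add_sub_cancel_right]; exact h.y j

theorem WindowIn.step_back {F : Subfield ℂ} (hF : ConstantsIn F α δ t) {q : Fin r}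
    (hq : IsLast t q) {S : State m} {n : ℤ} (h : WindowIn F q S (n + 1)) (hs : SumEq δ t S n)
    (hl : ∀ j, LocalEq α S j n) (hu : ∀ s, n - q < s → s ≤ n → S.u s ≠ 0) (hun : S.u n ≠ 0)
    (hy : ∀ j, S.y j (n + 1) + S.y j n ≠ 0) : WindowIn F q S n := by
  have h1 := h.reflect
  rw [show 1 - (n + 1) = -n by ring] at h1
  have h2 := h1.step hF.neg hq.neg hs.reflect (fun j => (hl j).reflect)
    (fun s h3 h4 => hu (-s) (by omega) (by omega)) (by simpa [Volterra.reflect] using hun)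
    (fun j e => hy j (by
      simp only [Volterra.reflect, neg_neg, show -(-n - 1) = n + 1 by ring] at e
      linear_combination -e))
  have h3 := h2.reflect
  rwa [reflect_reflect, show 1 - (-n + 1) = n by ring] at h3

theorem u_ne_zero {S : State m} {j : Fin m} {n : ℤ} (hα : α j ≠ 0) (hl : LocalEq α S j n)
    (h : S.y j n ^ 2 - S.ω j ^ 2 ≠ 0) :
    S.u n ≠ 0 ∧ S.y j (n + 1) + S.y j n ≠ 0 ∧ S.y j n + S.y j (n - 1) ≠ 0 := by
  have h1 : S.u n * (S.y j (n + 1) + S.y j n) * (S.y j n + S.y j (n - 1)) ≠ 0 := by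
    have hl' : S.u n * (S.y j (n + 1) + S.y j n) * (S.y j n + S.y j (n - 1)) = _ := hl
    rw [hl']; exact mul_ne_zero hα h
  exact ⟨left_ne_zero_of_mul (left_ne_zero_of_mul h1),
    right_ne_zero_of_mul (left_ne_zero_of_mul h1), right_ne_zero_of_mul h1⟩

theorem nondegenerate_of_ne (hα : ∀ j, α j ≠ 0) {S : State m} (hS : IsSolution α δ t S)
    (h : ∀ j n, S.y j n ^ 2 - S.ω j ^ 2 ≠ 0) : Nondegenerate S := fun j n =>
  ⟨(u_ne_zero (hα j) (hS.local_eq j n) (h j n)).2.2, h j n⟩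

/-- The values of a nondegenerate solution near one point determine the solution. -/
theorem WindowIn.all [Nonempty (Fin m)] {F : Subfield ℂ} (hF : ConstantsIn F α δ t)
    (hα : ∀ j, α j ≠ 0) {q : Fin r} (hq : IsLast t q) {S : State m} (hS : IsSolution α δ t S)
    (hn : Nondegenerate S) {n : ℤ} (h : WindowIn F q S n) (n' : ℤ) : WindowIn F q S n' := by
  have hu (s : ℤ) : S.u s ≠ 0 :=
    let j := Classical.arbitrary (Fin m)
    (u_ne_zero (hα j) (hS.local_eq j s) (hn j s).2).1
  have f (n : ℤ) (h : WindowIn F q S n) : WindowIn F q S (n + 1) :=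
    h.step hF hq (hS.sum_eq n) (fun j => hS.local_eq j n) (fun s _ _ => hu s) (hu n)
      fun j => (hn j n).1
  have g (n : ℤ) (h : WindowIn F q S (n + 1)) : WindowIn F q S n :=
    h.step_back hF hq (hS.sum_eq n) (fun j => hS.local_eq j n) (fun s _ _ => hu s) (hu n)
      fun j => hn.add_ne' j n
  refine Int.inductionOn' n' n h (fun k _ hk => f k hk) fun k _ hk => g (k - 1) ?_
  rwa [sub_add_cancel]

end Windows

end Volterra

/-! ### Algebraic independence -/

namespace Volterra

section Transcendence

variable {K E : Type*} [Field K] [Field E] [Algebra K E] {ι : Type*}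

/-- Finitely many generators of a field that contains as many algebraically independent
elements are algebraically independent. -/
theorem algebraicIndependent_of_mem_adjoin [Finite ι] {x y : ι → E}
    (hx : AlgebraicIndependent K x)
    (h : ∀ i, x i ∈ IntermediateField.adjoin K (Set.range y)) : AlgebraicIndependent K y := by
  let L := IntermediateField.adjoin K (Set.range y)
  let y' : ι → L := fun i => ⟨y i, IntermediateField.subset_adjoin K _ ⟨i, rfl⟩⟩
  let x' : ι → L := fun i => ⟨x i, h i⟩
  have hx' : AlgebraicIndependent K x' := AlgebraicIndependent.of_comp L.val hx
  have htop : IntermediateField.adjoin K (Set.range y') = ⊤ := by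
    apply IntermediateField.map_injective L.val
    rw [IntermediateField.adjoin_map, ← Set.range_comp, ← AlgHom.fieldRange_eq_map,
      IntermediateField.fieldRange_val]
    rfl
  have halg : Algebra.IsAlgebraic (Algebra.adjoin K (Set.range y')) L := by
    rw [← IntermediateField.isAlgebraic_adjoin_iff_top, htop]
    exact ⟨fun a => isAlgebraic_algebraMap (⟨a, trivial⟩ : (⊤ : IntermediateField K L))⟩
  -- The field generated by $y$ has transcendence degree at least $|\iota|$ because of $x$; a family
  -- of $|\iota|$ generators must then be a transcendence basis.
  have hy' := (Algebra.IsAlgebraic.isTranscendenceBasis_of_lift_le_trdeg_of_finite K y'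
    hx'.lift_cardinalMk_le_trdeg).1
  exact hy'.map' (f := L.val) L.val.injective

theorem notMem_adjoin_of_notMem {x : ι → E} (hx : AlgebraicIndependent K x) {s : Set ι} {i : ι}
    (hi : i ∉ s) : x i ∉ IntermediateField.adjoin K (x '' s) := fun h =>
  IntermediateField.transcendental_adjoin_iff.2 (hx.transcendental_adjoin hi)
    (isAlgebraic_algebraMap (⟨x i, h⟩ : IntermediateField.adjoin K (x '' s)))

/-- Over a countable field, a transcendence basis of $\mathbb C$ has the cardinality of the
continuum. -/
theorem exists_algebraicIndependent (K : Subfield ℂ) [Countable K] (ι : Type*) [Finite ι] :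
    ∃ x : ι → ℂ, AlgebraicIndependent K x := by
  obtain ⟨s, hs⟩ := exists_isTranscendenceBasis K ℂ
  have h1 := IsAlgClosed.cardinal_eq_cardinal_transcendence_basis_of_aleph0_lt _ hs
    (Cardinal.mk_le_aleph0_iff.2 inferInstance)
    (by rw [Cardinal.mk_complex]; exact Cardinal.aleph0_lt_continuum)
  have : Infinite s := by
    rw [Cardinal.infinite_iff, ← Cardinal.lift_id (Cardinal.mk s), ← h1, Cardinal.lift_id,
      Cardinal.mk_complex]
    exact Cardinal.aleph0_le_continuum
  obtain ⟨n, ⟨e⟩⟩ := Finite.exists_equiv_fin ι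
  exact ⟨_, hs.1.comp (fun i => Infinite.natEmbedding s (e i)) fun i j hij =>
    e.injective (Fin.ext ((Infinite.natEmbedding s).injective hij))⟩

theorem countable_closure (s : Set ℂ) (hs : s.Countable) : Countable (Subfield.closure s) := by
  have := hs.to_subtype
  have := Subfield.cardinalMk_closure_le_max s
  rw [← Cardinal.mk_le_aleph0_iff]
  exact this.trans (max_le (Cardinal.mk_le_aleph0_iff.2 hs.to_subtype) le_rfl)

end Transcendence

end Volterra

/-! ### Solutions with algebraically independent data -/

namespace Volterra

section Generic

/-- The positions in the data at one point that determine a solution. -/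
inductive Slot (q m : ℕ)
  | u (s : Finset.Ico (-(q : ℤ)) q)
  | y (j : Fin m)
  | y' (j : Fin m)
  | ω (j : Fin m)
  | ε

instance (q m : ℕ) : Finite (Slot q m) := by
  let f : (Finset.Ico (-(q : ℤ)) q) ⊕ (Fin m ⊕ (Fin m ⊕ (Fin m ⊕ Unit))) → Slot q m :=
    Sum.elim Slot.u (Sum.elim Slot.y (Sum.elim Slot.y' (Sum.elim Slot.ω fun _ => Slot.ε)))
  refine Finite.of_surjective f fun i => ?_
  cases i with
  | u s => exact ⟨.inl s, rfl⟩
  | y j => exact ⟨.inr (.inl j), rfl⟩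
  | y' j => exact ⟨.inr (.inr (.inl j)), rfl⟩
  | ω j => exact ⟨.inr (.inr (.inr (.inl j))), rfl⟩
  | ε => exact ⟨.inr (.inr (.inr (.inr ()))), rfl⟩

variable {m r : ℕ} {α : Fin m → ℂ} {δ : ℂ} {t : Fin r → ℂ}

/-- The data of a state at the point `n`. -/
def window (q : ℕ) (S : State m) (n : ℤ) : Slot q m → ℂ
  | .u s => S.u (n + s)
  | .y j => S.y j n
  | .y' j => S.y j (n - 1)
  | .ω j => S.ω j
  | .ε => S.ε

theorem windowIn_iff {F : Subfield ℂ} {q : ℕ} {S : State m} {n : ℤ} :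
    WindowIn F q S n ↔ ∀ i, window q S n i ∈ F := by
  constructor
  · rintro ⟨h1, h2, h3, h4, h5⟩ (⟨s, hs⟩ | j | j | j | _)
    · rw [Finset.mem_Ico] at hs
      exact h1 _ (by simp only; omega) (by simp only; omega)
    exacts [h2 j, h3 j, h4 j, h5]
  · refine fun h => ⟨fun s h1 h2 => ?_, fun j => h (.y j), fun j => h (.y' j), fun j => h (.ω j),
      h .ε⟩
    have := h (.u ⟨s - n, Finset.mem_Ico.2 ⟨by omega, by omega⟩⟩)
    rwa [window, add_sub_cancel] at this

/-- The subfield of `ℂ` generated by `K` and `X`. -/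
def extend (K : Subfield ℂ) (X : Set ℂ) : Subfield ℂ := (IntermediateField.adjoin K X).toSubfield

theorem mem_extend {K : Subfield ℂ} {X : Set ℂ} {x : ℂ} (hx : x ∈ X) : x ∈ extend K X :=
  IntermediateField.subset_adjoin K X hx

theorem le_extend (K : Subfield ℂ) (X : Set ℂ) : K ≤ extend K X := fun x hx =>
  (IntermediateField.adjoin K X).algebraMap_mem ⟨x, hx⟩

theorem ConstantsIn.extend {K : Subfield ℂ} (h : ConstantsIn K α δ t) (X : Set ℂ) :
    ConstantsIn (extend K X) α δ t :=
  ⟨fun j => le_extend K X (h.α j), le_extend K X h.δ, fun i => le_extend K X (h.t i)⟩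

/-- The data at the point `n` are algebraically independent over `K`. -/
def IsGeneric (K : Subfield ℂ) (q : ℕ) (S : State m) (n : ℤ) : Prop :=
  AlgebraicIndependent K (window q S n)

variable {K : Subfield ℂ}

theorem IsGeneric.algebraicIndependent {q : ℕ} {S : State m} {n : ℤ} (h : IsGeneric K q S n)
    {v : Slot q m → ℂ} (hv : WindowIn (Volterra.extend K (Set.range v)) q S n) :
    AlgebraicIndependent K v :=
  algebraicIndependent_of_mem_adjoin h (windowIn_iff.1 hv)

theorem windowIn_self (q : ℕ) (S : State m) (n : ℤ) :
    WindowIn (extend K (Set.range (window q S n))) q S n :=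
  windowIn_iff.2 fun i => mem_extend ⟨i, rfl⟩

theorem notMem_extend {ι : Type*} {v : ι → ℂ} (h : AlgebraicIndependent K v) (i : ι) :
    v i ∉ extend K (v '' {i}ᶜ) :=
  notMem_adjoin_of_notMem h (by simp)

theorem IsGeneric.notMem {q : ℕ} {S : State m} {n : ℤ} (h : IsGeneric K q S n) (i : Slot q m) :
    window q S n i ∉ extend K (window q S n '' {i}ᶜ) :=
  notMem_extend h i

theorem mem_extend_image {q : ℕ} (v : Slot q m → ℂ) {i i' : Slot q m} (hi : i' ≠ i) :
    v i' ∈ extend K (v '' {i}ᶜ) :=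
  mem_extend ⟨i', hi, rfl⟩

theorem IsGeneric.u_ne {q : ℕ} {S : State m} {n : ℤ} (h : IsGeneric K q S n) {s : ℤ}
    (h1 : n - q ≤ s) (h2 : s < n + q) : S.u s ≠ 0 := by
  have := AlgebraicIndependent.ne_zero h
    (.u ⟨s - n, Finset.mem_Ico.2 ⟨by omega, by omega⟩⟩ : Slot q m)
  rwa [window, add_sub_cancel] at this

theorem IsGeneric.y_ne {q : ℕ} {S : State m} {n : ℤ} (h : IsGeneric K q S n) (j : Fin m) :
    S.y j n ∉ extend K (window q S n '' {.y j}ᶜ) := h.notMem (.y j)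

theorem IsGeneric.add_ne {q : ℕ} {S : State m} {n : ℤ} (h : IsGeneric K q S n) (j : Fin m) :
    S.y j n + S.y j (n - 1) ≠ 0 := fun e =>
  h.y_ne j (by
    rw [eq_neg_of_add_eq_zero_left e]
    exact neg_mem (mem_extend_image (window q S n) (i' := .y' j) (by simp)))

theorem IsGeneric.sq_sub_ne {q : ℕ} {S : State m} {n : ℤ} (h : IsGeneric K q S n) (j : Fin m) :
    S.y j n ^ 2 - S.ω j ^ 2 ≠ 0 := fun e => by
  have hω : S.ω j ∈ extend K (window q S n '' {.y j}ᶜ) :=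
    mem_extend_image (window q S n) (i' := .ω j) (by simp)
  rcases sq_eq_sq_iff_eq_or_eq_neg.1 (sub_eq_zero.1 e) with e | e
  · exact h.y_ne j (e ▸ hω)
  · exact h.y_ne j (e ▸ neg_mem hω)

theorem sgn_mul_self (n : ℤ) : sgn n * sgn n = 1 := by
  rw [sgn, ← mul_zpow]; simp

/-- For `q > 0` the value $u_n$ belongs to the independent data. For `q = 0` it does not, but if it
vanished, the sum equation would express $\varepsilon$ through the other data. -/
theorem IsGeneric.u_self_ne (hK : ConstantsIn K α δ t) {q : Fin r} (hq : IsLast t q)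
    {S : State m} {n : ℤ} (h : IsGeneric K q S n) (hs : SumEq δ t S n) : S.u n ≠ 0 := by
  rcases Nat.eq_zero_or_pos (q : ℕ) with h0 | h0
  · intro e
    have hF := hK.extend (window q S n '' {.ε}ᶜ)
    refine h.notMem .ε ?_
    have hs' : timeSum t S.u n + n - δ + sgn n * S.ε = ∑ j, S.y j n := hs
    have : S.ε = sgn n * (∑ j, S.y j n - timeSum t S.u n - n + δ) := by
      linear_combination sgn n * hs' - S.ε * sgn_mul_self n
    rw [window, this]
    refine mul_mem (sgn_mem _ n) (add_mem (sub_mem (sub_mem (sum_mem fun j _ => ?_)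
      (timeSum_mem hq _ hF.t n fun s h1 h2 => ?_)) (intCast_mem _ n)) hF.δ)
    · exact mem_extend_image (window q S n) (i' := .y j) (by simp)
    · have : s = n := by omega
      rw [this, e]
      exact zero_mem _
  · exact h.u_ne (by omega) (by omega)

/-- The backward step recovers the window at $n$ from the one at $n+1$, so the latter generates a
field containing equally many independent elements. -/
theorem IsGeneric.step (hα : ∀ j, α j ≠ 0) (hK : ConstantsIn K α δ t) {q : Fin r}
    (hq : IsLast t q) {S : State m} {n : ℤ} (h : IsGeneric K q S n) (hs : SumEq δ t S n)
    (hl : ∀ j, LocalEq α S j n) : IsGeneric K q S (n + 1) := by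
  have hun := h.u_self_ne hK hq hs
  refine h.algebraicIndependent ((windowIn_self q S (n + 1)).step_back (hK.extend _) hq hs hl
    (fun s h1 h2 => ?_) hun fun j => (u_ne_zero (hα j) (hl j) (h.sq_sub_ne j)).2.1)
  rcases eq_or_ne s n with rfl | h3
  · exact hun
  · exact h.u_ne (by omega) (by omega)

/-- A state with algebraically independent data in one point which solves the equations
has algebraically independent data in every point. -/
theorem IsGeneric.all [Nonempty (Fin m)] (hα : ∀ j, α j ≠ 0) (hK : ConstantsIn K α δ t)
    {q : Fin r} (hq : IsLast t q) {S : State m} (hS : IsSolution α δ t S) (hn : Nondegenerate S)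
    {n : ℤ} (h : IsGeneric K q S n) (n' : ℤ) : IsGeneric K q S n' :=
  h.algebraicIndependent ((windowIn_self q S n').all (hK.extend _) hα hq hS hn n)

theorem IsGeneric.congr {q : ℕ} {S T : State m} {n : ℤ} (h : IsGeneric K q S n)
    (hω : S.ω = T.ω) (hε : S.ε = T.ε) (hu : ∀ s, n - q ≤ s → s < n + q → S.u s = T.u s)
    (hy : ∀ j, S.y j n = T.y j n) (hy' : ∀ j, S.y j (n - 1) = T.y j (n - 1)) :
    IsGeneric K q T n := by
  have : window q S n = window q T n := by
    funext i
    rcases i with (⟨s, hs⟩ | j | j | j | _)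
    · rw [Finset.mem_Ico] at hs
      exact hu _ (by simp only; omega) (by simp only; omega)
    exacts [hy j, hy' j, congrFun hω j, hε]
  rwa [IsGeneric, ← this]

theorem IsGeneric.reflect {q : ℕ} {S : State m} {n : ℤ} (h : IsGeneric K q S n) :
    IsGeneric K q (reflect S) (1 - n) := by
  refine h.algebraicIndependent ?_
  have := (windowIn_self (K := K) q (Volterra.reflect S) (1 - n)).reflect
  rwa [reflect_reflect, sub_sub_cancel] at this

theorem SumEq.congr {q : Fin r} (hq : IsLast t q) {S T : State m} {n : ℤ} (h : SumEq δ t S n)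
    (hε : S.ε = T.ε) (hu : ∀ s, n - q ≤ s → s ≤ n + q → S.u s = T.u s)
    (hy : ∀ j, S.y j n = T.y j n) : SumEq δ t T n := by
  rw [SumEq, ← timeSum_congr hq n hu, ← hε, ← Finset.sum_congr rfl fun j _ => hy j]
  exact h

theorem LocalEq.congr {S T : State m} {j : Fin m} {n : ℤ} (h : LocalEq α S j n) (hω : S.ω = T.ω)
    (hu : S.u n = T.u n) (hy : ∀ s, n - 1 ≤ s → s ≤ n + 1 → S.y j s = T.y j s) :
    LocalEq α T j n := by
  rw [LocalEq, ← hu, ← hω, ← hy n (by omega) (by omega), ← hy (n + 1) (by omega) (by omega),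
    ← hy (n - 1) (by omega) (by omega)]
  exact h

/-- The state whose values `u_{n+q}`, `y^j_{n+1}` are computed from the equations at `n`. -/
def advance (α : Fin m → ℂ) (δ : ℂ) (t : Fin r → ℂ) (q : Fin r) (n : ℤ) (S : State m) : State m :=
  let u := Function.update S.u (n + q) ((∑ j, S.y j n - n + δ - sgn n * S.ε -
    timeSum t (Function.update S.u (n + q) 0) n) /
      (2 * ((q : ℂ) + 1) * t q * ∏ s ∈ Finset.range q, S.u (n + s)))
  { ω := S.ω
    ε := S.ε
    u := u
    y := fun j => Function.update (S.y j) (n + 1)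
      (α j * (S.y j n ^ 2 - S.ω j ^ 2) / (u n * (S.y j n + S.y j (n - 1))) - S.y j n) }

theorem advance_u {q : Fin r} {n : ℤ} {S : State m} {s : ℤ} (hs : s ≠ n + q) :
    (advance α δ t q n S).u s = S.u s := Function.update_of_ne hs _ _

theorem advance_y {q : Fin r} {n : ℤ} {S : State m} {j : Fin m} {s : ℤ} (hs : s ≠ n + 1) :
    (advance α δ t q n S).y j s = S.y j s := Function.update_of_ne hs _ _

theorem sumEq_advance {q : Fin r} (hq : IsLast t q) {n : ℤ} {S : State m}
    (hu : ∀ s : ℕ, s < q → S.u (n + s) ≠ 0) : SumEq δ t (advance α δ t q n S) n := by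
  have h1 : ∏ s ∈ Finset.range q, (advance α δ t q n S).u (n + s) =
      ∏ s ∈ Finset.range q, S.u (n + s) := Finset.prod_congr rfl fun s hs => by
    rw [Finset.mem_range] at hs
    exact advance_u (by omega)
  rw [SumEq, timeSum_top hq, h1, Finset.sum_congr rfl fun j _ => advance_y (by omega)]
  have hP : 2 * ((q : ℂ) + 1) * t q * (∏ s ∈ Finset.range q, S.u (n + s)) ≠ 0 :=
    mul_ne_zero (coeff_top_ne_zero hq) (Finset.prod_ne_zero_iff.2 fun s hs =>
      hu s (Finset.mem_range.1 hs))
  simp only [advance, Function.update_self, Function.update_idem]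
  rw [mul_div_cancel₀ _ hP]
  ring

theorem localEq_advance {q : Fin r} {n : ℤ} {S : State m} {j : Fin m}
    (hu : (advance α δ t q n S).u n ≠ 0) (hy : S.y j n + S.y j (n - 1) ≠ 0) :
    LocalEq α (advance α δ t q n S) j n := by
  rw [LocalEq, advance_y (s := n) (by omega), advance_y (s := n - 1) (by omega)]
  have : (advance α δ t q n S).y j (n + 1) = α j * (S.y j n ^ 2 - S.ω j ^ 2) /
      ((advance α δ t q n S).u n * (S.y j n + S.y j (n - 1))) - S.y j n :=
    Function.update_self _ _ _
  rw [this]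
  field_simp
  rw [sub_add_cancel]
  rfl

/-- The states that are computed from a state by solving the equations at `n`, …, `n + p - 1`. -/
def advances (α : Fin m → ℂ) (δ : ℂ) (t : Fin r → ℂ) (q : Fin r) (n : ℤ) (S : State m) :
    ℕ → State m
  | 0 => S
  | p + 1 => advance α δ t q (n + p) (advances α δ t q n S p)

theorem advances_ω (q : Fin r) (n : ℤ) (S : State m) (p : ℕ) :
    (advances α δ t q n S p).ω = S.ω := by
  induction p with
  | zero => rfl
  | succ p ih => exact ih

theorem advances_ε (q : Fin r) (n : ℤ) (S : State m) (p : ℕ) :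
    (advances α δ t q n S p).ε = S.ε := by
  induction p with
  | zero => rfl
  | succ p ih => exact ih

theorem advances_u {q : Fin r} {n : ℤ} {S : State m} {p p' : ℕ} (hp : p ≤ p') {s : ℤ}
    (hs : s < n + p + q) : (advances α δ t q n S p').u s = (advances α δ t q n S p).u s := by
  induction p', hp using Nat.le_induction with
  | base => rfl
  | succ k hk ih => rw [advances, advance_u (by omega), ih]

theorem advances_y {q : Fin r} {n : ℤ} {S : State m} {p p' : ℕ} (hp : p ≤ p') {j : Fin m} {s : ℤ}
    (hs : s < n + p + 1) : (advances α δ t q n S p').y j s = (advances α δ t q n S p).y j s := by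
  induction p', hp using Nat.le_induction with
  | base => rfl
  | succ k hk ih => rw [advances, advance_y (by omega), ih]

theorem IsGeneric.advance {q : Fin r} {n : ℤ} {S : State m} (h : IsGeneric K q S n) :
    IsGeneric K q (advance α δ t q n S) n :=
  h.congr rfl rfl (fun _ _ _ => (advance_u (by omega)).symm) (fun _ => (advance_y (by omega)).symm)
    fun _ => (advance_y (by omega)).symm

theorem advance_spec (hK : ConstantsIn K α δ t) {q : Fin r} (hq : IsLast t q)
    {n : ℤ} {S : State m} (h : IsGeneric K q S n) :
    SumEq δ t (advance α δ t q n S) n ∧ ∀ j, LocalEq α (advance α δ t q n S) j n := by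
  have hs : SumEq δ t (Volterra.advance α δ t q n S) n :=
    sumEq_advance hq fun s hs => h.u_ne (by omega) (by omega)
  exact ⟨hs, fun j => localEq_advance (h.advance.u_self_ne hK hq hs) (h.add_ne j)⟩

theorem isGeneric_advances (hα : ∀ j, α j ≠ 0) (hK : ConstantsIn K α δ t) {q : Fin r}
    (hq : IsLast t q) {n : ℤ} {S : State m} (h : IsGeneric K q S n) (p : ℕ) :
    IsGeneric K q (advances α δ t q n S p) (n + p) := by
  induction p with
  | zero => simpa [advances] using h
  | succ p ih =>
    have hs := advance_spec hK hq ih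
    have := ih.advance.step hα hK hq hs.1 hs.2
    rwa [add_assoc] at this

theorem exists_forward (hα : ∀ j, α j ≠ 0) (hK : ConstantsIn K α δ t) {q : Fin r}
    (hq : IsLast t q) {n : ℤ} {S : State m} (h : IsGeneric K q S n) :
    ∃ T : State m, T.ω = S.ω ∧ T.ε = S.ε ∧ (∀ s, s < n + q → T.u s = S.u s) ∧
      (∀ j s, s < n + 1 → T.y j s = S.y j s) ∧
      ∀ n', n ≤ n' → (∀ j, T.y j n' ^ 2 - T.ω j ^ 2 ≠ 0) ∧ SumEq δ t T n' ∧
        ∀ j, LocalEq α T j n' := by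
  -- Each value is read off at the first stage at which it is final: later steps change neither
  -- $u_s$ for $s<n+p+q$ nor $y_s$ for $s<n+p+1$.
  let T : State m :=
    { ω := S.ω
      ε := S.ε
      u := fun s => (advances α δ t q n S (s - n - q + 1).toNat).u s
      y := fun j s => (advances α δ t q n S (s - n).toNat).y j s }
  have hTu (p : ℕ) (s : ℤ) (hs : s < n + p + q) : (advances α δ t q n S p).u s = T.u s :=
    advances_u (by omega) (by omega)
  have hTy (p : ℕ) (j : Fin m) (s : ℤ) (hs : s < n + p + 1) :
      (advances α δ t q n S p).y j s = T.y j s :=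
    advances_y (by omega) (by omega)
  refine ⟨T, rfl, rfl, fun s hs => (hTu 0 s (by push_cast; omega)).symm,
    fun j s hs => (hTy 0 j s (by push_cast; omega)).symm, fun n' hn => ?_⟩
  obtain ⟨p, rfl⟩ := Int.le.dest hn
  have hg := isGeneric_advances hα hK hq h p
  obtain ⟨hs, hl⟩ := advance_spec hK hq hg
  refine ⟨fun j => ?_, ?_, fun j => ?_⟩
  · have := hg.sq_sub_ne j
    rwa [hTy p j _ (by omega), advances_ω] at this
  · exact hs.congr hq (advances_ε q n S (p + 1)) (fun s _ h2 => hTu (p + 1) s (by push_cast; omega))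
      fun j => hTy (p + 1) j _ (by push_cast; omega)
  · exact (hl j).congr (advances_ω q n S (p + 1)) (hTu (p + 1) _ (by push_cast; omega))
      fun s _ h2 => hTy (p + 1) j s (by push_cast; omega)

/-- A forward solution is glued to the reflection of a forward solution of the reflected system.
They share the initial window, $u_s$ for $-q\le s<q$ and $y_{-1},y_0$; an equation at $n\ge0$
involves only the first, an equation at $n\le-1$ only the second. -/
theorem exists_solution (hα : ∀ j, α j ≠ 0) (hK : ConstantsIn K α δ t) {q : Fin r}
    (hq : IsLast t q) {S : State m} (h : IsGeneric K q S 0) :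
    ∃ T : State m, IsSolution α δ t T ∧ Nondegenerate T ∧ IsGeneric K q T 0 := by
  obtain ⟨P, hPω, hPε, hPu, hPy, hP⟩ := exists_forward hα hK hq h
  have h1 := h.reflect
  rw [sub_zero] at h1
  obtain ⟨N', hNω, hNε, hNu', hNy', hN'⟩ := exists_forward hα hK.neg hq.neg h1
  let N := reflect N'
  have hN (n : ℤ) (hn : n ≤ -1) : (∀ j, N.y j n ^ 2 - N.ω j ^ 2 ≠ 0) ∧ SumEq δ t N n ∧
        ∀ j, LocalEq α N j n := by
    obtain ⟨h2, h3, h4⟩ := hN' (-n) (by omega)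
    refine ⟨fun j => ?_, ?_, fun j => ?_⟩
    · have := h2 j
      simpa [N, reflect] using this
    · simpa using h3.reflect
    · simpa using (h4 j).reflect
  have hNu (s : ℤ) (hs : -q ≤ s) : N.u s = S.u s := by
    have := hNu' (-s) (by omega)
    simpa [N, reflect] using this
  have hNy (j : Fin m) (s : ℤ) (hs : -1 ≤ s) : N.y j s = S.y j s := by
    have := hNy' j (-s) (by omega)
    simp only [N, reflect, this, neg_neg]
  let T : State m :=
    { ω := S.ω
      ε := S.ε
      u := fun s => if -q ≤ s then P.u s else N.u s
      y := fun j s => if -1 ≤ s then P.y j s else N.y j s }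
  have hTPu (s : ℤ) (hs : -q ≤ s) : P.u s = T.u s := by simp only [T, if_pos hs]
  have hTPy (j : Fin m) (s : ℤ) (hs : -1 ≤ s) : P.y j s = T.y j s := by
    simp only [T, if_pos hs]
  have hTNu (s : ℤ) (hs : s < q) : N.u s = T.u s := by
    by_cases h3 : -q ≤ s
    · rw [← hTPu s h3, hNu s h3, hPu s (by omega)]
    · simp only [T, if_neg h3]
  have hTNy (j : Fin m) (s : ℤ) (hs : s ≤ 0) : N.y j s = T.y j s := by
    by_cases h3 : -1 ≤ s
    · rw [← hTPy j s h3, hNy j s h3, hPy j s (by omega)]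
    · simp only [T, if_neg h3]
  have hNω' : N.ω = T.ω := hNω
  have hNε' : N.ε = T.ε := by
    change -N'.ε = S.ε
    rw [hNε]; exact neg_neg _
  have key (n : ℤ) : (∀ j, T.y j n ^ 2 - T.ω j ^ 2 ≠ 0) ∧ SumEq δ t T n ∧
      ∀ j, LocalEq α T j n := by
    rcases le_or_gt 0 n with hn | hn
    · obtain ⟨h2, h3, h4⟩ := hP n hn
      refine ⟨fun j => ?_, h3.congr hq hPε (fun s _ _ => hTPu s (by omega))
        (fun j => hTPy j n (by omega)), fun j => (h4 j).congr hPω (hTPu n (by omega))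
        fun s _ _ => hTPy j s (by omega)⟩
      have := h2 j
      rwa [hTPy j n (by omega), hPω] at this
    · obtain ⟨h2, h3, h4⟩ := hN n (by omega)
      refine ⟨fun j => ?_, h3.congr hq hNε' (fun s _ _ => hTNu s (by omega))
        (fun j => hTNy j n (by omega)), fun j => (h4 j).congr hNω' (hTNu n (by omega))
        fun s _ _ => hTNy j s (by omega)⟩
      have := h2 j
      rwa [hTNy j n (by omega), hNω'] at this
  have hT : IsSolution α δ t T := ⟨fun j n => (key n).2.2 j, fun n => (key n).2.1⟩
  refine ⟨T, hT, nondegenerate_of_ne hα hT fun j n => (key n).1 j, h.congr rfl rfl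
    (fun s h2 h3 => ?_) (fun j => ?_) fun j => ?_⟩
  · rw [← hTPu s (by omega), hPu s (by omega)]
  · rw [← hTPy j 0 (by omega), hPy j 0 (by omega)]
  · rw [← hTPy j _ (by omega), hPy j _ (by omega)]

theorem exists_isGeneric (K : Subfield ℂ) [Countable K] (q m : ℕ) :
    ∃ S : State m, IsGeneric K q S 0 := by
  obtain ⟨v, hv⟩ := exists_algebraicIndependent K (Slot q m)
  let S : State m :=
    { ω := fun j => v (.ω j)
      ε := v .ε
      u := fun s => if h : s ∈ Finset.Ico (-(q : ℤ)) q then v (.u ⟨s, h⟩) else 0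
      y := fun j n => if n = 0 then v (.y j) else v (.y' j) }
  have : window q S 0 = v := by
    funext i
    rcases i with (⟨s, hs⟩ | j | j | j | _)
    · simp only [window, S, zero_add, dif_pos hs]
    all_goals simp [window, S]
  exact ⟨S, by rwa [IsGeneric, this]⟩

end Generic

end Volterra

/-! ### Independence of the data survives the maps; regular solutions exist -/

namespace Volterra

section GenericSolution

variable {m r : ℕ} {α : Fin m → ℂ} {δ : ℂ} {t : Fin r → ℂ} {K F : Subfield ℂ} {q : Fin r}
  {S : State m}

/-- The nondegenerate solutions whose data in each point are algebraically independent. -/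
structure GenericSolution (K : Subfield ℂ) (α : Fin m → ℂ) (δ : ℂ) (t : Fin r → ℂ) (q : ℕ)
    (S : State m) : Prop where
  isSolution : IsSolution α δ t S
  nondegenerate : Nondegenerate S
  isGeneric : ∀ n, IsGeneric K q S n

theorem GenericSolution.A (hα : ∀ j, α j ≠ 0) (hS : GenericSolution K α δ t q S) (k : Fin m) :
    GenericSolution K α δ t q (A k S) := by
  have hsol := isSolution_A hS.isSolution k
  refine ⟨hsol, nondegenerate_of_ne hα hsol fun j n => ?_, fun n => ?_⟩
  · have h1 := (hS.nondegenerate j n).2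
    rcases eq_or_ne j k with rfl | hj
    · simpa [Volterra.A] using h1
    · simpa [Volterra.A, Function.update_of_ne hj] using h1
  · refine (hS.isGeneric n).algebraicIndependent ?_
    have h1 := windowIn_self (K := K) q (Volterra.A k S) n
    refine ⟨h1.u, h1.y, h1.y', fun j => ?_, h1.ε⟩
    have h2 := h1.ω j
    rcases eq_or_ne j k with rfl | hj
    · have := neg_mem h2
      simpa [Volterra.A] using this
    · simpa [Volterra.A, Function.update_of_ne hj] using h2

theorem aVar_mem {k : Fin m} {n : ℤ} (hy : S.y k n ∈ F) (hy' : S.y k (n - 1) ∈ F)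
    (hω : S.ω k ∈ F) : aVar k S n ∈ F :=
  div_mem (sub_mem hy hω) (add_mem hy hy')

/-- Let $F$ be generated over $K$ by all data at $n$ except $\omega^k$; then $a_n\notin F$, since it
determines $\omega^k$. The equality would force $a_n=1$, which nondegeneracy excludes, or one of
three rational expressions for $a_n$ over $F$. -/
theorem GenericSolution.ByOff_ne (hα : ∀ j, α j ≠ 0) (hinj : Function.Injective α)
    (hK : ConstantsIn K α δ t) (hS : GenericSolution K α δ t q S) {j k : Fin m} (hjk : j ≠ k)
    (n : ℤ) : ByOff α k S j n ≠ S.ω j := by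
  intro e
  have hn := hS.nondegenerate
  have hg := hS.isGeneric n
  have hmem (i : Slot q m) (hi : i ≠ .ω k) :
      window q S n i ∈ extend K (window q S n '' {.ω k}ᶜ) := mem_extend_image _ hi
  have hF := hK.extend (window q S n '' {.ω k}ᶜ)
  set F := extend K (window q S n '' {.ω k}ᶜ) with hFdef
  have hyk : S.y k n ∈ F := hmem (.y k) (by simp)
  have hyk' : S.y k (n - 1) ∈ F := hmem (.y' k) (by simp)
  have hyj : S.y j n ∈ F := hmem (.y j) (by simp)
  have hyj' : S.y j (n - 1) ∈ F := hmem (.y' j) (by simp)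
  have hωj : S.ω j ∈ F := hmem (.ω j) (by simpa using hjk)
  have hb : aVar j S n ∈ F := aVar_mem hyj hyj' hωj
  have ha : aVar k S n ∉ F := fun ha => hg.notMem (.ω k) (by
    have : S.ω k = S.y k n - aVar k S n * (S.y k n + S.y k (n - 1)) := by
      rw [← sub_eq_aVar_mul (hn.add_ne k n), sub_sub_cancel]
    rw [window, this]
    exact sub_mem hyk (mul_mem ha (add_mem hyk hyk')))
  have hαjk := hinj.ne hjk
  have h1 := ByOff_sub_eq hS.isSolution hn hαjk n
  rw [e, sub_self, mul_zero, eq_comm, mul_eq_zero, mul_eq_zero] at h1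
  rcases h1 with (h1 | h1) | h1
  · exact hn.one_sub_aVar_ne_zero k n h1
  · refine ha ?_
    have : aVar k S n = α j * aVar j S n / α k := by
      rw [eq_div_iff (hα k)]
      linear_combination -h1
    rw [this]
    exact div_mem (mul_mem (hF.α j) hb) (hF.α k)
  · have h2 := ByOff_add_eq hS.isSolution hn hαjk n
    rw [e, h1, mul_zero, mul_zero, mul_zero, eq_comm, mul_eq_zero, mul_eq_zero] at h2
    rcases h2 with h2 | h2 | h2
    · exact ha (sub_eq_zero.1 h2 ▸ hb)
    · exact hα j h2
    · refine ha ?_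
      rw [eq_div_of_mul_eq (hn.add_ne j n) (sub_eq_zero.1 h2)]
      exact div_mem (add_mem hyj hωj) (add_mem hyj hyj')

theorem GenericSolution.ByOff_sq_ne (hα : ∀ j, α j ≠ 0) (hinj : Function.Injective α)
    (hK : ConstantsIn K α δ t) (hS : GenericSolution K α δ t q S) {j k : Fin m} (hjk : j ≠ k)
    (n : ℤ) : ByOff α k S j n ^ 2 - S.ω j ^ 2 ≠ 0 := by
  intro e
  rcases sq_eq_sq_iff_eq_or_eq_neg.1 (sub_eq_zero.1 e) with e | e
  · exact hS.ByOff_ne hα hinj hK hjk n e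
  -- The formula for $\tilde y^j$ does not contain $\omega^j$, so the opposite sign is covered by
  -- passing to the image under $A_j$.
  · refine (hS.A hα j).ByOff_ne hα hinj hK hjk n ?_
    have h1 : (Volterra.A j S).ω j = -S.ω j := by simp [Volterra.A]
    have h2 : (Volterra.A j S).ω k = S.ω k := by simp [Volterra.A, Function.update_of_ne hjk.symm]
    rw [h1, ← e, ByOff, ByOff, h2]
    rfl

/-- The data of a solution at the point `n` in terms of the coefficients of the first order
operator of `B_k`. -/
def darbouxWindow (q : ℕ) (k : Fin m) (S : State m) (n : ℤ) : Slot q m → ℂ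
  | .u s => aVar k S (n + s)
  | .y j => if j = k then aVar k S (n + q) else S.y j n
  | .y' j => if j = k then aVar k S (n + q + 1) else S.y j (n - 1)
  | .ω j => S.ω j
  | .ε => S.ε

theorem aVar_mem_of_darbouxWindow {q : ℕ} {k : Fin m} {n : ℤ}
    (hu : ∀ s, darbouxWindow q k S n (.u s) ∈ F) (hy : darbouxWindow q k S n (.y k) ∈ F)
    (hy' : darbouxWindow q k S n (.y' k) ∈ F) (s : ℤ) (h1 : n - q ≤ s) (h2 : s ≤ n + q + 1) :
    aVar k S s ∈ F := by
  rcases lt_or_ge s (n + q) with h3 | h3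
  · have := hu ⟨s - n, Finset.mem_Ico.2 ⟨by omega, by omega⟩⟩
    rwa [darbouxWindow, add_sub_cancel] at this
  · rcases eq_or_ne s (n + q) with rfl | h4
    · simpa [darbouxWindow] using hy
    · obtain rfl : s = n + q + 1 := by omega
      simpa [darbouxWindow] using hy'

/-- The $2q+2$ coefficients $a_{n-q},\dots,a_{n+q+1}$ replace the $2q$ values of $u$ together with
$y^k_n,y^k_{n-1}$. They recover $u_{n-q},\dots,u_{n+q}$, then $y^k_n$ from the sum equation and
$y^k_{n-1}$ from $a_n$. -/
theorem GenericSolution.algebraicIndependent_darbouxWindow (hK : ConstantsIn K α δ t)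
    (hq : IsLast t q) (hS : GenericSolution K α δ t q S) (k : Fin m) (n : ℤ) :
    AlgebraicIndependent K (darbouxWindow q k S n) := by
  refine (hS.isGeneric n).algebraicIndependent ?_
  have hn := hS.nondegenerate
  have hmem (i : Slot q m) : darbouxWindow q k S n i ∈
      extend K (Set.range (darbouxWindow q k S n)) := mem_extend ⟨i, rfl⟩
  have hF := hK.extend (Set.range (darbouxWindow q k S n))
  set F := extend K (Set.range (darbouxWindow q k S n))
  have ha := aVar_mem_of_darbouxWindow (fun s => hmem (.u s)) (hmem (.y k)) (hmem (.y' k))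
  have hu (s : ℤ) (h1 : n - q ≤ s) (h2 : s ≤ n + q) : S.u s ∈ F := by
    rw [hS.isSolution.u_eq hn k]
    exact mul_mem (hF.α k) (mul_mem (ha s (by omega) (by omega))
      (sub_mem (one_mem F) (ha _ (by omega) (by omega))))
  have hyj (j : Fin m) (hj : j ≠ k) : S.y j n ∈ F := by
    simpa only [darbouxWindow, if_neg hj] using hmem (.y j)
  have hyj' (j : Fin m) (hj : j ≠ k) : S.y j (n - 1) ∈ F := by
    simpa only [darbouxWindow, if_neg hj] using hmem (.y' j)
  have hyk : S.y k n ∈ F := by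
    have h1 := hS.isSolution.sum_eq n
    rw [← Finset.add_sum_erase _ _ (Finset.mem_univ k)] at h1
    rw [← sub_eq_iff_eq_add.2 h1]
    exact sub_mem (add_mem (sub_mem (add_mem (timeSum_mem hq F hF.t n hu) (intCast_mem F n)) hF.δ)
      (mul_mem (sgn_mem F n) (hmem .ε)))
      (sum_mem fun j hj => hyj j (Finset.ne_of_mem_erase hj))
  have hyk' : S.y k (n - 1) ∈ F := by
    have h1 := sub_eq_aVar_mul (hn.add_ne k n)
    have h2 : S.y k (n - 1) = ((1 - aVar k S n) * S.y k n - S.ω k) / aVar k S n := by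
      rw [eq_div_iff (hn.aVar_ne_zero k n)]
      linear_combination -h1
    rw [h2]
    have := ha n (by omega) (by omega)
    exact div_mem (sub_mem (mul_mem (sub_mem (one_mem F) this) hyk) (hmem (.ω k))) this
  refine ⟨fun s h1 h2 => hu s h1 h2.le, fun j => ?_, fun j => ?_, fun j => hmem (.ω j), hmem .ε⟩
  · rcases eq_or_ne j k with rfl | hj
    exacts [hyk, hyj j hj]
  · rcases eq_or_ne j k with rfl | hj
    exacts [hyk', hyj' j hj]

/-- In the new coordinates $\tilde y^k_n$ is a rational expression that does not contain $\omega^k$,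
so it cannot equal $\pm(1-\omega^k)$. -/
theorem GenericSolution.ByDiag_sq_ne (hinj : Function.Injective α)
    (hK : ConstantsIn K α δ t) (hq : IsLast t q) (hS : GenericSolution K α δ t q S) (k : Fin m)
    (n : ℤ) : ByDiag α δ t k S n ^ 2 - (1 - S.ω k) ^ 2 ≠ 0 := by
  have hn := hS.nondegenerate
  have hnot : S.ω k ∉ extend K (darbouxWindow q k S n '' {.ω k}ᶜ) :=
    notMem_extend (hS.algebraicIndependent_darbouxWindow hK hq k n) (.ω k)
  have hmem (i : Slot q m) (hi : i ≠ .ω k) : darbouxWindow q k S n i ∈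
      extend K (darbouxWindow q k S n '' {.ω k}ᶜ) := mem_extend_image _ hi
  have hF := hK.extend (darbouxWindow q k S n '' {.ω k}ᶜ)
  generalize extend K (darbouxWindow q k S n '' {.ω k}ᶜ) = F at hnot hmem hF
  have ha := aVar_mem_of_darbouxWindow (fun s => hmem (.u s) (by simp)) (hmem (.y k) (by simp))
    (hmem (.y' k) (by simp))
  have hoff (j : Fin m) (hj : j ≠ k) : ByOff α k S j n ∈ F := by
    have hy : S.y j n ∈ F := by
      simpa only [darbouxWindow, if_neg hj] using hmem (.y j) (by simp)
    have hy' : S.y j (n - 1) ∈ F := by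
      simpa only [darbouxWindow, if_neg hj] using hmem (.y' j) (by simp)
    have hω : S.ω j ∈ F := hmem (.ω j) (by simpa using hj)
    have hb := aVar_mem hy hy' hω
    have hak := ha n (by omega) (by omega)
    have h1 := aVar_mul_ByOff hS.isSolution hn (hinj.ne hj) n
    rw [← mul_assoc] at h1
    rw [eq_div_of_mul_eq (mul_ne_zero (sub_ne_zero.2 (hinj.ne hj)) (hn.aVar_ne_zero k n))
      ((mul_comm _ _).trans h1)]
    exact div_mem (sub_mem (sub_mem (add_mem (mul_mem (hF.α j) (mul_mem hak hy))
      (mul_mem (hF.α k) (mul_mem hak hy))) (mul_mem (hF.α j) (mul_mem hb (add_mem hy hω))))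
      (mul_mem (hF.α k) (mul_mem (pow_mem hak 2) (add_mem hy hy'))))
      (mul_mem (sub_mem (hF.α j) (hF.α k)) hak)
  have hdiag : ByDiag α δ t k S n ∈ F := by
    rw [ByDiag]
    refine sub_mem (sub_mem (add_mem (add_mem (neg_mem (sum_mem fun j hj =>
      hoff j (Finset.ne_of_mem_erase hj))) (timeSum_mem hq F hF.t n fun s h1 h2 => ?_))
      (intCast_mem F n)) hF.δ) (mul_mem (sgn_mem F n) (hmem .ε (by simp)))
    rw [hS.isSolution.Bu_eq hn k]
    exact mul_mem (hF.α k) (mul_mem (sub_mem (one_mem F) (ha s (by omega) (by omega)))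
      (ha _ (by omega) (by omega)))
  intro e
  rcases sq_eq_sq_iff_eq_or_eq_neg.1 (sub_eq_zero.1 e) with e | e
  · exact hnot (by
      rw [show S.ω k = 1 - ByDiag α δ t k S n by rw [e]; ring]
      exact sub_mem (one_mem F) hdiag)
  · exact hnot (by
      rw [show S.ω k = 1 + ByDiag α δ t k S n by rw [e]; ring]
      exact add_mem (one_mem F) hdiag)

theorem B_mem (hF : ConstantsIn F α δ t) (hq : IsLast t q) (k : Fin m)
    (hu : ∀ n, S.u n ∈ F) (hy : ∀ j n, S.y j n ∈ F) (hω : ∀ j, S.ω j ∈ F) (hε : S.ε ∈ F) (n : ℤ) :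
    WindowIn F q (B α δ t k S) n := by
  have hBu (s : ℤ) : Bu k S s ∈ F :=
    div_mem (mul_mem (hu s) (mul_mem (sub_mem (hy k _) (hω k)) (add_mem (hy k _) (hω k))))
      (sub_mem (pow_mem (hy k s) 2) (pow_mem (hω k) 2))
  have hoff (j : Fin m) (s : ℤ) : ByOff α k S j s ∈ F :=
    mul_mem (div_mem (one_mem F) (sub_mem (hF.α j) (hF.α k)))
      (sub_mem (sub_mem (mul_mem (add_mem (hF.α j) (hF.α k)) (hy j s))
        (mul_mem (mul_mem (hF.α k) (add_mem (hy k s) (hω k)))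
          (div_mem (add_mem (hy j _) (hy j _)) (add_mem (hy k _) (hy k _)))))
        (mul_mem (mul_mem (hF.α k) (sub_mem (hy k s) (hω k)))
          (div_mem (add_mem (hy j _) (hy j _)) (add_mem (hy k _) (hy k _)))))
  have hdiag (s : ℤ) : ByDiag α δ t k S s ∈ F := by
    rw [ByDiag]
    exact sub_mem (sub_mem (add_mem (add_mem (neg_mem (sum_mem fun j _ => hoff j s))
      (timeSum_mem hq F hF.t s fun _ _ _ => hBu _)) (intCast_mem F s)) hF.δ)
      (mul_mem (sgn_mem F s) hε)
  have hBy (j : Fin m) (s : ℤ) : (B α δ t k S).y j s ∈ F := by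
    rcases eq_or_ne j k with rfl | hj
    · rw [B_y_self]; exact hdiag s
    · rw [B_y_of_ne hj]; exact hoff j s
  refine ⟨fun s _ _ => hBu s, fun j => hBy j n, fun j => hBy j _, fun j => ?_, neg_mem hε⟩
  rcases eq_or_ne j k with rfl | hj
  · rw [B_ω_self]; exact sub_mem (one_mem F) (hω j)
  · rw [B_ω_of_ne hj]; exact hω j

/-- Once the image is known to be nondegenerate, its window determines the whole image and $B_k$
leads back to $S$; hence the window of $S$ lies in the field generated by that of the image. -/
theorem GenericSolution.B (hα : ∀ j, α j ≠ 0) (hinj : Function.Injective α)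
    (hK : ConstantsIn K α δ t) (hq : IsLast t q) (hS : GenericSolution K α δ t q S) (k : Fin m) :
    GenericSolution K α δ t q (B α δ t k S) := by
  have : Nonempty (Fin m) := ⟨k⟩
  have hsol := isSolution_B hinj hS.isSolution hS.nondegenerate k
  have hn : Nondegenerate (Volterra.B α δ t k S) := nondegenerate_of_ne hα hsol fun j n => by
    rcases eq_or_ne j k with rfl | hj
    · rw [B_y_self, B_ω_self]; exact hS.ByDiag_sq_ne hinj hK hq j n
    · rw [B_y_of_ne hj, B_ω_of_ne hj]; exact hS.ByOff_sq_ne hα hinj hK hj n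
  refine ⟨hsol, hn, fun n => (hS.isGeneric n).algebraicIndependent ?_⟩
  have hF := hK.extend (Set.range (window q (Volterra.B α δ t k S) n))
  have hw := (windowIn_self (K := K) q (Volterra.B α δ t k S) n).all hF hα hq hsol hn
  have := B_mem hF hq k (S := Volterra.B α δ t k S) (fun s => ?_) (fun j s => (hw s).y j)
    (hw n).ω (hw n).ε n
  · rwa [B_B hinj hS.isSolution hS.nondegenerate hn] at this
  -- The windows contain no $u$ when `q = 0`, so $u_s$ is recovered from the coefficients of the
  -- first order operator.
  · have ha (s : ℤ) := aVar_mem ((hw s).y k) ((hw s).y' k) ((hw s).ω k)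
    rw [hsol.u_eq hn k]
    exact mul_mem (hF.α k) (mul_mem (ha s) (sub_mem (one_mem _) (ha (s + 1))))

theorem GenericSolution.applyWord (hα : ∀ j, α j ≠ 0) (hinj : Function.Injective α)
    (hK : ConstantsIn K α δ t) (hq : IsLast t q) (hS : GenericSolution K α δ t q S)
    (w : List (Fin m ⊕ Fin m)) : GenericSolution K α δ t q (applyWord α δ t w S) := by
  induction w with
  | nil => exact hS
  | cons l w ih =>
    rcases l with k | k
    · exact ih.A hα k
    · exact ih.B hα hinj hK hq k

/-- One generic solution serves for every $k$: an integer value of $2\omega^k$ would make $\omega^k$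
rational, although it is transcendental over $K$. -/
theorem exists_regular (hα : ∀ j, α j ≠ 0) (hinj : Function.Injective α) (ht : t ≠ 0)
    (k : Fin m) : ∃ S : Regular α δ t, ∀ n : ℤ, 2 * S.1.ω k ≠ n := by
  have : Nonempty (Fin m) := ⟨k⟩
  obtain ⟨q, hq⟩ := exists_isLast ht
  let X : Set ℂ := Set.range α ∪ {δ} ∪ Set.range t
  let K := Subfield.closure X
  have hK : ConstantsIn K α δ t :=
    ⟨fun j => Subfield.subset_closure (.inl (.inl ⟨j, rfl⟩)),
      Subfield.subset_closure (.inl (.inr rfl)), fun i => Subfield.subset_closure (.inr ⟨i, rfl⟩)⟩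
  have : Countable K := countable_closure X
    ((((Set.finite_range α).union (Set.finite_singleton δ)).union (Set.finite_range t)).countable)
  obtain ⟨S₀, hS₀⟩ := exists_isGeneric K q m
  obtain ⟨S, hS, hn, hg⟩ := exists_solution hα hK hq hS₀
  have hgen : GenericSolution K α δ t q S := ⟨hS, hn, hg.all hα hK hq hS hn⟩
  refine ⟨⟨S, hS, fun w => (hgen.applyWord hα hinj hK hq w).nondegenerate⟩, fun n e => ?_⟩
  refine hg.notMem (.ω k) ?_
  have : window q S 0 (.ω k) = n / 2 := by
    rw [window, eq_div_iff two_ne_zero, mul_comm]; exact e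
  rw [this]
  exact div_mem (intCast_mem _ n) (ofNat_mem _ 2)

end GenericSolution

end Volterra

end

theorem proposition6 (m r : ℕ) (α : Fin m → ℂ) (hα : ∀ j, α j ≠ 0)
    (hα_inj : Function.Injective α) (δ : ℂ) :
    -- the transformations preserve the form of the system
    (∀ (t : Fin r → ℂ) (k : Fin m) (S : Volterra.State m), Volterra.IsSolution α δ t S →
      Volterra.IsSolution α δ t (Volterra.A k S) ∧
      (Volterra.Nondegenerate S → Volterra.IsSolution α δ t (Volterra.B α δ t k S))) ∧
    -- they are consistent with the derivations with respect to the times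
    (∀ (t : Fin r → ℂ) (k : Fin m) (S : (Fin r → ℂ) → Volterra.State m),
      Volterra.IsSolution α δ t (S t) → Volterra.FlowsAt t S →
      Volterra.FlowsAt t (fun s => Volterra.A k (S s)) ∧
      (Volterra.Nondegenerate (S t) →
        Volterra.FlowsAt t (fun s => Volterra.B α δ s k (S s)))) ∧
    -- the relations between them
    (∀ (k : Fin m) (S : Volterra.State m), Volterra.A k (Volterra.A k S) = S) ∧
    (∀ (j k : Fin m) (S : Volterra.State m), j ≠ k →
      Volterra.A j (Volterra.A k S) = Volterra.A k (Volterra.A j S)) ∧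
    (∀ (t : Fin r → ℂ) (k : Fin m) (S : Volterra.State m), Volterra.IsSolution α δ t S →
      Volterra.Nondegenerate S → Volterra.Nondegenerate (Volterra.B α δ t k S) →
      Volterra.B α δ t k (Volterra.B α δ t k S) = S) ∧
    (∀ (t : Fin r → ℂ) (j k : Fin m) (S : Volterra.State m), j ≠ k →
      Volterra.IsSolution α δ t S →
      Volterra.Nondegenerate S → Volterra.Nondegenerate (Volterra.B α δ t k S) →
      Volterra.Nondegenerate (Volterra.B α δ t j S) →
      Volterra.B α δ t j (Volterra.B α δ t k S) =
        Volterra.B α δ t k (Volterra.B α δ t j S)) ∧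
    (∀ (t : Fin r → ℂ) (j k : Fin m) (S : Volterra.State m), j ≠ k →
      Volterra.A j (Volterra.B α δ t k S) = Volterra.B α δ t k (Volterra.A j S)) ∧
    -- the group generated by them
    (∀ t : Fin r → ℂ, t ≠ 0 →
      ∃ a b : Fin m → Equiv.Perm (Volterra.Regular α δ t),
        (∀ k S, (a k S).1 = Volterra.A k S.1) ∧
        (∀ k S, (b k S).1 = Volterra.B α δ t k S.1) ∧
        ∃ Φ : Subgroup.closure (Set.range a ∪ Set.range b) ≃* Volterra.ShiftSignGroup m,
          ∀ (g : Subgroup.closure (Set.range a ∪ Set.range b))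
            (S : Volterra.Regular α δ t) (k : Fin m),
            (g.1 S).1.ω k =
              (((Φ g).right k : ℤ) : ℂ) * S.1.ω k + (((Φ g).left.toAdd k : ℤ) : ℂ)) := by
  refine ⟨fun t k S hS => ⟨Volterra.isSolution_A hS k, fun h => Volterra.isSolution_B hα_inj hS h k⟩,
    fun t k S hS hF => ⟨Volterra.flowsAt_A hF k, fun h => Volterra.flowsAt_B hα_inj hS hF h k⟩,
    Volterra.A_A, fun j k S hjk => Volterra.A_comm hjk S,
    fun t k S hS h hT => Volterra.B_B hα_inj hS h hT,
    fun t j k S hjk hS h hT hU => Volterra.B_comm hα hα_inj hS h hjk hT hU,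
    fun t j k S hjk => Volterra.A_B hjk S, fun t ht => ?_⟩
  exact Volterra.exists_group_iso hα hα_inj (Volterra.exists_regular hα hα_inj ht)
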